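/- Let $r\ge 1$ and let $A,B\in\mathbb C^{r\times r}$ be Hermitian with $A$ nonsingular. For nonsingular $A_n$ ($n\ge1$) define matrix polynomials by $P_{-1}=0$, $P_0=I_r$, $xP_n=A_{n+1}P_{n+1}+BP_n+A_n^*P_{n-1}$ $(n\ge 0)$; a spectral measure of $(P_n)$ is a positive semidefinite matrix-valued measure $M$ on $\mathbb R$ with finite moments such that $\int P_n\,\mathrm dM\,P_m^*=\delta_{nm}I_r$ for all $n,m\ge0$ (so $\int \mathrm dM=I_r$). Let $W$ be the spectral measure for $A_n=A$ $(n\ge1)$ (matrix Chebyshev polynomials of the second kind), and $X$ the spectral measure for $A_1=\sqrt2A$, $A_n=A$ $(n\ge2)$ (first kind). Let $f(z,x)=\det(zA^*+B+z^{-1}A-xI_r)$. For $x\in\mathbb C$ order the $2r$ roots of $f(\cdot,x)$, counted with multiplicity, so that $|z_1(x)|\le\dots\le|z_{2r}(x)|$, and put $\Gamma_0=\{x\in\mathbb C:|z_r(x)|=|z_{r+1}(x)|\}$. By local data at a real point $x$ we mean: an open interval $\mathcal I\ni x$ with $\mathcal I\subset\Gamma_0$; an open set $\Omega\subset\mathbb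 C$ containing $\mathcal I$; analytic functions $z_1,\dots,z_{2r}$ on $\Omega$ which at each $y\in\Omega$ list all the roots of $f(\cdot,y)$ with multiplicity (no longer ordered by modulus) and satisfy $z_{2r+1-k}=z_k^{-1}$ for all $k$; the functions $w_k=z_k+z_k^{-1}$, $k=1,\dots,r$; and an invertible matrix $V(x)$ whose $k$-th column is a vector of Euclidean norm one in the null space of $w_k(x)A+B-xI_r$, $k=1,\dots,r$. Then for Lebesgue-almost every real $x\in\Gamma_0$ local data at $x$ exist and, for every choice of local data at $x$, the densities at $x$ of the absolutely continuous parts of $X$ and $W$ with respect to Lebesgue measure are $$\frac{\mathrm dX(x)}{\mathrm dx}=V(x)\Lambda_X(x)V(x)^{-1}A^{-1},\qquad \frac{\mathrm dW(x)}{\mathrm dx}=V(x)\Lambda_W(x)V(x)^{-1}A^{-1},$$ where $$\Lambda_X(x)=\frac1\pi\,\mathrm{diag}\left(\frac{\mathbf 1_{w_k(x)\in(-2,2)}}{\sqrt{4-w_k(x)^2}}\,\mathrm{sign}\,w_k'(x)\right)_{k=1}^r,\qquad \Lambda_W(x)=\frac1{2\pi}\,\mathrm{diag}\left(\mathbf 1_{w_k(x)\in(-2,2)}\sqrt{4-w_k(x)^2}\;\mathrm{sign}\,w_k'(x)\right)_{k=1}^r,$$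 and a diagonal entry is understood to be $0$ when $w_k(x)\notin(-2,2)$. -/

import Mathlib

namespace MatrixChebyshev

open MeasureTheory Matrix Polynomial
open scoped ComplexOrder

noncomputable section

/-! ### Matrix orthogonal polynomials and their spectral measures -/

/-- The matrix polynomials (as functions of a real variable) generated by
`x P_n = a_{n+1} P_{n+1} + b_n P_n + a_n^* P_{n-1}`, `P_{-1} = 0`, `P_0 = 1`.
The value `a 0` plays no role. -/
def orthPoly {r : ℕ} (a b : ℕ → Matrix (Fin r) (Fin r) ℂ) :
    ℕ → ℝ → Matrix (Fin r) (Fin r) ℂ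
  | 0, _ => 1
  | 1, x => (a 1)⁻¹ * ((x : ℂ) • 1 - b 0)
  | n + 2, x =>
      (a (n + 2))⁻¹ *
        (((x : ℂ) • 1 - b (n + 1)) * orthPoly a b (n + 1) x - (a (n + 1))ᴴ * orthPoly a b n x)

/-- The `(i, j)` entry of a matrix-valued measure, as a complex measure. -/
def entry {r : ℕ} (W : VectorMeasure ℝ (Matrix (Fin r) (Fin r) ℂ)) (i j : Fin r) :
    ComplexMeasure ℝ :=
  W.mapRange (Matrix.entryAddMonoidHom ℂ i j) (continuous_id.matrix_elem i j)

/-- `∫ f dν` for a complex-valued function `f` and a complex measure `ν`. -/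
def cintegral (f : ℝ → ℂ) (ν : ComplexMeasure ℝ) : ℂ :=
  ν.integral f (ContinuousLinearMap.mul ℝ ℂ)

/-- `W` is a spectral measure of the matrix polynomials `P_n` with recurrence coefficients
`a`, `b`: it takes positive semidefinite values, has finite moments, and
`∫ P_n dW P_m^* = δ_{nm} I`. For `n = m = 0` this contains the normalization `∫ dW = I`. -/
structure IsSpectralMeasure {r : ℕ} (a b : ℕ → Matrix (Fin r) (Fin r) ℂ)
    (W : VectorMeasure ℝ (Matrix (Fin r) (Fin r) ℂ)) : Prop where
  posSemidef : ∀ E : Set ℝ, MeasurableSet E → (W E).PosSemidef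
  moments : ∀ (i j : Fin r) (n : ℕ), (entry W i j).Integrable (fun x : ℝ => (x : ℂ) ^ n)
  orthonormal : ∀ (n m : ℕ) (i j : Fin r),
    ∑ k, ∑ l, cintegral (fun x => orthPoly a b n x i k * star (orthPoly a b m x j l))
        (entry W k l) =
      if n = m then (1 : Matrix (Fin r) (Fin r) ℂ) i j else 0

/-- The coefficients `A_n` of the matrix Chebyshev polynomials of the first kind:
`A_1 = √2 A` and `A_n = A` for `n ≥ 2`. -/
def chebFirst {r : ℕ} (A : Matrix (Fin r) (Fin r) ℂ) : ℕ → Matrix (Fin r) (Fin r) ℂ :=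
  fun n => if n = 1 then ((Real.sqrt 2 : ℝ) : ℂ) • A else A

/-- The coefficients `A_n` of the matrix Chebyshev polynomials of the second kind. -/
def chebSecond {r : ℕ} (A : Matrix (Fin r) (Fin r) ℂ) : ℕ → Matrix (Fin r) (Fin r) ℂ :=
  fun _ => A

/-- The density, with respect to Lebesgue measure, of the absolutely continuous part (in the
Lebesgue decomposition, entry by entry) of a matrix-valued measure. -/
def acDensity {r : ℕ} (W : VectorMeasure ℝ (Matrix (Fin r) (Fin r) ℂ)) (x : ℝ) :
    Matrix (Fin r) (Fin r) ℂ :=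
  Matrix.of fun i j => (entry W i j).rnDeriv volume x

/-! ### The algebraic equation -/

/-- `f(z, x) = det (z A^* + B + z⁻¹ A - x I)`. -/
def algFun {r : ℕ} (A B : Matrix (Fin r) (Fin r) ℂ) (z x : ℂ) : ℂ :=
  (z • Aᴴ + B + z⁻¹ • A - x • 1).det

/-- The polynomial `Z^r f(Z, x) = det (Z² A^* + Z (B - x I) + A)` in `Z`. -/
def clearedPoly {r : ℕ} (A B : Matrix (Fin r) (Fin r) ℂ) (x : ℂ) : ℂ[X] :=
  ((X : ℂ[X]) ^ 2 • Aᴴ.map C + (X : ℂ[X]) • (B - x • 1).map C + A.map C).det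

theorem eval_clearedPoly {r : ℕ} (A B : Matrix (Fin r) (Fin r) ℂ) (x z : ℂ) (hz : z ≠ 0) :
    (clearedPoly A B x).eval z = z ^ r * algFun A B z x := by
  have h : z ^ r = z ^ Fintype.card (Fin r) := by simp
  rw [clearedPoly, algFun, h, ← Matrix.det_smul, ← Polynomial.coe_evalRingHom, RingHom.map_det]
  congr 1
  ext i j
  simp
  field_simp
  ring

/-- `z` lists the roots of `f(·, x) = 0`, counted with their multiplicities. -/
def IsRootList {r : ℕ} (A B : Matrix (Fin r) (Fin r) ℂ) (x : ℂ) (z : Fin (2 * r) → ℂ) : Prop :=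
  (clearedPoly A B x).roots = Finset.univ.val.map z

/-- `Γ₀`: the `x` such that, the roots being ordered by increasing modulus, the `r`-th and the
`(r+1)`-st one have the same modulus (the list is indexed from `0`). -/
def Gamma0 {r : ℕ} (A B : Matrix (Fin r) (Fin r) ℂ) : Set ℂ :=
  {x | ∃ z : Fin (2 * r) → ℂ, IsRootList A B x z ∧ Monotone (fun k => ‖z k‖) ∧
    ∃ i j : Fin (2 * r), (i : ℕ) + 1 = r ∧ (j : ℕ) = r ∧ ‖z i‖ = ‖z j‖}

/-- For Hermitian `A`: the interval `(a, b)` lies in `Γ₀`, and `z` is a labelling of the roots of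
`f(·, x) = 0` by functions that are analytic on an open complex neighbourhood `Ω` of `(a, b)`, such
that the `k`-th function from the end is the inverse of the `k`-th one. The roots are not ordered
by modulus. -/
structure IsAnalyticLabelling {r : ℕ} (A B : Matrix (Fin r) (Fin r) ℂ) (a b : ℝ) (Ω : Set ℂ)
    (z : Fin (2 * r) → ℂ → ℂ) : Prop where
  subset_Gamma0 : ∀ x ∈ Set.Ioo a b, (x : ℂ) ∈ Gamma0 A B
  isOpen : IsOpen Ω
  subset_nhd : ∀ x ∈ Set.Ioo a b, (x : ℂ) ∈ Ω
  analytic : ∀ k, AnalyticOnNhd ℂ (z k) Ω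
  roots : ∀ x ∈ Ω, IsRootList A B x (fun k => z k x)
  pairing : ∀ x ∈ Ω, ∀ k, z k.rev x = (z k x)⁻¹

/-- `w_k = z_k + z_k⁻¹` for the first `r` of the `2r` functions `z_k`. -/
def wFun {r : ℕ} (z : Fin (2 * r) → ℂ → ℂ) (k : Fin r) (x : ℂ) : ℂ :=
  z (k.castLE (by omega)) x + (z (k.castLE (by omega)) x)⁻¹

/-- `V` is an invertible matrix whose `k`-th column is a vector of Euclidean norm one in the null
space of `w_k A + B - x I`. -/
structure IsNullVectorMatrix {r : ℕ} (A B : Matrix (Fin r) (Fin r) ℂ) (x : ℂ) (w : Fin r → ℂ)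
    (V : Matrix (Fin r) (Fin r) ℂ) : Prop where
  isUnit_det : IsUnit V.det
  norm_eq_one : ∀ k, ∑ i, ‖V i k‖ ^ 2 = 1
  null : ∀ k, (w k • A + B - x • 1) *ᵥ (fun i => V i k) = 0

/-! ### The diagonal factors -/

open Classical in
/-- The `k`-th diagonal entry is `1_{w_k ∈ (-2,2)} sign(w_k') / (π √(4 - w_k²))`; here `w'` lists
the derivatives, which are real wherever the indicator does not vanish. -/
def lambdaX {r : ℕ} (w w' : Fin r → ℂ) : Matrix (Fin r) (Fin r) ℂ :=
  Matrix.diagonal fun k =>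
    if ∃ t ∈ Set.Ioo (-2 : ℝ) 2, w k = (t : ℂ) then
      ((1 / Real.pi * (Real.sign (w' k).re / Real.sqrt (4 - (w k).re ^ 2)) : ℝ) : ℂ)
    else 0

open Classical in
/-- The `k`-th diagonal entry is `1_{w_k ∈ (-2,2)} sign(w_k') √(4 - w_k²) / (2π)`; here `w'` lists
the derivatives, which are real wherever the indicator does not vanish. -/
def lambdaW {r : ℕ} (w w' : Fin r → ℂ) : Matrix (Fin r) (Fin r) ℂ :=
  Matrix.diagonal fun k =>
    if ∃ t ∈ Set.Ioo (-2 : ℝ) 2, w k = (t : ℂ) then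
      ((1 / (2 * Real.pi) * (Real.sqrt (4 - (w k).re ^ 2) * Real.sign (w' k).re) : ℝ) : ℂ)
    else 0

end

end MatrixChebyshev

/-! The matrix Jacobi operator with off-diagonal blocks `α_n A` and diagonal blocks `B` is `J ⊗ A +
I ⊗ B`, where `J` is the scalar Jacobi matrix with coefficients `α_n` and `0`. In both cases `J` is
a Chebyshev matrix, that is, multiplication by `w` on `L²(ν)`, with `ν = ρ(w) dw` the arcsine law
(first kind) or the semicircle law (second kind) on `[-2, 2]`. The spectral measure is therefore the
integral against `ρ(w) dw` of the spectral measures of the Hermitian matrices `w A + B`. This is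
proved through moments: `IsSpectralMeasure.moment_eq` gives `∫ xⁿ dW = ∫ (w A + B)ⁿ dν`, and
`integral_eq_of_moments` passes to continuous functions, everything being compactly supported.

To find the density at `x`, note that `x` is an eigenvalue of `w A + B` iff `w` is an eigenvalue of
`M(x) = A⁻¹ (x - B)`. Off a finite set `M(x)` is diagonalizable with locally analytic eigenvalues
`φ_i` (`exists_localDiag`). Substituting `w = φ_i(x)` on the real branches gives the density `∑
ρ(φ_i) |φ_i'| E_i`, where `E_i` is the orthogonal projection onto the kernel of `φ_i A + B - x`;
nonreal branches do not contribute. The generally oblique spectral projection `Q_i` of `M(x)`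
satisfies `Q_i A⁻¹ = φ_i' E_i` (`LocalDiag.classProj_mul_inv_mulVec` with `mul_specSum_eq`). Hence
the density is `∑ ρ(φ_i) sign(φ_i') Q_i A⁻¹`, which is `V Λ V⁻¹ A⁻¹`.

Finally, `z` is a root of `f(·, x)` iff `z + z⁻¹` is an eigenvalue of `M(x)`. The functions `w_k` of
any labelling thus agree locally with branches `φ_i`, and `V Λ V⁻¹`, being a function of `M(x)`,
does not depend on the eigenvectors chosen. Local data exist because `z + z⁻¹ = φ_i` is analytically
solvable away from `φ_i = ±2`, and because a point lies in `Γ₀` exactly when some root has modulus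
one (`mem_Gamma0_iff`). -/

namespace MatrixChebyshev

open MeasureTheory Matrix Polynomial
open scoped ComplexOrder

/-! ### A generically separable polynomial annihilating `A⁻¹ (t - B)` -/

section AlgebraicPart

open Polynomial.Bivariate

/-- A monic polynomial over `F[X]` divides a power of a monic polynomial which is coprime to its
derivative up to a nonzero element of `F[X]`. -/
theorem exists_monic_dvd_pow_of_bezout {F : Type*} [Field F] [CharZero F] (χ : F[X][X])
    (hχ : χ.Monic) :
    ∃ q : F[X][X], q.Monic ∧ (∃ n, χ ∣ q ^ n) ∧
      ∃ (a b : F[X][X]) (d : F[X]), d ≠ 0 ∧ a * q + b * derivative q = C d := by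
  let K := FractionRing F[X]
  have : CharZero K := charZero_of_injective_algebraMap (IsFractionRing.injective F[X] K)
  -- Over the fraction field, `y` is a radical of `χ`; since `F[X]` is integrally closed, its monic
  -- multiple has coefficients in `F[X]`.
  obtain ⟨y, n, hy, hyd, hyn⟩ := exists_squarefree_dvd_pow_of_ne_zero
    (hχ.map (algebraMap F[X] K)).ne_zero
  obtain ⟨q, hq⟩ := IsIntegrallyClosed.eq_map_mul_C_of_dvd K hχ hyd
  have hy0 : y.leadingCoeff ≠ 0 := leadingCoeff_ne_zero.2 hy.ne_zero
  have hinj : Function.Injective (algebraMap F[X] K) := IsFractionRing.injective F[X] K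
  have hqm : (q.map (algebraMap F[X] K)).Monic := by
    have h := congrArg leadingCoeff hq
    rw [leadingCoeff_mul, leadingCoeff_C] at h
    exact mul_right_cancel₀ hy0 (h.trans (one_mul _).symm)
  have hq1 : q.Monic := Polynomial.monic_of_injective hinj hqm
  have hunit : IsUnit (C y.leadingCoeff : K[X]) := isUnit_C.2 hy0.isUnit
  have hsep : (q.map (algebraMap F[X] K)).Separable := by
    rw [PerfectField.separable_iff_squarefree]
    exact hy.squarefree_of_dvd ⟨_, hq.symm⟩
  refine ⟨q, hq1, ⟨n, ?_⟩, ?_⟩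
  · rw [← map_dvd_map _ hinj hχ, Polynomial.map_pow]
    refine hyn.trans ?_
    rw [← hq, mul_pow]
    exact ((hunit.pow n).dvd_mul_right).1 dvd_rfl
  -- Clearing the denominators `s`, `t` of the Bézout cofactors leaves `d = s * t`.
  · obtain ⟨a, b, hab⟩ := hsep
    obtain ⟨s, hs0, hs⟩ := IsLocalization.integerNormalization_spec (nonZeroDivisors F[X]) a
    obtain ⟨t, ht0, ht⟩ := IsLocalization.integerNormalization_spec (nonZeroDivisors F[X]) b
    refine ⟨C t * IsLocalization.integerNormalization (nonZeroDivisors F[X]) a,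
      C s * IsLocalization.integerNormalization (nonZeroDivisors F[X]) b, s * t,
      mul_ne_zero (nonZeroDivisors.ne_zero hs0) (nonZeroDivisors.ne_zero ht0), ?_⟩
    apply Polynomial.map_injective _ hinj
    simp only [Polynomial.map_add, Polynomial.map_mul, hs, ht, Polynomial.map_C,
      ← derivative_map, map_mul]
    rw [← mul_one (C (algebraMap F[X] K s) * C (algebraMap F[X] K t)), ← hab]
    have e1 : (s • a : K[X]) = C (algebraMap F[X] K s) * a := by
      ext i; simp [Algebra.smul_def]
    have e2 : (t • b : K[X]) = C (algebraMap F[X] K t) * b := by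
      ext i; simp [Algebra.smul_def]
    rw [e1, e2]
    ring

theorem aeval_mulVec_of_mulVec_eq_smul {n : Type*} [Fintype n] [DecidableEq n]
    {M : Matrix n n ℂ} {v : n → ℂ} {t : ℂ} (h : M *ᵥ v = t • v) (p : ℂ[X]) :
    aeval M p *ᵥ v = p.eval t • v := by
  induction p using Polynomial.induction_on' with
  | add p q hp hq => simp [Matrix.add_mulVec, hp, hq, add_smul]
  | monomial k a =>
    have hk : ∀ k : ℕ, (M ^ k) *ᵥ v = t ^ k • v := by
      intro k
      induction k with
      | zero => simp
      | succ k ih => rw [pow_succ', ← Matrix.mulVec_mulVec, ih, Matrix.mulVec_smul, h, smul_smul,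
          pow_succ]
    rw [aeval_monomial, ← Matrix.mulVec_mulVec, hk, eval_monomial, Matrix.mulVec_smul,
      Algebra.algebraMap_eq_smul_one, Matrix.smul_mulVec, Matrix.one_mulVec, smul_smul, mul_comm]

/-- A polynomial which vanishes at the eigenvalues of a Hermitian matrix annihilates it. -/
theorem aeval_eq_zero_of_isHermitian {n : Type*} [Fintype n] [DecidableEq n]
    {H : Matrix n n ℂ} (hH : H.IsHermitian) (p : ℂ[X])
    (h : ∀ t : ℂ, (H - t • 1).det = 0 → p.eval t = 0) : aeval H p = 0 := by
  have hv : ∀ j, aeval H p *ᵥ (hH.eigenvectorBasis j).ofLp = 0 := by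
    intro j
    have h1 : H *ᵥ (hH.eigenvectorBasis j).ofLp =
        (hH.eigenvalues j : ℂ) • (hH.eigenvectorBasis j).ofLp := hH.mulVec_eigenvectorBasis j
    have h2 : p.eval (hH.eigenvalues j : ℂ) = 0 := by
      apply h
      refine Matrix.exists_mulVec_eq_zero_iff.1 ⟨(hH.eigenvectorBasis j).ofLp, ?_, ?_⟩
      · intro h0
        have := hH.eigenvectorBasis.orthonormal.ne_zero j
        exact this (by ext i; exact congrFun h0 i)
      · rw [Matrix.sub_mulVec, h1, Matrix.smul_mulVec, Matrix.one_mulVec, sub_self]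
    rw [aeval_mulVec_of_mulVec_eq_smul h1, h2, zero_smul]
  have hlin : Matrix.mulVecLin (aeval H p) = 0 := by
    refine (hH.eigenvectorBasis.toBasis.map (WithLp.linearEquiv 2 ℂ (n → ℂ))).ext fun j => ?_
    simpa using hv j
  ext i j
  have := congrFun (LinearMap.congr_fun hlin (Pi.single j 1)) i
  simpa using this

theorem eval_aeval_matrix {n : Type*} [Fintype n] [DecidableEq n] (M : Matrix n n ℂ[X])
    (p : ℂ[X][X]) (w : ℂ) (i j : n) :
    ((aeval M p) i j).eval w =
      (aeval ((evalRingHom w).mapMatrix M) (p.map (evalRingHom w))) i j := by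
  have h : (evalRingHom w).mapMatrix (aeval M p) =
      aeval ((evalRingHom w).mapMatrix M) (p.map (evalRingHom w)) := by
    rw [aeval_def, aeval_def, hom_eval₂, eval₂_map]
    congr 1
    refine RingHom.ext fun x => Matrix.ext fun i j => ?_
    simp only [RingHom.comp_apply, RingHom.mapMatrix_apply, Matrix.map_apply,
      Matrix.algebraMap_matrix_apply, Algebra.algebraMap_self, RingHom.id_apply]
    split_ifs <;> simp
  have := congrFun (congrFun h i) j
  simpa using this

/-- A bivariate polynomial `q(x, w)` which vanishes whenever `x` is an eigenvalue of `w A + B`,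
`A`, `B` Hermitian, satisfies `q(w A + B, w) = 0` identically in `w`. -/
theorem aeval_pencil_eq_zero {n : Type*} [Fintype n] [DecidableEq n] {A B : Matrix n n ℂ}
    (hA : A.IsHermitian) (hB : B.IsHermitian) (q : ℂ[X][X])
    (hq : ∀ t w : ℂ, (w • A + B - t • 1).det = 0 → q.evalEval t w = 0) :
    aeval ((X : ℂ[X]) • A.map C + B.map C) (swap q) = 0 := by
  ext1 i j
  -- The entries are polynomials in `w`, so it suffices to treat real `w`, for which `w A + B` is
  -- Hermitian.
  refine Polynomial.eq_of_infinite_eval_eq _ _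
    (Set.Infinite.mono (s := Set.range ((↑) : ℝ → ℂ)) ?_
      (Set.infinite_range_of_injective Complex.ofReal_injective))
  rintro _ ⟨w, rfl⟩
  simp only [Set.mem_ofPred_eq, eval_aeval_matrix, Matrix.zero_apply, eval_zero]
  have hH : (evalRingHom (w : ℂ)).mapMatrix ((X : ℂ[X]) • A.map C + B.map C) =
      (w : ℂ) • A + B := by
    ext i j; simp; ring
  rw [hH, aeval_eq_zero_of_isHermitian]
  · simp
  · refine Matrix.IsHermitian.add ?_ hB
    rw [Matrix.IsHermitian, Matrix.conjTranspose_smul, hA.eq]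
    simp
  · intro t ht
    have := hq t w ht
    rwa [← coe_aevalAeval_eq_evalEval, ← Bivariate.aevalAeval_swap, coe_aevalAeval_eq_evalEval,
      ← map_evalRingHom_eval] at this

/-- In `q(x, w)` the outer variable is `w`; after `swap` it is `x`, so matrices over `ℂ[w]` can be
substituted for `x`. This is the case of a constant. -/
theorem aeval_C_swap (q : ℂ[X][X]) (t : ℂ) :
    aeval (C t : ℂ[X]) (swap q) = q.map (evalRingHom t) := by
  have h : ((aeval (C t : ℂ[X])).toRingHom).comp
      (swap (R := ℂ)).toAlgHom.toRingHom = mapRingHom (evalRingHom t) := by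
    ext <;> simp [swap_C_C, swap_X, swap_Y]
  exact RingHom.congr_fun h q

/-- If `q(w A + B, w) = 0` identically in `w` then `q(t, M) = 0` when `A M = t - B`. -/
theorem aeval_eq_zero_of_aeval_pencil {n : Type*} [Fintype n] [DecidableEq n]
    {A B M : Matrix n n ℂ} (q : ℂ[X][X])
    (hq : aeval ((X : ℂ[X]) • A.map C + B.map C) (swap q) = 0) (t : ℂ)
    (hM : A * M = t • 1 - B) : aeval M (q.map (evalRingHom t)) = 0 := by
  set H : Matrix n n ℂ[X] := (X : ℂ[X]) • A.map C + B.map C with hHdef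
  -- The scalar matrix `t` commutes with `H`, so `q(t, w) - q(H, w)` is a multiple of `t - H`, and
  -- `q(H, w) = 0`.
  have hfac : ∃ N : Matrix n n ℂ[X],
      aeval ((C t : ℂ[X]) • (1 : Matrix n n ℂ[X])) (swap q) = N * ((C t : ℂ[X]) • 1 - H) := by
    have hc : Commute ((C t : ℂ[X]) • (1 : Matrix n n ℂ[X])) H :=
      (Commute.one_left H).smul_left _
    refine ⟨∑ k ∈ Finset.range ((swap q).natDegree + 1),
      (algebraMap ℂ[X] (Matrix n n ℂ[X]) ((swap q).coeff k)) *
        ∑ i ∈ Finset.range k, ((C t : ℂ[X]) • (1 : Matrix n n ℂ[X])) ^ i * H ^ (k - 1 - i), ?_⟩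
    rw [← sub_zero (aeval ((C t : ℂ[X]) • (1 : Matrix n n ℂ[X])) (swap q)), ← hq, aeval_def,
      aeval_def, eval₂_eq_sum_range, eval₂_eq_sum_range, ← Finset.sum_sub_distrib, Finset.sum_mul]
    refine Finset.sum_congr rfl fun k _ => ?_
    rw [mul_assoc, hc.geom_sum₂_mul, mul_sub]
  obtain ⟨N, hN⟩ := hfac
  have hl : aeval ((C t : ℂ[X]) • (1 : Matrix n n ℂ[X])) (swap q) =
      (q.map (evalRingHom t)) • (1 : Matrix n n ℂ[X]) := by
    have h1 : ((C t : ℂ[X]) • (1 : Matrix n n ℂ[X])) = algebraMap ℂ[X] _ (C t) := by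
      rw [Algebra.algebraMap_eq_smul_one]
    rw [h1, aeval_algebraMap_apply, Algebra.algebraMap_eq_smul_one]
    rw [aeval_C_swap]
  have hr : (C t : ℂ[X]) • (1 : Matrix n n ℂ[X]) - H =
      - (A.map C * ((X : ℂ[X]) • 1 - M.map C)) := by
    have : A.map C * M.map C = (C t : ℂ[X]) • (1 : Matrix n n ℂ[X]) - B.map C := by
      rw [← Matrix.map_mul, hM]
      ext i j; by_cases hij : i = j <;> simp [hij]
    rw [mul_sub, this, hHdef, Matrix.mul_smul, mul_one]
    abel
  rw [hl, hr] at hN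
  -- As a polynomial with matrix coefficients, `q(t, X)` has the right factor `X - M`; evaluation at
  -- `M` kills it.
  have hN2 : (q.map (evalRingHom t)).map (algebraMap ℂ (Matrix n n ℂ)) =
      matPolyEquiv (-(N * A.map C)) * (X - C M) := by
    have hX : matPolyEquiv ((X : ℂ[X]) • (1 : Matrix n n ℂ[X]) - M.map C) = X - C M := by
      rw [map_sub, matPolyEquiv_smul_one, matPolyEquiv_map_C, Polynomial.map_X]
    rw [← hX, ← map_mul, ← matPolyEquiv_smul_one, hN, neg_mul, mul_neg, mul_assoc]
  have h0 := congrArg (eval M) hN2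
  rw [eval_mul_X_sub_C] at h0
  rwa [← eval_map_algebraMap]

/-- The matrix `A⁻¹ (t - B)`, whose eigenvalues are the roots `w` of `det (w A + B - t)`. -/
noncomputable def pencilMatrix {n : Type*} [Fintype n] [DecidableEq n] (A B : Matrix n n ℂ)
    (t : ℂ) : Matrix n n ℂ := A⁻¹ * (t • 1 - B)

theorem mul_pencilMatrix {n : Type*} [Fintype n] [DecidableEq n] {A : Matrix n n ℂ}
    (hA : A.det ≠ 0) (B : Matrix n n ℂ) (t : ℂ) : A * pencilMatrix A B t = t • 1 - B := by
  rw [pencilMatrix, ← mul_assoc, Matrix.mul_nonsing_inv _ hA.isUnit, one_mul]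

/-- The polynomial `q` is the radical, in `w`, of the characteristic polynomial of `A⁻¹ (x - B)`.
That matrix need not be diagonalizable, but `w A + B` is for real `w`, which gives `q(w A + B, w) =
0`; this identity transfers to `q(t, A⁻¹ (t - B)) = 0`. The Bézout relation makes `q(t, ·)`
separable wherever `d(t) ≠ 0`. -/
theorem exists_annihilating_poly {n : Type*} [Fintype n] [DecidableEq n] {A B : Matrix n n ℂ}
    (hA : A.IsHermitian) (hAdet : A.det ≠ 0) (hB : B.IsHermitian) :
    ∃ q : ℂ[X][X], q.Monic ∧
      (∃ (a b : ℂ[X][X]) (d : ℂ[X]), d ≠ 0 ∧ a * q + b * derivative q = C d) ∧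
      ∀ t : ℂ, aeval (pencilMatrix A B t) (q.map (evalRingHom t)) = 0 := by
  set M : Matrix n n ℂ[X] := A⁻¹.map C * ((X : ℂ[X]) • 1 - B.map C) with hM
  obtain ⟨q, hq, ⟨k, hk⟩, hbez⟩ := exists_monic_dvd_pow_of_bezout M.charpoly M.charpoly_monic
  refine ⟨q, hq, hbez, fun t => ?_⟩
  refine aeval_eq_zero_of_aeval_pencil q (aeval_pencil_eq_zero hA hB q fun t w h => ?_) t
    (mul_pencilMatrix hAdet B t)
  have hev : (evalRingHom t).mapMatrix M = pencilMatrix A B t := by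
    rw [hM, pencilMatrix, map_mul]
    congr 1
    · ext i j; simp
    · ext i j; by_cases hij : i = j <;> simp [hij]
  have hχ : M.charpoly.evalEval t w = 0 := by
    rw [← map_evalRingHom_eval, ← Matrix.charpoly_map]
    change (((evalRingHom t).mapMatrix M).charpoly).eval w = 0
    rw [hev, Matrix.eval_charpoly]
    have : (w • A + B - t • 1) = A * (Matrix.scalar n w - pencilMatrix A B t) := by
      rw [mul_sub, mul_pencilMatrix hAdet, Matrix.scalar_apply, ← Matrix.smul_one_eq_diagonal,
        Matrix.mul_smul, mul_one]
      abel
    rw [this, Matrix.det_mul] at h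
    exact (mul_eq_zero.1 h).resolve_left hAdet
  have := evalEval_dvd t w hk
  rw [hχ, zero_dvd_iff, evalEval_pow] at this
  exact eq_zero_of_pow_eq_zero this

end AlgebraicPart
end MatrixChebyshev

namespace MatrixChebyshev

open MeasureTheory Matrix Polynomial
open scoped ComplexOrder Topology

/-! ### Analytic local diagonalization of the pencil -/

section LocalStructure

/-- A simultaneous analytic diagonalization of the pencils `w A + B - t`, `t ∈ U`: the functions
`φ i`, `i : ι`, are analytic with distinct values at each point and list the `w` for which the
pencil is singular; the `k`-th column of `V t` is in the null space for `w = φ (κ k) t`. -/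
structure LocalDiag {r : ℕ} (A B : Matrix (Fin r) (Fin r) ℂ) {ι : Type} (κ : Fin r → ι)
    (φ : ι → ℂ → ℂ) (V : ℂ → Matrix (Fin r) (Fin r) ℂ) (U : Set ℂ) : Prop where
  isOpen : IsOpen U
  surjective : Function.Surjective κ
  analytic : ∀ i, AnalyticOnNhd ℂ (φ i) U
  injective : ∀ t ∈ U, Function.Injective fun i => φ i t
  continuousOn : ContinuousOn V U
  det_ne_zero : ∀ t ∈ U, (V t).det ≠ 0
  null : ∀ t ∈ U, ∀ k, (φ (κ k) t • A + B - t • 1) *ᵥ (fun i => V t i k) = 0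

theorem LocalDiag.mono {r : ℕ} {A B : Matrix (Fin r) (Fin r) ℂ} {ι : Type} {κ : Fin r → ι}
    {φ : ι → ℂ → ℂ} {V : ℂ → Matrix (Fin r) (Fin r) ℂ} {U U' : Set ℂ}
    (h : LocalDiag A B κ φ V U) (hU' : IsOpen U') (hsub : U' ⊆ U) : LocalDiag A B κ φ V U' where
  isOpen := hU'
  surjective := h.surjective
  analytic i := (h.analytic i).mono hsub
  injective t ht := h.injective t (hsub ht)
  continuousOn := h.continuousOn.mono hsub
  det_ne_zero t ht := h.det_ne_zero t (hsub ht)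
  null t ht := h.null t (hsub ht)

theorem contDiff_evalEval (q : ℂ[X][X]) {n : WithTop ℕ∞} :
    ContDiff ℂ n (fun u : ℂ × ℂ => q.evalEval u.1 u.2) := by
  induction q using Polynomial.induction_on' with
  | add p q hp hq => simpa [evalEval_add] using hp.add hq
  | monomial k a =>
    have : (fun u : ℂ × ℂ => (monomial k a).evalEval u.1 u.2) =
        fun u => aeval u.1 a * u.2 ^ k := by
      funext u
      simp [← C_mul_X_pow_eq_monomial, evalEval_mul, evalEval_pow, evalEval_C, evalEval_X,
        coe_aeval_eq_eval]
    rw [this]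
    exact ((contDiff_aeval a _).comp contDiff_fst).mul (contDiff_snd.pow k)

/-- A simple root of a polynomial with polynomial coefficients extends to an analytic root. -/
theorem exists_analytic_root (q : ℂ[X][X]) {t₀ w₀ : ℂ} (h0 : q.evalEval t₀ w₀ = 0)
    (h1 : (derivative q).evalEval t₀ w₀ ≠ 0) :
    ∃ φ : ℂ → ℂ, AnalyticAt ℂ φ t₀ ∧ φ t₀ = w₀ ∧ ∀ᶠ t in 𝓝 t₀, q.evalEval t (φ t) = 0 := by
  set F : ℂ × ℂ → ℂ := fun u => q.evalEval u.1 u.2 with hF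
  have hcd : ContDiffAt ℂ (⊤ : WithTop ℕ∞) F (t₀, w₀) := (contDiff_evalEval q).contDiffAt
  have hd : HasDerivAt (fun w => F (t₀, w)) ((derivative q).evalEval t₀ w₀) w₀ := by
    have := (q.map (evalRingHom t₀)).hasDerivAt w₀
    rw [derivative_map, map_evalRingHom_eval] at this
    simpa only [hF, ← map_evalRingHom_eval] using this
  have hdiff : HasFDerivAt F (fderiv ℂ F (t₀, w₀)) (t₀, w₀) :=
    (hcd.differentiableAt (by simp)).hasFDerivAt
  have hpart : fderiv ℂ F (t₀, w₀) ∘L .inr ℂ ℂ ℂ =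
      ContinuousLinearMap.toSpanSingleton ℂ ((derivative q).evalEval t₀ w₀) := by
    have e1 : HasFDerivAt (fun w => F (t₀, w)) (fderiv ℂ F (t₀, w₀) ∘L .inr ℂ ℂ ℂ) w₀ :=
      hdiff.comp w₀ (hasFDerivAt_prodMk_right t₀ w₀)
    exact e1.unique hd.hasFDerivAt
  have hinv : (fderiv ℂ F (t₀, w₀) ∘L .inr ℂ ℂ ℂ).IsInvertible := by
    rw [hpart]
    refine ⟨ContinuousLinearEquiv.unitsEquivAut ℂ (Units.mk0 _ h1), ?_⟩
    ext
    simp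
  refine ⟨hcd.implicitFunction (by simp) hinv, ?_, hcd.implicitFunction_apply_self _ hinv, ?_⟩
  · exact (hcd.contDiffAt_implicitFunction (by simp) hinv).analyticAt
  · have := hcd.eventually_apply_implicitFunction (by simp) hinv
    simpa [hF, h0] using this

theorem continuousOn_aeval_prod {n ι : Type*} [Fintype n] [DecidableEq n]
    {M : ℂ → Matrix n n ℂ} {φ : ι → ℂ → ℂ} {U : Set ℂ} (hM : ContinuousOn M U)
    (hφ : ∀ i, ContinuousOn (φ i) U) (s : Finset ι) :
    ContinuousOn (fun t => aeval (M t) (∏ j ∈ s, (X - C (φ j t)))) U := by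
  classical
  induction s using Finset.induction_on with
  | empty => simpa using continuousOn_const
  | insert a s ha ih =>
    simp only [Finset.prod_insert ha, map_mul, map_sub, aeval_X, aeval_C,
      Algebra.algebraMap_eq_smul_one]
    exact (hM.sub ((hφ a).smul continuousOn_const)).mul ih

theorem continuousOn_mulVec {n : Type*} [Fintype n] {M : ℂ → Matrix n n ℂ} {U : Set ℂ}
    (hM : ContinuousOn M U) (v : n → ℂ) : ContinuousOn (fun t => M t *ᵥ v) U :=
  (continuous_id.matrix_mulVec continuous_const).comp_continuousOn hM

/-- A matrix annihilated by a separable polynomial is semisimple, so its eigenvectors span and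
contain a basis. -/
theorem exists_eigenvector_basis {r : ℕ} (M : Matrix (Fin r) (Fin r) ℂ) (p : ℂ[X])
    (hp : p.Separable) (hM : aeval M p = 0) :
    ∃ (lam : Fin r → ℂ) (V : Matrix (Fin r) (Fin r) ℂ), V.det ≠ 0 ∧
      (∀ k, p.eval (lam k) = 0) ∧ ∀ k, M *ᵥ (fun i => V i k) = lam k • fun i => V i k := by
  have hss : Module.End.IsSemisimple (Matrix.toLin' M) := by
    refine Module.End.isSemisimple_of_squarefree_aeval_eq_zero hp.squarefree ?_
    have : aeval (Matrix.toLinAlgEquiv' M) p = Matrix.toLinAlgEquiv' (aeval M p) :=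
      aeval_algHom_apply (Matrix.toLinAlgEquiv' (R := ℂ) (n := Fin r)) M p
    rw [hM, map_zero] at this
    exact this
  have htop : ⊤ ≤ Submodule.span ℂ {v : Fin r → ℂ | ∃ μ : ℂ, M *ᵥ v = μ • v} := by
    rw [← Module.End.iSup_maxGenEigenspace_eq_top (Matrix.toLin' M)]
    refine iSup_le fun μ => ?_
    rw [hss.isFinitelySemisimple.maxGenEigenspace_eq_eigenspace]
    intro v hv
    rw [Module.End.mem_eigenspace_iff, Matrix.toLin'_apply] at hv
    exact Submodule.subset_span ⟨μ, hv⟩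
  let b := Module.Basis.ofSpan htop
  have hb : ∀ i, b i ∈ {v : Fin r → ℂ | ∃ μ : ℂ, M *ᵥ v = μ • v} := fun i =>
    Module.Basis.ofSpan_subset htop ⟨i, rfl⟩
  have := FiniteDimensional.fintypeBasisIndex b
  have hcard := Module.finrank_eq_card_basis b
  rw [Module.finrank_fin_fun] at hcard
  let e := Fintype.equivFinOfCardEq hcard.symm
  let b' := b.reindex e
  have hb' : ∀ k, ∃ μ : ℂ, M *ᵥ b' k = μ • b' k := fun k => by
    have := hb (e.symm k)
    simpa [b'] using this
  choose lam hlam using hb'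
  refine ⟨lam, Matrix.of fun i k => b' k i, ?_, fun k => ?_, fun k => hlam k⟩
  · have h : LinearIndependent ℂ (fun k => b' k) := b'.linearIndependent
    have h2 : IsUnit (Matrix.of fun i k => b' k i) := by
      rw [← Matrix.linearIndependent_cols_iff_isUnit]
      exact h
    exact ((Matrix.isUnit_iff_isUnit_det _).1 h2).ne_zero
  · have h := aeval_mulVec_of_mulVec_eq_smul (hlam k) p
    rw [hM, Matrix.zero_mulVec] at h
    exact (smul_eq_zero.1 h.symm).resolve_right (b'.ne_zero k)

theorem pencil_mulVec_eq_zero_iff {n : Type*} [Fintype n] [DecidableEq n] {A : Matrix n n ℂ}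
    (hA : A.det ≠ 0) (B : Matrix n n ℂ) (t w : ℂ) (v : n → ℂ) :
    (w • A + B - t • 1) *ᵥ v = 0 ↔ pencilMatrix A B t *ᵥ v = w • v := by
  have h : w • A + B - t • 1 = A * (w • 1 - pencilMatrix A B t) := by
    rw [mul_sub, mul_pencilMatrix hA, Matrix.mul_smul, mul_one]
    abel
  rw [h, ← Matrix.mulVec_mulVec]
  constructor
  · intro h0
    have := Matrix.eq_zero_of_mulVec_eq_zero hA h0
    rw [Matrix.sub_mulVec, Matrix.smul_mulVec, Matrix.one_mulVec, sub_eq_zero] at this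
    exact this.symm
  · intro h0
    rw [Matrix.sub_mulVec, Matrix.smul_mulVec, Matrix.one_mulVec, h0, sub_self, Matrix.mulVec_zero]

theorem continuous_pencilMatrix {n : Type*} [Fintype n] [DecidableEq n] (A B : Matrix n n ℂ) :
    Continuous (pencilMatrix A B) := by
  unfold pencilMatrix
  exact continuous_const.mul ((continuous_id.smul continuous_const).sub continuous_const)

/-- Off a finite set, the pencils `w A + B - t` have an analytic local diagonalization. -/
theorem exists_localDiag {r : ℕ} {A B : Matrix (Fin r) (Fin r) ℂ}
    (hA : A.IsHermitian) (hAdet : A.det ≠ 0) (hB : B.IsHermitian) :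
    ∃ d : ℂ[X], d ≠ 0 ∧ ∀ t₀ : ℂ, d.eval t₀ ≠ 0 →
      ∃ (ι : Type) (_ : Fintype ι) (κ : Fin r → ι) (φ : ι → ℂ → ℂ)
        (V : ℂ → Matrix (Fin r) (Fin r) ℂ) (U : Set ℂ), t₀ ∈ U ∧ LocalDiag A B κ φ V U := by
  classical
  obtain ⟨q, hq, ⟨a, b, d, hd, hbez⟩, hann⟩ := exists_annihilating_poly hA hAdet hB
  refine ⟨d, hd, fun t₀ ht₀ => ?_⟩
  set p : ℂ → ℂ[X] := fun t => q.map (evalRingHom t) with hp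
  have hsep : (p t₀).Separable := by
    have h := congrArg (Polynomial.map (evalRingHom t₀)) hbez
    rw [Polynomial.map_add, Polynomial.map_mul, Polynomial.map_mul, ← derivative_map,
      Polynomial.map_C, coe_evalRingHom] at h
    refine ⟨C (d.eval t₀)⁻¹ * a.map (evalRingHom t₀), C (d.eval t₀)⁻¹ * b.map (evalRingHom t₀), ?_⟩
    rw [mul_assoc, mul_assoc, ← mul_add, h, ← C_mul, inv_mul_cancel₀ ht₀, C_1]
  have hev : ∀ t w, (p t).eval w = q.evalEval t w := fun t w => map_evalRingHom_eval t w q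
  let S : Finset ℂ := (p t₀).roots.toFinset
  have hpm : ∀ t, (p t).Monic := fun t => hq.map _
  have hmemS : ∀ w, w ∈ S ↔ (p t₀).eval w = 0 := fun w => by
    simp [S, mem_roots (hpm t₀).ne_zero]
  have hdeg : ∀ t, (p t).natDegree = q.natDegree := fun t => hq.natDegree_map _
  have hScard : S.card = q.natDegree := by
    rw [Multiset.toFinset_card_of_nodup (nodup_roots hsep), ← hdeg t₀]
    exact (splits_iff_card_roots.1 (IsAlgClosed.splits (p t₀)))
  have hroot : ∀ s : S, ∃ φ : ℂ → ℂ, AnalyticAt ℂ φ t₀ ∧ φ t₀ = s ∧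
      ∀ᶠ t in 𝓝 t₀, q.evalEval t (φ t) = 0 := fun s => by
    have h0 : (p t₀).eval (s : ℂ) = 0 := (hmemS s).1 s.2
    refine exists_analytic_root q (by rw [← hev, h0]) ?_
    rw [← map_evalRingHom_eval, ← derivative_map]
    exact hsep.eval₂_derivative_ne_zero (RingHom.id ℂ) (by simpa using h0)
  choose φ hφa hφ0 hφr using hroot
  have hinj : ∀ᶠ t in 𝓝 t₀, Function.Injective fun s => φ s t := by
    have : ∀ i j : S, i ≠ j → ∀ᶠ t in 𝓝 t₀, φ i t ≠ φ j t := fun i j hij => by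
      have h : φ i t₀ - φ j t₀ ≠ 0 := by
        rw [hφ0, hφ0]
        exact sub_ne_zero.2 fun h => hij (Subtype.ext h)
      exact (((hφa i).continuousAt.sub (hφa j).continuousAt).eventually_ne h).mono
        fun t ht => sub_ne_zero.1 ht
    have h2 : ∀ᶠ t in 𝓝 t₀, ∀ i j : S, i ≠ j → φ i t ≠ φ j t := by
      simp only [Filter.eventually_all]
      exact this
    filter_upwards [h2] with t ht i j hij
    by_contra h
    exact ht i j h hij
  obtain ⟨lam, V₀, hV₀, hlam, hV₀e⟩ := exists_eigenvector_basis _ _ hsep (hann t₀)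
  let κ₀ : Fin r → S := fun k => ⟨lam k, (hmemS _).2 (hlam k)⟩
  -- Up to scale this is the Lagrange polynomial of the root `φ s t`. At the pencil matrix it maps
  -- every vector into the eigenspace of `φ s t`, and so moves the eigenvectors `V₀` continuously
  -- with `t`.
  let L : S → ℂ → ℂ[X] := fun s t => ∏ j ∈ Finset.univ.erase s, (X - C (φ j t))
  let V : ℂ → Matrix (Fin r) (Fin r) ℂ := fun t =>
    Matrix.of fun i k => (aeval (pencilMatrix A B t) (L (κ₀ k) t) *ᵥ fun i => V₀ i k) i
  obtain ⟨U₁, hU₁, hU₁o, hU₁t⟩ := eventually_nhds_iff.1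
    ((Filter.eventually_all.2 fun s => (hφa s).eventually_analyticAt).and
      (hinj.and (Filter.eventually_all.2 hφr)))
  have hVc : ContinuousOn V U₁ := by
    refine continuousOn_pi.2 fun i => continuousOn_pi.2 fun k => ?_
    exact continuousOn_pi.1 (continuousOn_mulVec (continuousOn_aeval_prod (U := U₁)
      (continuous_pencilMatrix A B).continuousOn
      (fun s t ht => ((hU₁ t ht).1 s).continuousAt.continuousWithinAt)
      (Finset.univ.erase (κ₀ k))) fun i => V₀ i k) i
  have hVdet : (V t₀).det ≠ 0 := by
    -- At `t₀` the columns of `V₀` are already eigenvectors and only get multiplied by the nonzero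
    -- values of `L`.
    have h1 : V t₀ = V₀ * diagonal (fun k => (L (κ₀ k) t₀).eval (lam k)) := by
      ext i k
      rw [Matrix.mul_diagonal]
      change (aeval (pencilMatrix A B t₀) (L (κ₀ k) t₀) *ᵥ fun i => V₀ i k) i = _
      rw [aeval_mulVec_of_mulVec_eq_smul (hV₀e k)]
      simp [mul_comm]
    rw [h1, Matrix.det_mul, Matrix.det_diagonal]
    refine mul_ne_zero hV₀ (Finset.prod_ne_zero_iff.2 fun k _ => ?_)
    simp only [L, eval_prod, eval_sub, eval_X, eval_C, hφ0]
    refine Finset.prod_ne_zero_iff.2 fun j hj => sub_ne_zero.2 fun h => ?_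
    exact (Finset.ne_of_mem_erase hj) (Subtype.ext h.symm)
  have hdet : ∀ᶠ t in 𝓝 t₀, (V t).det ≠ 0 := by
    have h : ContinuousAt (fun t => (V t).det) t₀ :=
      (continuous_id.matrix_det.continuousAt).comp (hVc.continuousAt (hU₁o.mem_nhds hU₁t))
    exact h.eventually_ne hVdet
  obtain ⟨U₂, hU₂, hU₂o, hU₂t⟩ := eventually_nhds_iff.1 hdet
  -- Passing to the range of `κ₀` ensures that every branch carries an eigenvector.
  refine ⟨Set.range κ₀, inferInstance, Set.rangeFactorization κ₀, fun i => φ i, V, U₁ ∩ U₂,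
    ⟨hU₁t, hU₂t⟩, hU₁o.inter hU₂o, Set.rangeFactorization_surjective,
    fun i t ht => (hU₁ t ht.1).1 i,
    fun t ht i j hij => Subtype.ext ((hU₁ t ht.1).2.1 hij), hVc.mono Set.inter_subset_left,
    fun t ht => hU₂ t ht.2, fun t ht k => ?_⟩
  rw [pencil_mulVec_eq_zero_iff hAdet, ← sub_eq_zero]
  obtain ⟨-, hti, htr⟩ := hU₁ t ht.1
  -- The branches are `deg q` distinct roots of the monic polynomial `p t`.
  have hprod : p t = ∏ s : S, (X - C (φ s t)) := by
    have hm : (∏ s : S, (X - C (φ s t))).Monic := monic_prod_X_sub_C _ _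
    have hdvd : (∏ s : S, (X - C (φ s t))) ∣ p t := by
      refine Finset.prod_dvd_of_coprime (fun i _ j _ hij => ?_) fun s _ => ?_
      · exact isCoprime_X_sub_C_of_isUnit_sub (sub_ne_zero.2 fun h => hij (hti h)).isUnit
      · rw [dvd_iff_isRoot, IsRoot, hev]
        exact htr s
    refine eq_of_monic_of_dvd_of_natDegree_le hm (hpm t) hdvd ?_
    rw [natDegree_prod_of_monic _ _ fun s _ => monic_X_sub_C _]
    simp [hdeg, hScard]
  have hfac : (X - C (φ (κ₀ k) t)) * L (κ₀ k) t = p t := by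
    rw [hprod]
    exact Finset.mul_prod_erase Finset.univ (fun s => X - C (φ s t)) (Finset.mem_univ _)
  have h0 := hann t
  change aeval _ (p t) = 0 at h0
  rw [← hfac, map_mul] at h0
  have h1 := congrArg (fun N => N *ᵥ fun i => V₀ i k) h0
  simp only [map_sub, aeval_X, aeval_C, ← Matrix.mulVec_mulVec, Matrix.zero_mulVec,
    Matrix.sub_mulVec, Algebra.algebraMap_eq_smul_one, Matrix.smul_mulVec,
    Matrix.one_mulVec] at h1
  exact h1

end LocalStructure
end MatrixChebyshev

namespace MatrixChebyshev

open MeasureTheory Matrix Polynomial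
open scoped ComplexOrder Topology

/-! ### Spectral projections of the pencil and derivatives of its eigenvalues -/

section SpectralProjections

variable {r : ℕ} {A B : Matrix (Fin r) (Fin r) ℂ} {ι : Type} {κ : Fin r → ι}
  {φ : ι → ℂ → ℂ} {V : ℂ → Matrix (Fin r) (Fin r) ℂ} {U : Set ℂ}

theorem LocalDiag.pencilMatrix_mul (h : LocalDiag A B κ φ V U) (hA : A.det ≠ 0) {t : ℂ}
    (ht : t ∈ U) : pencilMatrix A B t * V t = V t * diagonal fun k => φ (κ k) t := by
  ext i k
  have := congrFun ((pencil_mulVec_eq_zero_iff hA B t _ _).1 (h.null t ht k)) i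
  rw [Matrix.mul_diagonal, mul_comm]
  exact this

theorem LocalDiag.inv_mul (h : LocalDiag A B κ φ V U) {t : ℂ} (ht : t ∈ U) :
    (V t)⁻¹ * V t = 1 := Matrix.nonsing_inv_mul _ (h.det_ne_zero t ht).isUnit

theorem LocalDiag.mul_inv (h : LocalDiag A B κ φ V U) {t : ℂ} (ht : t ∈ U) :
    V t * (V t)⁻¹ = 1 := Matrix.mul_nonsing_inv _ (h.det_ne_zero t ht).isUnit

/-- The pencil matrix is diagonal in the basis of columns of `V t`, so an eigenvector has no
component along columns belonging to other eigenvalues. -/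
theorem LocalDiag.coeff_eq_zero (h : LocalDiag A B κ φ V U) (hA : A.det ≠ 0) {t w : ℂ}
    (ht : t ∈ U) {v : Fin r → ℂ} (hv : (w • A + B - t • 1) *ᵥ v = 0) {k : Fin r}
    (hk : φ (κ k) t ≠ w) : ((V t)⁻¹ *ᵥ v) k = 0 := by
  rw [pencil_mulVec_eq_zero_iff hA] at hv
  have h1 : (diagonal fun k => φ (κ k) t) *ᵥ ((V t)⁻¹ *ᵥ v) = w • ((V t)⁻¹ *ᵥ v) := by
    rw [← Matrix.mulVec_smul, ← hv, Matrix.mulVec_mulVec, Matrix.mulVec_mulVec]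
    congr 1
    have := congrArg (fun N => (V t)⁻¹ * N * (V t)⁻¹) (h.pencilMatrix_mul hA ht)
    rw [mul_assoc, mul_assoc, h.mul_inv ht, mul_one, ← mul_assoc, h.inv_mul ht, one_mul] at this
    exact this.symm
  have h2 := congrFun h1 k
  rw [Matrix.mulVec_diagonal, Pi.smul_apply, smul_eq_mul, ← sub_eq_zero, ← sub_mul] at h2
  exact (mul_eq_zero.1 h2).resolve_left (sub_ne_zero.2 hk)

theorem LocalDiag.exists_eq (h : LocalDiag A B κ φ V U) (hA : A.det ≠ 0) {t w : ℂ}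
    (ht : t ∈ U) {v : Fin r → ℂ} (hv : (w • A + B - t • 1) *ᵥ v = 0) (hv0 : v ≠ 0) :
    ∃ k, φ (κ k) t = w := by
  by_contra! hne
  apply hv0
  have h1 : (V t)⁻¹ *ᵥ v = 0 := funext fun k => h.coeff_eq_zero hA ht hv (hne k)
  have h2 := congrArg (fun u => V t *ᵥ u) h1
  simpa [Matrix.mulVec_mulVec, h.mul_inv ht] using h2

theorem LocalDiag.det_eq_zero_iff (h : LocalDiag A B κ φ V U) (hA : A.det ≠ 0) {t w : ℂ}
    (ht : t ∈ U) : (w • A + B - t • 1).det = 0 ↔ ∃ k, φ (κ k) t = w := by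
  constructor
  · intro h0
    obtain ⟨v, hv0, hv⟩ := Matrix.exists_mulVec_eq_zero_iff.2 h0
    exact h.exists_eq hA ht hv hv0
  · rintro ⟨k, rfl⟩
    refine Matrix.exists_mulVec_eq_zero_iff.1 ⟨_, ?_, h.null t ht k⟩
    intro h0
    have h1 : (V t).col k = 0 := h0
    apply h.det_ne_zero t ht
    exact Matrix.det_eq_zero_of_column_eq_zero k fun i => congrFun h1 i

theorem isHermitian_pencil (hA : A.IsHermitian) (hB : B.IsHermitian) {w : ℂ}
    (hw : star w = w) (x : ℝ) : (w • A + B - (x : ℂ) • 1).IsHermitian := by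
  rw [Matrix.IsHermitian, conjTranspose_sub, conjTranspose_add, conjTranspose_smul,
    conjTranspose_smul, hA.eq, hB.eq, hw]
  simp

theorem det_pencil_star (hA : A.IsHermitian) (hB : B.IsHermitian) (x : ℝ) (w : ℂ) :
    (star w • A + B - (x : ℂ) • 1).det = star (w • A + B - (x : ℂ) • 1).det := by
  rw [← Matrix.det_conjTranspose, conjTranspose_sub, conjTranspose_add, conjTranspose_smul,
    conjTranspose_smul, hA.eq, hB.eq]
  simp

open Classical in
/-- The projection onto the span of the columns of `V` in the `i`-th class. -/
noncomputable def classProj (κ : Fin r → ι) (V : Matrix (Fin r) (Fin r) ℂ) (i : ι) :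
    Matrix (Fin r) (Fin r) ℂ := V * diagonal (fun k => if κ k = i then 1 else 0) * V⁻¹

theorem LocalDiag.classProj_mulVec (h : LocalDiag A B κ φ V U) (hA : A.det ≠ 0) {t : ℂ}
    (ht : t ∈ U) (i : ι) {v : Fin r → ℂ} (hv : (φ i t • A + B - t • 1) *ᵥ v = 0) :
    classProj κ (V t) i *ᵥ v = v := by
  classical
  rw [classProj, ← Matrix.mulVec_mulVec, ← Matrix.mulVec_mulVec]
  have : (diagonal fun k => if κ k = i then (1 : ℂ) else 0) *ᵥ ((V t)⁻¹ *ᵥ v) =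
      (V t)⁻¹ *ᵥ v := by
    funext k
    rw [Matrix.mulVec_diagonal]
    by_cases hk : κ k = i
    · simp [hk]
    · have : φ (κ k) t ≠ φ i t := fun e => hk (h.injective t ht e)
      rw [h.coeff_eq_zero hA ht hv this, mul_zero]
  rw [this, Matrix.mulVec_mulVec, h.mul_inv ht, Matrix.one_mulVec]

theorem LocalDiag.pencil_mul_mul_diagonal (h : LocalDiag A B κ φ V U) {t : ℂ}
    (ht : t ∈ U) (i : ι) (c : Fin r → ℂ) (hc : ∀ k, κ k ≠ i → c k = 0) :
    (φ i t • A + B - t • 1) *ᵥ (V t *ᵥ c) = 0 := by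
  have : V t *ᵥ c = ∑ k, c k • fun i => V t i k := by
    funext i
    simp [Matrix.mulVec, dotProduct, mul_comm]
  rw [this, Matrix.mulVec_sum]
  refine Finset.sum_eq_zero fun k _ => ?_
  rw [Matrix.mulVec_smul]
  by_cases hk : κ k = i
  · rw [← hk, h.null t ht k, smul_zero]
  · rw [hc k hk, zero_smul]

theorem LocalDiag.pencil_mulVec_classProj (h : LocalDiag A B κ φ V U) {t : ℂ}
    (ht : t ∈ U) (i : ι) (v : Fin r → ℂ) :
    (φ i t • A + B - t • 1) *ᵥ (classProj κ (V t) i *ᵥ v) = 0 := by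
  classical
  rw [classProj, ← Matrix.mulVec_mulVec, ← Matrix.mulVec_mulVec]
  refine h.pencil_mul_mul_diagonal ht i _ fun k hk => ?_
  rw [Matrix.mulVec_diagonal, if_neg hk, zero_mul]

/-- The pencil matrix is self-adjoint for the possibly indefinite Hermitian form `A`. Eigenvectors
for the real number `φ i x` are therefore `A`-orthogonal to those for other eigenvalues, so the Gram
matrix `G` commutes with `E`. -/
theorem LocalDiag.mul_classProj (h : LocalDiag A B κ φ V U) (hA : A.IsHermitian)
    (hAdet : A.det ≠ 0) (hB : B.IsHermitian) {x : ℝ} (hx : (x : ℂ) ∈ U) (i : ι)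
    (hi : star (φ i x) = φ i x) :
    A * classProj κ (V x) i = (classProj κ (V x) i)ᴴ * A := by
  classical
  set E : Matrix (Fin r) (Fin r) ℂ := diagonal (fun k => if κ k = i then (1 : ℂ) else 0) with hE
  set D : Matrix (Fin r) (Fin r) ℂ := diagonal (fun k => φ (κ k) x) with hD
  set G := (V x)ᴴ * A * V x with hG
  have hAM : A * pencilMatrix A B x = (pencilMatrix A B x)ᴴ * A := by
    have h1 := mul_pencilMatrix hAdet B x
    have h2 := congrArg conjTranspose h1
    rw [conjTranspose_mul, hA.eq] at h2
    rw [h1, h2, conjTranspose_sub, hB.eq]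
    simp
  have hGD : G * D = Dᴴ * G := by
    rw [hG, mul_assoc, hD, ← h.pencilMatrix_mul hAdet hx, mul_assoc, ← mul_assoc A, hAM,
      mul_assoc (pencilMatrix A B x)ᴴ, ← mul_assoc (V x)ᴴ, ← conjTranspose_mul,
      h.pencilMatrix_mul hAdet hx, conjTranspose_mul]
    simp only [mul_assoc]
  have hGE : G * E = E * G := by
    ext j k
    rw [hE, Matrix.mul_diagonal, Matrix.diagonal_mul]
    have h1 := congrFun (congrFun hGD j) k
    rw [hD, diagonal_conjTranspose, Matrix.mul_diagonal, Matrix.diagonal_mul, Pi.star_apply] at h1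
    by_cases hj : κ j = i <;> by_cases hk : κ k = i <;> simp only [hj, hk, if_true, if_false]
    · ring
    · have hne : φ (κ k) x ≠ star (φ (κ j) x) := by
        rw [hj, hi]; exact fun e => hk (h.injective _ hx e)
      have : G j k = 0 := by
        have h2 : (φ (κ k) x - star (φ (κ j) x)) * G j k = 0 := by rw [sub_mul, ← h1]; ring
        exact (mul_eq_zero.1 h2).resolve_left (sub_ne_zero.2 hne)
      rw [this]; ring
    · have hne : φ (κ k) x ≠ star (φ (κ j) x) := by
        rw [hk, ← hi]; exact fun e => hj (h.injective _ hx (star_injective e)).symm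
      have : G j k = 0 := by
        have h2 : (φ (κ k) x - star (φ (κ j) x)) * G j k = 0 := by rw [sub_mul, ← h1]; ring
        exact (mul_eq_zero.1 h2).resolve_left (sub_ne_zero.2 hne)
      rw [this]; ring
    · ring
  have hEE : Eᴴ = E := by
    rw [hE, diagonal_conjTranspose]
    congr 1
    funext k
    simp only [Pi.star_apply]
    split_ifs <;> simp
  have hQV : classProj κ (V x) i * V x = V x * E := by
    rw [classProj, mul_assoc, h.inv_mul hx, mul_one]
  have key : (V x)ᴴ * (A * classProj κ (V x) i) * V x =
      (V x)ᴴ * ((classProj κ (V x) i)ᴴ * A) * V x := by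
    rw [← mul_assoc (V x)ᴴ (classProj κ (V x) i)ᴴ, ← conjTranspose_mul, hQV, conjTranspose_mul,
      hEE, mul_assoc, mul_assoc A, hQV, ← mul_assoc A, ← mul_assoc, ← mul_assoc, ← hG, hGE, hG]
    simp only [mul_assoc]
  have hinv : ((V x)⁻¹)ᴴ * (V x)ᴴ = 1 := by
    rw [← conjTranspose_mul, h.mul_inv hx, conjTranspose_one]
  have := congrArg (fun N => ((V x)⁻¹)ᴴ * N * (V x)⁻¹) key
  rwa [mul_assoc, mul_assoc, h.mul_inv hx, mul_one, ← mul_assoc, hinv, one_mul,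
    mul_assoc, mul_assoc, h.mul_inv hx, mul_one, ← mul_assoc, hinv, one_mul] at this

/-- The derivative of an eigenvalue `w` of the pencil at a real point. -/
theorem LocalDiag.deriv_mul_dotProduct (h : LocalDiag A B κ φ V U) (hA : A.IsHermitian)
    (hAdet : A.det ≠ 0) (hB : B.IsHermitian) {x : ℝ} (hx : (x : ℂ) ∈ U) (i : ι)
    (hi : star (φ i x) = φ i x) {u v : Fin r → ℂ}
    (hu : (φ i x • A + B - (x : ℂ) • 1) *ᵥ u = 0) (hv : (φ i x • A + B - (x : ℂ) • 1) *ᵥ v = 0) :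
    deriv (φ i) x * (star u ⬝ᵥ A *ᵥ v) = star u ⬝ᵥ v := by
  set c := (V x)⁻¹ *ᵥ v with hc
  have hc0 : ∀ k, κ k ≠ i → c k = 0 := fun k hk =>
    h.coeff_eq_zero hAdet hx hv fun e => hk (h.injective _ hx e)
  have hvx : V x *ᵥ c = v := by rw [hc, Matrix.mulVec_mulVec, h.mul_inv hx, Matrix.one_mulVec]
  have hu' : star u ᵥ* (φ i x • A + B - (x : ℂ) • 1) = 0 := by
    have := congrArg star hu
    rw [Matrix.star_mulVec, (isHermitian_pencil hA hB hi x).eq, star_zero] at this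
    exact this
  have hVc : ContinuousAt (fun y => V y *ᵥ c) x :=
    (continuousOn_mulVec h.continuousOn c).continuousAt (h.isOpen.mem_nhds hx)
  -- First-order perturbation in difference-quotient form: the eigenvector `V y *ᵥ c` extending `v`
  -- is only known to be continuous, and pairing with the left null vector `star u` removes its
  -- variation.
  have hslope : ∀ᶠ y in 𝓝[≠] (x : ℂ),
      slope (φ i) x y * (star u ⬝ᵥ A *ᵥ (V y *ᵥ c)) = star u ⬝ᵥ (V y *ᵥ c) := by
    filter_upwards [self_mem_nhdsWithin, nhdsWithin_le_nhds (h.isOpen.mem_nhds hx)] with y hy hyU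
    have hy0 : y - x ≠ 0 := sub_ne_zero.2 hy
    have h1 := h.pencil_mul_mul_diagonal hyU i c hc0
    have h2 : star u ⬝ᵥ (φ i x • A + B - (x : ℂ) • 1) *ᵥ (V y *ᵥ c) = 0 := by
      rw [Matrix.dotProduct_mulVec, hu', zero_dotProduct]
    have h3 : star u ⬝ᵥ (φ i y • A + B - y • 1) *ᵥ (V y *ᵥ c) = 0 := by
      rw [h1, dotProduct_zero]
    simp only [Matrix.sub_mulVec, Matrix.add_mulVec, Matrix.smul_mulVec, Matrix.one_mulVec,
      dotProduct_sub, dotProduct_add, dotProduct_smul, smul_eq_mul] at h2 h3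
    rw [slope_def_field]
    field_simp
    linear_combination h3 - h2
  have hA1 : Filter.Tendsto (fun y => star u ⬝ᵥ A *ᵥ (V y *ᵥ c)) (𝓝[≠] (x : ℂ))
      (𝓝 (star u ⬝ᵥ A *ᵥ v)) := by
    have : ContinuousAt (fun y => star u ⬝ᵥ A *ᵥ (V y *ᵥ c)) x :=
      ((continuous_const (y := star u)).dotProduct
        (continuous_const.matrix_mulVec continuous_id)).continuousAt.comp hVc
    have := this.tendsto
    rw [hvx] at this
    exact this.mono_left nhdsWithin_le_nhds
  have hA2 : Filter.Tendsto (fun y => star u ⬝ᵥ (V y *ᵥ c)) (𝓝[≠] (x : ℂ))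
      (𝓝 (star u ⬝ᵥ v)) := by
    have : ContinuousAt (fun y => star u ⬝ᵥ (V y *ᵥ c)) x :=
      ((continuous_const (y := star u)).dotProduct continuous_id).continuousAt.comp hVc
    have := this.tendsto
    rw [hvx] at this
    exact this.mono_left nhdsWithin_le_nhds
  have hd : Filter.Tendsto (slope (φ i) x) (𝓝[≠] (x : ℂ)) (𝓝 (deriv (φ i) x)) :=
    hasDerivAt_iff_tendsto_slope.1 ((h.analytic i) x hx).differentiableAt.hasDerivAt
  exact tendsto_nhds_unique ((hd.mul hA1).congr' hslope) hA2

/-- In the derivative formula with `u = v ≠ 0` both quadratic forms are real, and the right-hand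
side is nonzero. -/
theorem LocalDiag.deriv_real (h : LocalDiag A B κ φ V U) (hA : A.IsHermitian)
    (hAdet : A.det ≠ 0) (hB : B.IsHermitian) {x : ℝ} (hx : (x : ℂ) ∈ U) (i : ι)
    (hi : star (φ i x) = φ i x) :
    deriv (φ i) x = ((deriv (φ i) x).re : ℂ) ∧ (deriv (φ i) x).re ≠ 0 := by
  obtain ⟨k, rfl⟩ := h.surjective i
  set v : Fin r → ℂ := fun i => V x i k with hvdef
  have hv := h.null x hx k
  have hv0 : v ≠ 0 := fun h0 =>
    h.det_ne_zero x hx (Matrix.det_eq_zero_of_column_eq_zero k fun i => congrFun h0 i)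
  have key := h.deriv_mul_dotProduct hA hAdet hB hx (κ k) hi hv hv
  have h1 : star v ⬝ᵥ v ≠ 0 := by rwa [Ne, dotProduct_star_self_eq_zero]
  have hr1 : star (star v ⬝ᵥ v) = star v ⬝ᵥ v := (star_dotProduct v v).symm
  have hr2 : star (star v ⬝ᵥ A *ᵥ v) = star v ⬝ᵥ A *ᵥ v := by
    rw [← star_dotProduct, Matrix.star_mulVec, hA.eq, Matrix.dotProduct_mulVec]
  change deriv (φ (κ k)) x * (star v ⬝ᵥ A *ᵥ v) = star v ⬝ᵥ v at key
  have h2 : star v ⬝ᵥ A *ᵥ v ≠ 0 := fun h0 => h1 (by rw [← key, h0, mul_zero])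
  have hd : deriv (φ (κ k)) x = (star v ⬝ᵥ v) / (star v ⬝ᵥ A *ᵥ v) := by
    rw [← key, mul_div_cancel_right₀ _ h2]
  have hreal : star (deriv (φ (κ k)) x) = deriv (φ (κ k)) x := by
    rw [hd, star_div₀, hr1, hr2]
  have hre : deriv (φ (κ k)) x = ((deriv (φ (κ k)) x).re : ℂ) :=
    (Complex.conj_eq_iff_re.1 hreal).symm
  refine ⟨hre, fun h0 => h1 ?_⟩
  rw [← key, hre, h0, Complex.ofReal_zero, zero_mul]

/-- For `u` in the same kernel, `⟨u, A Q A⁻¹ v⟩ = ⟨Q u, v⟩ = ⟨u, v⟩`, which the derivative formula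
equates with `φ' ⟨u, A v⟩`. The difference `e` of the two sides is thus `A`-orthogonal to the
kernel, and it lies in the kernel. There the form `A` is nondegenerate because `Q` is
`A`-self-adjoint. -/
theorem LocalDiag.classProj_mul_inv_mulVec (h : LocalDiag A B κ φ V U) (hA : A.IsHermitian)
    (hAdet : A.det ≠ 0) (hB : B.IsHermitian) {x : ℝ} (hx : (x : ℂ) ∈ U) (i : ι)
    (hi : star (φ i x) = φ i x) {v : Fin r → ℂ}
    (hv : (φ i x • A + B - (x : ℂ) • 1) *ᵥ v = 0) :
    (classProj κ (V x) i * A⁻¹) *ᵥ v = deriv (φ i) x • v := by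
  set Q := classProj κ (V x) i with hQ
  have hAQ := h.mul_classProj hA hAdet hB hx i hi
  set e := (Q * A⁻¹) *ᵥ v - deriv (φ i) x • v with he
  have heker : (φ i x • A + B - (x : ℂ) • 1) *ᵥ e = 0 := by
    rw [he, Matrix.mulVec_sub, ← Matrix.mulVec_mulVec, h.pencil_mulVec_classProj hx,
      Matrix.mulVec_smul, hv, smul_zero, sub_zero]
  have hQe : Q *ᵥ e = e := h.classProj_mulVec hAdet hx i heker
  have h1 : ∀ u, (φ i x • A + B - (x : ℂ) • 1) *ᵥ u = 0 → star u ⬝ᵥ A *ᵥ e = 0 := by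
    intro u hu
    have h2 := h.deriv_mul_dotProduct hA hAdet hB hx i hi hu hv
    have h3 : star u ⬝ᵥ A *ᵥ ((Q * A⁻¹) *ᵥ v) = star u ⬝ᵥ v := by
      rw [Matrix.mulVec_mulVec, ← mul_assoc, hAQ, mul_assoc, Matrix.mul_nonsing_inv _ hAdet.isUnit,
        mul_one, Matrix.dotProduct_mulVec, ← Matrix.star_mulVec, h.classProj_mulVec hAdet hx i hu]
    rw [he, Matrix.mulVec_sub, dotProduct_sub, h3, Matrix.mulVec_smul, dotProduct_smul,
      smul_eq_mul, h2, sub_self]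
  -- Since `y = A e` is fixed by `Qᴴ`, its squared norm is `⟨Q y, A e⟩`, which vanishes as `Q y` is
  -- in the kernel.
  have h4 : A *ᵥ e = 0 := by
    rw [← dotProduct_star_self_eq_zero]
    set y := A *ᵥ e with hy
    have h5 : y = Qᴴ *ᵥ y := by
      conv_lhs => rw [hy, ← hQe, Matrix.mulVec_mulVec, hAQ, ← Matrix.mulVec_mulVec]
    have h6 : star (Q *ᵥ y) ⬝ᵥ y = 0 := h1 _ (h.pencil_mulVec_classProj hx i _)
    rw [Matrix.star_mulVec, ← Matrix.dotProduct_mulVec, ← h5] at h6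
    exact h6
  have h6 := Matrix.eq_zero_of_mulVec_eq_zero hAdet h4
  rwa [he, sub_eq_zero] at h6

theorem LocalDiag.isHermitian_classProj_mul_inv (h : LocalDiag A B κ φ V U) (hA : A.IsHermitian)
    (hAdet : A.det ≠ 0) (hB : B.IsHermitian) {x : ℝ} (hx : (x : ℂ) ∈ U) (i : ι)
    (hi : star (φ i x) = φ i x) : (classProj κ (V x) i * A⁻¹).IsHermitian := by
  have hAQ := h.mul_classProj hA hAdet hB hx i hi
  have h1 := congrArg (fun N => A⁻¹ * N * A⁻¹) hAQ
  rw [← mul_assoc, Matrix.nonsing_inv_mul _ hAdet.isUnit, one_mul, mul_assoc, mul_assoc,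
    Matrix.mul_nonsing_inv _ hAdet.isUnit, mul_one] at h1
  rw [Matrix.IsHermitian, h1, conjTranspose_mul, conjTranspose_conjTranspose,
    conjTranspose_nonsing_inv, hA.eq, h1]

end SpectralProjections

/-! ### Functional calculus of a Hermitian matrix in its eigenbasis -/

section SpectralSum

variable {n : Type*} [Fintype n] [DecidableEq n]

/-- `⟨f(H) u, u⟩` for a Hermitian matrix `H`, in terms of its eigenvector basis. -/
noncomputable def specSum {H : Matrix n n ℂ} (hH : H.IsHermitian) (u : n → ℂ) (f : ℝ → ℝ) : ℝ :=
  ∑ j, f (hH.eigenvalues j) * ‖star (hH.eigenvectorBasis j).ofLp ⬝ᵥ u‖ ^ 2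

theorem dotProduct_mulVec_eq_sum {H : Matrix n n ℂ} (hH : H.IsHermitian) (u : n → ℂ)
    (N : Matrix n n ℂ) (τ : n → ℂ)
    (hN : ∀ j, N *ᵥ (hH.eigenvectorBasis j).ofLp = τ j • (hH.eigenvectorBasis j).ofLp) :
    star u ⬝ᵥ N *ᵥ u = ∑ j, τ j * ((‖star (hH.eigenvectorBasis j).ofLp ⬝ᵥ u‖ ^ 2 : ℝ) : ℂ) := by
  have hu : u = ∑ j, (star (hH.eigenvectorBasis j).ofLp ⬝ᵥ u) •
      (hH.eigenvectorBasis j).ofLp := by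
    have h := hH.eigenvectorBasis.sum_repr (WithLp.toLp 2 u)
    have h2 := congrArg WithLp.ofLp h
    rw [WithLp.ofLp_sum] at h2
    simp only [WithLp.ofLp_smul] at h2
    conv_lhs => rw [show u = (WithLp.toLp 2 u).ofLp from rfl, ← h2]
    refine Finset.sum_congr rfl fun j _ => ?_
    congr 1
    rw [hH.eigenvectorBasis.repr_apply_apply, EuclideanSpace.inner_eq_star_dotProduct,
      dotProduct_comm]
  conv_lhs => rw [hu, Matrix.mulVec_sum, ← hu]
  rw [dotProduct_sum]
  refine Finset.sum_congr rfl fun j _ => ?_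
  rw [Matrix.mulVec_smul, hN, dotProduct_smul, dotProduct_smul, smul_eq_mul, smul_eq_mul]
  have : star u ⬝ᵥ (hH.eigenvectorBasis j).ofLp =
      star (star (hH.eigenvectorBasis j).ofLp ⬝ᵥ u) := by
    rw [← star_dotProduct]
  rw [this]
  push_cast
  rw [← Complex.mul_conj']
  change _ = τ j * (_ * star _)
  ring

theorem pow_mulVec_of_mulVec_eq_smul {H : Matrix n n ℂ} {v : n → ℂ} {t : ℂ}
    (h : H *ᵥ v = t • v) (k : ℕ) : (H ^ k) *ᵥ v = t ^ k • v := by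
  simpa using aeval_mulVec_of_mulVec_eq_smul h (X ^ k)

theorem dotProduct_pow_mulVec_eq_specSum {H : Matrix n n ℂ} (hH : H.IsHermitian) (u : n → ℂ)
    (k : ℕ) : star u ⬝ᵥ (H ^ k) *ᵥ u = (specSum hH u fun t => t ^ k : ℝ) := by
  rw [dotProduct_mulVec_eq_sum hH u (H ^ k) (fun j => (hH.eigenvalues j : ℂ) ^ k)
    fun j => pow_mulVec_of_mulVec_eq_smul (hH.mulVec_eigenvectorBasis j) k, specSum]
  push_cast
  rfl

/-- A Hermitian `T` with range in the `x`-eigenspace of `H`, acting there as `c`, is `c` times the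
orthogonal spectral projection. It is applied to `T = Q A⁻¹` and `c = φ'`. -/
theorem mul_specSum_eq {H T : Matrix n n ℂ} (hH : H.IsHermitian) (hT : T.IsHermitian) (x : ℝ)
    (c : ℂ) (hHT : ∀ v, H *ᵥ (T *ᵥ v) = (x : ℂ) • (T *ᵥ v))
    (hTc : ∀ v, H *ᵥ v = (x : ℂ) • v → T *ᵥ v = c • v) (u : n → ℂ) (f : ℝ → ℝ)
    (hf : ∀ j, hH.eigenvalues j ≠ x → f (hH.eigenvalues j) = 0) :
    c * (specSum hH u f : ℝ) = f x * (star u ⬝ᵥ T *ᵥ u) := by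
  have hH1 : ∀ j, H *ᵥ (hH.eigenvectorBasis j).ofLp =
      (hH.eigenvalues j : ℂ) • (hH.eigenvectorBasis j).ofLp := fun j =>
    hH.mulVec_eigenvectorBasis j
  rw [dotProduct_mulVec_eq_sum hH u T (fun j => if hH.eigenvalues j = x then c else 0)]
  · rw [specSum, Finset.mul_sum]
    push_cast
    rw [Finset.mul_sum]
    refine Finset.sum_congr rfl fun j _ => ?_
    by_cases hj : hH.eigenvalues j = x
    · rw [if_pos hj, hj]; ring
    · rw [if_neg hj, hf j hj]; simp
  · intro j
    by_cases hj : hH.eigenvalues j = x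
    · rw [if_pos hj]
      exact hTc _ (by rw [hH1, hj])
    · rw [if_neg hj, zero_smul, ← dotProduct_star_self_eq_zero]
      set v := (hH.eigenvectorBasis j).ofLp
      -- `T T v` satisfies the eigenvalue equation for `x`, hence is orthogonal to `v`; the product
      -- equals `‖T v‖²`.
      have h1 : star (T *ᵥ (T *ᵥ v)) ⬝ᵥ v = 0 := by
        set y := T *ᵥ (T *ᵥ v)
        have hy : H *ᵥ y = (x : ℂ) • y := hHT _
        have e1 : star y ⬝ᵥ H *ᵥ v = (hH.eigenvalues j : ℂ) * (star y ⬝ᵥ v) := by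
          rw [hH1, dotProduct_smul, smul_eq_mul]
        have e2 : star y ⬝ᵥ H *ᵥ v = (x : ℂ) * (star y ⬝ᵥ v) := by
          have := congrArg star hy
          rw [Matrix.star_mulVec, hH.eq, star_smul] at this
          rw [Matrix.dotProduct_mulVec, this, smul_dotProduct, smul_eq_mul]
          simp
        have e3 : ((hH.eigenvalues j : ℂ) - x) * (star y ⬝ᵥ v) = 0 := by
          rw [sub_mul, ← e1, e2, sub_self]
        refine (mul_eq_zero.1 e3).resolve_left (sub_ne_zero.2 ?_)
        exact_mod_cast hj
      rw [Matrix.star_mulVec, hT.eq, ← Matrix.dotProduct_mulVec] at h1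
      rw [← h1, dotProduct_comm]

end SpectralSum
end MatrixChebyshev

namespace MatrixChebyshev

open MeasureTheory Matrix Polynomial
open scoped ComplexOrder Topology ENNReal

/-! ### Scalar measures attached to a positive semidefinite matrix measure -/

section QuadraticForms

variable {r : ℕ} {W : VectorMeasure ℝ (Matrix (Fin r) (Fin r) ℂ)}

theorem entry_apply (W : VectorMeasure ℝ (Matrix (Fin r) (Fin r) ℂ)) (i j : Fin r) (E : Set ℝ) :
    entry W i j E = W E i j := by
  rfl

theorem star_dotProduct_mulVec_eq_sum (M : Matrix (Fin r) (Fin r) ℂ) (u : Fin r → ℂ) :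
    star u ⬝ᵥ M *ᵥ u = ∑ i, ∑ j, star (u i) * u j * M i j := by
  simp only [dotProduct, Matrix.mulVec, Pi.star_apply, Finset.mul_sum]
  exact Finset.sum_congr rfl fun i _ => Finset.sum_congr rfl fun j _ => by ring

/-- The quadratic forms of a positive semidefinite matrix measure are finite measures. -/
theorem exists_quadMeasure (hW : ∀ E : Set ℝ, MeasurableSet E → (W E).PosSemidef)
    (u : Fin r → ℂ) : ∃ μ : Measure ℝ, IsFiniteMeasure μ ∧
      ∀ E : Set ℝ, MeasurableSet E → ((μ.real E : ℝ) : ℂ) = star u ⬝ᵥ W E *ᵥ u := by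
  let f : Matrix (Fin r) (Fin r) ℂ →+ ℝ :=
    { toFun := fun M => (star u ⬝ᵥ M *ᵥ u).re
      map_zero' := by simp
      map_add' := fun M N => by simp [Matrix.add_mulVec] }
  have hf : Continuous f := Complex.continuous_re.comp
    ((continuous_const (y := star u)).dotProduct
      (continuous_id.matrix_mulVec continuous_const))
  let s : SignedMeasure ℝ := W.mapRange f hf
  have hs : 0 ≤[Set.univ] s := by
    rw [VectorMeasure.le_restrict_univ_iff_le]
    intro E hE
    have := (hW E hE).dotProduct_mulVec_nonneg u
    exact (Complex.le_def.1 this).1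
  refine ⟨s.toMeasureOfZeroLE Set.univ MeasurableSet.univ hs, inferInstance, fun E hE => ?_⟩
  rw [SignedMeasure.toMeasureOfZeroLE_real_apply _ _ _ hE, Set.univ_inter]
  have := (hW E hE).dotProduct_mulVec_nonneg u
  exact Complex.ext rfl (Complex.le_def.1 this).2

/-- The measure `μ` is dominated by a finite combination of the variations of the entries. -/
theorem integrable_of_integrable_entry {μ : Measure ℝ} [IsFiniteMeasure μ] {u : Fin r → ℂ}
    (hμ : ∀ E : Set ℝ, MeasurableSet E → ((μ.real E : ℝ) : ℂ) = star u ⬝ᵥ W E *ᵥ u)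
    {f : ℝ → ℂ} (hf : ∀ i j, (entry W i j).Integrable f) : Integrable f μ := by
  have hle : μ ≤ ∑ i, ∑ j, (‖u i‖₊ * ‖u j‖₊) • (entry W i j).variation := by
    refine Measure.le_iff.2 fun E hE => ?_
    have h1 : μ E = ‖((μ.real E : ℝ) : ℂ)‖ₑ := by
      rw [Measure.real, ← ofReal_norm, Complex.norm_of_nonneg ENNReal.toReal_nonneg,
        ENNReal.ofReal_toReal (measure_ne_top μ E)]
    rw [h1, hμ E hE, star_dotProduct_mulVec_eq_sum]
    simp only [Measure.coe_finsetSum, Finset.sum_apply, Measure.coe_nnreal_smul_apply]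
    refine (enorm_sum_le _ _).trans (Finset.sum_le_sum fun i _ => ?_)
    refine (enorm_sum_le _ _).trans (Finset.sum_le_sum fun j _ => ?_)
    rw [enorm_mul, enorm_mul]
    have h2 : ‖W E i j‖ₑ ≤ (entry W i j).variation E :=
      VectorMeasure.enorm_measure_le_variation (entry W i j) E
    have h3 : ‖star (u i)‖ₑ = ‖u i‖ₑ := by
      rw [← ofReal_norm, ← ofReal_norm, norm_star]
    rw [h3, ENNReal.coe_mul, ← enorm_eq_nnnorm, ← enorm_eq_nnnorm]
    gcongr
  refine Integrable.mono_measure ?_ hle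
  rw [integrable_finsetSum_measure]
  intro i _
  rw [integrable_finsetSum_measure]
  exact fun j _ => (hf i j).smul_measure_nnreal

theorem cintegral_simpleFunc (ν : ComplexMeasure ℝ) [IsFiniteMeasure ν.variation]
    (f : SimpleFunc ℝ ℝ) :
    cintegral (fun x => (f x : ℂ)) ν = ∑ y ∈ f.range, (y : ℂ) * ν (f ⁻¹' {y}) := by
  have h : (fun x => (f x : ℂ)) = fun x => ∑ y ∈ f.range,
      (f ⁻¹' {y}).indicator (fun _ => (y : ℂ)) x := by
    funext x
    rw [Finset.sum_eq_single (f x)]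
    · simp
    · intro y _ hy
      rw [Set.indicator_of_notMem]
      exact fun hx => hy hx.symm
    · exact fun hx => absurd (SimpleFunc.mem_range_self f x) hx
  rw [h, cintegral, VectorMeasure.integral_finsetSum]
  · refine Finset.sum_congr rfl fun y _ => ?_
    rw [VectorMeasure.integral_indicator_const _ (f.measurableSet_fiber y)]
    · rfl
  · exact fun y _ => (integrable_const _).indicator (f.measurableSet_fiber y)

/-- On simple functions this is bilinearity; the approximating simple functions are dominated by `2
|f|`, so dominated convergence applies on both sides. -/
theorem integral_quadMeasure {μ : Measure ℝ} [IsFiniteMeasure μ] {u : Fin r → ℂ}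
    (hμ : ∀ E : Set ℝ, MeasurableSet E → ((μ.real E : ℝ) : ℂ) = star u ⬝ᵥ W E *ᵥ u)
    (h1 : ∀ i j, IsFiniteMeasure (entry W i j).variation) {f : ℝ → ℝ} (hfm : Measurable f)
    (hf : ∀ i j, (entry W i j).Integrable fun x => (f x : ℂ)) :
    ((∫ x, f x ∂μ : ℝ) : ℂ) =
      ∑ i, ∑ j, star (u i) * u j * cintegral (fun x => (f x : ℂ)) (entry W i j) := by
  let g : ℕ → SimpleFunc ℝ ℝ := fun n =>
    SimpleFunc.approxOn f hfm Set.univ 0 (Set.mem_univ _) n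
  have hg : ∀ x, Filter.Tendsto (fun n => g n x) Filter.atTop (𝓝 (f x)) := fun x =>
    SimpleFunc.tendsto_approxOn hfm _ (by simp)
  have hgb : ∀ n x, ‖g n x‖ ≤ ‖f x‖ + ‖f x‖ := fun n x =>
    SimpleFunc.norm_approxOn_zero_le hfm (Set.mem_univ _) x n
  have hfμ : Integrable f μ := by
    have := integrable_of_integrable_entry hμ hf
    simpa using this.re
  have hL : Filter.Tendsto (fun n => ((∫ x, g n x ∂μ : ℝ) : ℂ)) Filter.atTop
      (𝓝 ((∫ x, f x ∂μ : ℝ) : ℂ)) :=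
    (Complex.continuous_ofReal.tendsto _).comp
      (tendsto_integral_of_dominated_convergence (fun x => ‖f x‖ + ‖f x‖)
        (fun n => (g n).aestronglyMeasurable) (hfμ.norm.add hfμ.norm)
        (fun n => Filter.Eventually.of_forall (hgb n)) (Filter.Eventually.of_forall hg))
  have hR : ∀ i j, Filter.Tendsto (fun n => cintegral (fun x => (g n x : ℂ)) (entry W i j))
      Filter.atTop (𝓝 (cintegral (fun x => (f x : ℂ)) (entry W i j))) := fun i j => by
    refine VectorMeasure.tendsto_integral_of_dominated_convergence
      (fun x => ‖f x‖ + ‖f x‖) (fun n => ?_) ?_ (fun n => Filter.Eventually.of_forall fun x => ?_)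
      (Filter.Eventually.of_forall fun x => ?_)
    · exact (Complex.measurable_ofReal.comp (g n).measurable).aestronglyMeasurable
    · have : Integrable (fun x => ‖f x‖) (entry W i j).variation := by
        simpa using (hf i j).norm
      exact this.add this
    · simpa using hgb n x
    · exact (Complex.continuous_ofReal.tendsto _).comp (hg x)
  refine tendsto_nhds_unique hL ?_
  have hR' := tendsto_finsetSum Finset.univ fun i _ => tendsto_finsetSum Finset.univ
    fun j _ => (hR i j).const_mul (star (u i) * u j)
  refine hR'.congr fun n => ?_
  rw [SimpleFunc.integral_eq_sum _ (by
    refine Integrable.mono' (hfμ.norm.add hfμ.norm) (g n).aestronglyMeasurable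
      (Filter.Eventually.of_forall (hgb n)))]
  simp only [cintegral_simpleFunc, entry_apply, smul_eq_mul]
  push_cast
  simp only [Finset.mul_sum]
  simp only [hμ _ ((g n).measurableSet_fiber _), star_dotProduct_mulVec_eq_sum, Finset.sum_mul]
  conv_rhs => rw [Finset.sum_comm]
  refine Finset.sum_congr rfl fun i _ => ?_
  conv_rhs => rw [Finset.sum_comm]
  exact Finset.sum_congr rfl fun j _ => Finset.sum_congr rfl fun y _ => by ring

end QuadraticForms

/-! ### Moments of the spectral measure -/

section Moments

variable {r : ℕ}

theorem exists_poly_orthPoly (a b : ℕ → Matrix (Fin r) (Fin r) ℂ) (m : ℕ) :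
    ∀ i k, ∃ p : ℂ[X], ∀ x : ℝ, orthPoly a b m x i k = p.eval (x : ℂ) := by
  have hmul : ∀ (M : Matrix (Fin r) (Fin r) ℂ) (F : ℝ → Matrix (Fin r) (Fin r) ℂ),
      (∀ i k, ∃ p : ℂ[X], ∀ x : ℝ, F x i k = p.eval (x : ℂ)) →
      ∀ i k, ∃ p : ℂ[X], ∀ x : ℝ, (M * F x) i k = p.eval (x : ℂ) := by
    intro M F hF i k
    choose p hp using hF
    exact ⟨∑ j, C (M i j) * p j k, fun x => by simp [Matrix.mul_apply, eval_finsetSum, hp]⟩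
  have hlin : ∀ (M : Matrix (Fin r) (Fin r) ℂ) (F : ℝ → Matrix (Fin r) (Fin r) ℂ),
      (∀ i k, ∃ p : ℂ[X], ∀ x : ℝ, F x i k = p.eval (x : ℂ)) →
      ∀ i k, ∃ p : ℂ[X], ∀ x : ℝ, (((x : ℂ) • 1 - M) * F x) i k = p.eval (x : ℂ) := by
    intro M F hF i k
    obtain ⟨p, hp⟩ := hF i k
    obtain ⟨p', hp'⟩ := hmul M F hF i k
    exact ⟨X * p - p', fun x => by simp [sub_mul, hp, hp']⟩
  have hone : ∀ i k, ∃ p : ℂ[X], ∀ x : ℝ, (1 : Matrix (Fin r) (Fin r) ℂ) i k = p.eval (x : ℂ) :=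
    fun i k => ⟨C ((1 : Matrix (Fin r) (Fin r) ℂ) i k), fun x => by simp⟩
  induction m using Nat.twoStepInduction with
  | zero => exact hone
  | one =>
    have h := hmul (a 1)⁻¹ _ (hlin (b 0) (fun _ => 1) hone)
    simpa [orthPoly] using h
  | more m h0 h1 =>
    have h2 := hlin (b (m + 1)) _ h1
    have h3 := hmul (a (m + 1))ᴴ _ h0
    refine hmul (a (m + 2))⁻¹ (fun x => ((x : ℂ) • 1 - b (m + 1)) * orthPoly a b (m + 1) x -
      (a (m + 1))ᴴ * orthPoly a b m x) fun i k => ?_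
    obtain ⟨p, hp⟩ := h2 i k
    obtain ⟨p', hp'⟩ := h3 i k
    exact ⟨p - p', fun x => by rw [Matrix.sub_apply, hp, hp', eval_sub]⟩

theorem IsSpectralMeasure.integrable_eval {a b : ℕ → Matrix (Fin r) (Fin r) ℂ}
    {W : VectorMeasure ℝ (Matrix (Fin r) (Fin r) ℂ)} (hW : IsSpectralMeasure a b W)
    (i j : Fin r) (p : ℂ[X]) : (entry W i j).Integrable fun x : ℝ => p.eval (x : ℂ) := by
  simp only [eval_eq_sum_range]
  exact integrable_finsetSum _ fun n _ => (hW.moments i j n).const_mul _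

theorem IsSpectralMeasure.isFiniteMeasure {a b : ℕ → Matrix (Fin r) (Fin r) ℂ}
    {W : VectorMeasure ℝ (Matrix (Fin r) (Fin r) ℂ)} (hW : IsSpectralMeasure a b W)
    (i j : Fin r) : IsFiniteMeasure (entry W i j).variation := by
  have h := hW.moments i j 0
  simp only [pow_zero] at h
  exact (integrable_const_iff_isFiniteMeasure (one_ne_zero (α := ℂ))).1 h

theorem cintegral_const_mul (ν : ComplexMeasure ℝ) (c : ℂ) (f : ℝ → ℂ) :
    cintegral (fun x => c * f x) ν = c * cintegral f ν := by
  rw [cintegral, cintegral, VectorMeasure.integral_eq_setToFun, VectorMeasure.integral_eq_setToFun]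
  refine setToFun_smul _ (fun c s x => ?_) c f
  change (c • x) * ν s = c • (x * ν s)
  simp [mul_assoc]

/-- Scalar orthonormal polynomials of `ν` with recurrence coefficients `α`, `0`. -/
structure IsScalarSystem (α : ℕ → ℝ) (p : ℕ → ℝ → ℝ) (ν : Measure ℝ) : Prop where
  isFinite : IsFiniteMeasure ν
  abs_le : ∀ᵐ w ∂ν, |w| ≤ 2
  ne_zero : ∀ m, α (m + 1) ≠ 0
  zero : ∀ w, p 0 w = 1
  mul_zero : ∀ w, w * p 0 w = α 1 * p 1 w
  mul_succ : ∀ m w, w * p (m + 1) w = α (m + 2) * p (m + 2) w + α (m + 1) * p m w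
  continuous : ∀ m, Continuous (p m)
  integral : ∀ m, ∫ w, p m w ∂ν = if m = 0 then 1 else 0

theorem IsScalarSystem.integrable {α : ℕ → ℝ} {p : ℕ → ℝ → ℝ} {ν : Measure ℝ}
    (h : IsScalarSystem α p ν) {E : Type*} [NormedAddCommGroup E] {f : ℝ → E}
    (hf : Continuous f) [SecondCountableTopologyEither ℝ E] : Integrable f ν := by
  have := h.isFinite
  obtain ⟨C, hC⟩ := (isCompact_Icc (a := (-2 : ℝ)) (b := 2)).exists_bound_of_continuousOn
    hf.continuousOn
  refine Integrable.mono' (integrable_const C) hf.aestronglyMeasurable ?_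
  filter_upwards [h.abs_le] with w hw using hC w (_root_.abs_le.1 hw)

/-- The moments of the spectral measure are those of the pencil `w A + B` under `ν`. -/
theorem IsSpectralMeasure.moment_eq {A B : Matrix (Fin r) (Fin r) ℂ} (hA : A.IsHermitian)
    (hAdet : A.det ≠ 0) {α : ℕ → ℝ} {p : ℕ → ℝ → ℝ} {ν : Measure ℝ} (hν : IsScalarSystem α p ν)
    {W : VectorMeasure ℝ (Matrix (Fin r) (Fin r) ℂ)}
    (hW : IsSpectralMeasure (fun m => (α m : ℂ) • A) (fun _ => B) W) (n : ℕ) (i j : Fin r) :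
    cintegral (fun x => (x : ℂ) ^ n) (entry W i j) =
      ∫ w, (((w : ℂ) • A + B) ^ n) i j ∂ν := by
  set P := orthPoly (fun m => (α m : ℂ) • A) (fun _ => B) with hP
  have hinv : ∀ m : ℕ, ((α (m + 1) : ℂ) • A) * ((α (m + 1) : ℂ) • A)⁻¹ = 1 := fun m => by
    refine Matrix.mul_nonsing_inv _ (IsUnit.mk0 _ ?_)
    rw [Matrix.det_smul]
    exact mul_ne_zero (pow_ne_zero _ (Complex.ofReal_ne_zero.2 (hν.ne_zero m))) hAdet
  have hP0 : ∀ x : ℝ, (x : ℂ) • P 0 x = ((α 1 : ℂ) • A) * P 1 x + B * P 0 x := fun x => by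
    simp only [hP, orthPoly]
    rw [← mul_assoc, hinv 0]
    simp
  have hPs : ∀ (m : ℕ) (x : ℝ), (x : ℂ) • P (m + 1) x =
      ((α (m + 2) : ℂ) • A) * P (m + 2) x + B * P (m + 1) x + ((α (m + 1) : ℂ) • A) * P m x :=
    fun m x => by
    simp only [hP]
    rw [orthPoly, ← mul_assoc, hinv (m + 1), conjTranspose_smul, hA.eq]
    simp [sub_mul]
    abel
  -- `R` matches matrix polynomials in `x` with matrix functions of `w` through `c P_m ↔ p_m c`. The
  -- two recurrences have the same shape, so multiplication by `x` corresponds to right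
  -- multiplication by `w A + B`.
  let R : AddSubmonoid ((ℝ → Matrix (Fin r) (Fin r) ℂ) × (ℝ → Matrix (Fin r) (Fin r) ℂ)) :=
    AddSubmonoid.closure {F | ∃ (c : Matrix (Fin r) (Fin r) ℂ) (m : ℕ),
      F = (fun x => c * P m x, fun w => (p m w : ℂ) • c)}
  have hgen : ∀ (c : Matrix (Fin r) (Fin r) ℂ) (m : ℕ),
      ((fun x => c * P m x, fun w => (p m w : ℂ) • c) :
        (ℝ → Matrix (Fin r) (Fin r) ℂ) × (ℝ → Matrix (Fin r) (Fin r) ℂ)) ∈ R :=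
    fun c m => AddSubmonoid.subset_closure ⟨c, m, rfl⟩
  have hstep : ∀ F ∈ R, ((fun x : ℝ => (x : ℂ) • F.1 x, fun w : ℝ => F.2 w * ((w : ℂ) • A + B)) :
        (ℝ → Matrix (Fin r) (Fin r) ℂ) × (ℝ → Matrix (Fin r) (Fin r) ℂ)) ∈ R := by
    intro F hF
    induction hF using AddSubmonoid.closure_induction with
    | mem F hF =>
      obtain ⟨c, m, rfl⟩ := hF
      cases m with
      | zero =>
        have := R.add_mem (hgen (c * ((α 1 : ℂ) • A)) 1) (hgen (c * B) 0)
        convert this using 1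
        refine Prod.ext (funext fun x => ?_) (funext fun w => ?_)
        · simp only [Prod.fst_add, Pi.add_apply]
          rw [← Matrix.mul_smul, hP0, mul_add, mul_assoc, mul_assoc]
        · simp only [Prod.snd_add, Pi.add_apply]
          have h1 : (w : ℂ) * p 0 w = α 1 * p 1 w := by exact_mod_cast hν.mul_zero w
          rw [mul_add, Matrix.mul_smul, Matrix.smul_mul, smul_smul, h1, Matrix.smul_mul,
            Matrix.mul_smul, smul_smul, mul_comm (p 1 w : ℂ)]
      | succ m =>
        have := R.add_mem (R.add_mem (hgen (c * ((α (m + 2) : ℂ) • A)) (m + 2))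
          (hgen (c * B) (m + 1))) (hgen (c * ((α (m + 1) : ℂ) • A)) m)
        convert this using 1
        refine Prod.ext (funext fun x => ?_) (funext fun w => ?_)
        · simp only [Prod.fst_add, Pi.add_apply]
          rw [← Matrix.mul_smul, hPs, mul_add, mul_add, mul_assoc, mul_assoc, mul_assoc]
        · simp only [Prod.snd_add, Pi.add_apply]
          have h1 : (w : ℂ) * p (m + 1) w = α (m + 2) * p (m + 2) w + α (m + 1) * p m w := by
            exact_mod_cast hν.mul_succ m w
          rw [mul_add, Matrix.mul_smul, Matrix.smul_mul, smul_smul, h1, Matrix.smul_mul,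
            Matrix.mul_smul, smul_smul, Matrix.mul_smul, smul_smul, add_smul,
            mul_comm (p (m + 2) w : ℂ), mul_comm (p m w : ℂ)]
          abel
    | zero =>
      convert R.zero_mem using 1
      refine Prod.ext (funext fun x => ?_) (funext fun w => ?_) <;> simp
    | add F G _ _ hF hG =>
      convert R.add_mem hF hG using 1
      refine Prod.ext (funext fun x => ?_) (funext fun w => ?_) <;> simp [add_mul]
  have hpow : ∀ n : ℕ, ((fun x : ℝ => (x : ℂ) ^ n • (1 : Matrix (Fin r) (Fin r) ℂ),
      fun w : ℝ => ((w : ℂ) • A + B) ^ n) :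
        (ℝ → Matrix (Fin r) (Fin r) ℂ) × (ℝ → Matrix (Fin r) (Fin r) ℂ)) ∈ R := by
    intro n
    induction n with
    | zero =>
      convert hgen 1 0 using 1
      refine Prod.ext (funext fun x => ?_) (funext fun w => ?_)
      · simp [hP, orthPoly]
      · simp [hν.zero]
    | succ n ih =>
      convert hstep _ ih using 1
      refine Prod.ext (funext fun x => ?_) (funext fun w => ?_)
      · simp [pow_succ', smul_smul]
      · simp [pow_succ]
  -- Integration against `W` and against `ν` agree on generators: both give `c` for `m = 0` and `0`
  -- otherwise. Only orthonormality against `P_0 = 1` is needed.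
  have hint : ∀ F ∈ R, (∀ i k l m, (entry W l m).Integrable fun x => F.1 x i k) ∧
      (∀ i j, Integrable (fun w => F.2 w i j) ν) ∧
      ∀ i j, ∑ k, cintegral (fun x => F.1 x i k) (entry W k j) = ∫ w, F.2 w i j ∂ν := by
    intro F hF
    induction hF using AddSubmonoid.closure_induction with
    | mem F hF =>
      obtain ⟨c, m, rfl⟩ := hF
      have hPint : ∀ i k l m', (entry W l m').Integrable fun x => P m x i k := by
        intro i k l m'
        obtain ⟨q, hq⟩ := exists_poly_orthPoly (fun m => (α m : ℂ) • A) (fun _ => B) m i k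
        simp only [hP, hq]
        exact hW.integrable_eval _ _ q
      refine ⟨fun i k l m' => ?_, fun i j => ?_, fun i j => ?_⟩
      · simp only [Matrix.mul_apply]
        exact integrable_finsetSum _ fun s _ => (hPint s k l m').const_mul _
      · simp only [Matrix.smul_apply, smul_eq_mul]
        exact (hν.integrable (Complex.continuous_ofReal.comp (hν.continuous m))).mul_const _
      · simp only [Matrix.smul_apply, smul_eq_mul, Matrix.mul_apply]
        have hort := hW.orthonormal m 0
        have e1 : ∀ k, cintegral (fun x => ∑ s, c i s * P m x s k) (entry W k j) =
            ∑ s, c i s * cintegral (fun x => P m x s k) (entry W k j) := fun k => by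
          rw [cintegral, VectorMeasure.integral_finsetSum _
            fun s _ => (hPint s k k j).const_mul _]
          exact Finset.sum_congr rfl fun s _ => cintegral_const_mul _ _ _
        have e2 : ∀ s, ∑ k, cintegral (fun x => P m x s k) (entry W k j) =
            if m = 0 then (1 : Matrix (Fin r) (Fin r) ℂ) s j else 0 := fun s => by
          rw [← hort s j]
          refine Finset.sum_congr rfl fun k _ => ?_
          rw [Finset.sum_eq_single j]
          · simp [hP, orthPoly]
          · intro l _ hl
            simp [orthPoly, hl.symm, cintegral]
          · exact fun h => absurd (Finset.mem_univ _) h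
        simp only [e1]
        rw [Finset.sum_comm]
        simp only [← Finset.mul_sum, e2]
        have e3 : ∫ w, (p m w : ℂ) * c i j ∂ν = ((∫ w, p m w ∂ν : ℝ) : ℂ) * c i j := by
          rw [integral_mul_const, integral_complex_ofReal]
        rw [e3, hν.integral m]
        split_ifs with hm
        · simp [Matrix.one_apply]
        · simp
    | zero => simp [cintegral]
    | add F G _ _ hF hG =>
      obtain ⟨hF1, hF2, hF3⟩ := hF
      obtain ⟨hG1, hG2, hG3⟩ := hG
      refine ⟨fun i k l m => (hF1 i k l m).add (hG1 i k l m), fun i j => (hF2 i j).add (hG2 i j),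
        fun i j => ?_⟩
      simp only [Prod.fst_add, Prod.snd_add, Pi.add_apply, Matrix.add_apply]
      rw [integral_add (hF2 i j) (hG2 i j), ← hF3, ← hG3, ← Finset.sum_add_distrib]
      exact Finset.sum_congr rfl fun k _ => VectorMeasure.integral_fun_add (hF1 i k k j) (hG1 i k k j)
  have hfin := (hint _ (hpow n)).2.2 i j
  simp only at hfin
  rw [← hfin, Finset.sum_eq_single i]
  · simp
  · intro k _ hk
    simp [hk.symm, cintegral]
  · exact fun h => absurd (Finset.mem_univ _) h

end Moments
-- From moments to continuous functions
section Determinacy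

/-- A finite measure whose moments are those of a bounded family of weighted sums of point
evaluations is concentrated on a compact interval. -/
theorem ae_abs_le_of_moments {μ ν : Measure ℝ} [IsFiniteMeasure μ] [IsFiniteMeasure ν]
    {n : Type*} [Fintype n] {t a : ℝ → n → ℝ} {R K : ℝ} (hR : 0 ≤ R)
    (ht : ∀ᵐ w ∂ν, ∀ j, |t w j| ≤ R) (ha : ∀ w j, 0 ≤ a w j) (haK : ∀ w, ∑ j, a w j = K)
    (hμ : ∀ k : ℕ, Integrable (fun x : ℝ => x ^ k) μ)
    (hm : ∀ k : ℕ, ∫ x, x ^ k ∂μ = ∫ w, ∑ j, t w j ^ k * a w j ∂ν) :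
    ∀ᵐ x ∂μ, |x| ≤ R := by
  -- Markov's inequality for `x ^ (2k)` bounds this mass by a constant times `(R / R') ^ (2k)`,
  -- which tends to `0`.
  have key : ∀ R' > R, μ.real {x | R' ≤ |x|} = 0 := by
    intro R' hR'
    have hR'0 : 0 < R' := hR.trans_lt hR'
    have hK : 0 ≤ K := (haK 0) ▸ Finset.sum_nonneg fun j _ => ha 0 j
    have hb : ∀ k : ℕ, μ.real {x | R' ≤ |x|} ≤ ((R / R') ^ 2) ^ k * (K * ν.real Set.univ) := by
      intro k
      have h1 := mul_meas_ge_le_integral_of_nonneg (μ := μ) (f := fun x : ℝ => x ^ (2 * k))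
        (Filter.Eventually.of_forall fun x => (even_two_mul k).pow_nonneg x) (hμ (2 * k))
        (R' ^ (2 * k))
      have h2 : {x : ℝ | R' ≤ |x|} ⊆ {x : ℝ | R' ^ (2 * k) ≤ x ^ (2 * k)} := fun x hx => by
        change R' ^ (2 * k) ≤ x ^ (2 * k)
        rw [← (even_two_mul k).pow_abs x]
        exact pow_le_pow_left₀ hR'0.le hx _
      have h3 : ∫ x, x ^ (2 * k) ∂μ ≤ R ^ (2 * k) * K * ν.real Set.univ := by
        rw [hm]
        have h4 : ∀ᵐ w ∂ν, ‖∑ j, t w j ^ (2 * k) * a w j‖ ≤ R ^ (2 * k) * K := by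
          filter_upwards [ht] with w hw
          refine (norm_sum_le _ _).trans ?_
          rw [← haK w, Finset.mul_sum]
          refine Finset.sum_le_sum fun j _ => ?_
          rw [norm_mul, Real.norm_of_nonneg (ha w j), norm_pow, Real.norm_eq_abs]
          exact mul_le_mul_of_nonneg_right (pow_le_pow_left₀ (abs_nonneg _) (hw j) _) (ha w j)
        exact (le_abs_self _).trans (norm_integral_le_of_norm_le_const h4)
      have h5 : R' ^ (2 * k) * μ.real {x | R' ≤ |x|} ≤ R ^ (2 * k) * K * ν.real Set.univ :=
        (mul_le_mul_of_nonneg_left (measureReal_mono h2) (by positivity)).trans (h1.trans h3)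
      have h6 : ((R / R') ^ 2) ^ k = R ^ (2 * k) / R' ^ (2 * k) := by
        rw [div_pow, div_pow, pow_mul, pow_mul]
      rw [h6, div_mul_eq_mul_div, le_div_iff₀ (by positivity)]
      linarith
    have hlim : Filter.Tendsto (fun k : ℕ => ((R / R') ^ 2) ^ k * (K * ν.real Set.univ))
        Filter.atTop (𝓝 (0 * (K * ν.real Set.univ))) := by
      refine (tendsto_pow_atTop_nhds_zero_of_lt_one (by positivity) ?_).mul_const _
      have : R / R' < 1 := (div_lt_one hR'0).2 hR'
      have h0 : 0 ≤ R / R' := by positivity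
      nlinarith
    rw [zero_mul] at hlim
    exact le_antisymm (ge_of_tendsto' hlim hb) measureReal_nonneg
  have hall : ∀ᵐ x ∂μ, ∀ k : ℕ, |x| < R + 1 / ((k : ℝ) + 1) := by
    rw [ae_all_iff]
    intro k
    have := key (R + 1 / ((k : ℝ) + 1)) (by linarith [Nat.one_div_pos_of_nat (α := ℝ) (n := k)])
    rw [measureReal_eq_zero_iff] at this
    rw [ae_iff]
    simpa using this
  filter_upwards [hall] with x hx
  refine le_of_forall_pos_lt_add fun ε hε => ?_
  obtain ⟨k, hk⟩ := exists_nat_one_div_lt hε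
  exact (hx k).trans (by linarith)

/-- Both sides only see `[-R, R]`, where `f` is a uniform limit of polynomials, and for polynomials
the claim is equality of moments. -/
theorem integral_eq_of_moments {μ ν : Measure ℝ} [IsFiniteMeasure μ] [IsFiniteMeasure ν]
    {n : Type*} [Fintype n] {t a : ℝ → n → ℝ} {R K : ℝ} (hR : 0 ≤ R)
    (ht : ∀ᵐ w ∂ν, ∀ j, |t w j| ≤ R) (ha : ∀ w j, 0 ≤ a w j) (haK : ∀ w, ∑ j, a w j = K)
    (hμ : ∀ k : ℕ, Integrable (fun x : ℝ => x ^ k) μ)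
    (hmeas : ∀ k : ℕ, AEStronglyMeasurable (fun w => ∑ j, t w j ^ k * a w j) ν)
    (hm : ∀ k : ℕ, ∫ x, x ^ k ∂μ = ∫ w, ∑ j, t w j ^ k * a w j ∂ν)
    {f : ℝ → ℝ} (hf : Continuous f) :
    ∫ x, f x ∂μ = ∫ w, ∑ j, f (t w j) * a w j ∂ν := by
  have hsupp := ae_abs_le_of_moments hR ht ha haK hμ hm
  have hK : 0 ≤ K := (haK 0) ▸ Finset.sum_nonneg fun j _ => ha 0 j
  have hbk : ∀ k : ℕ, ∀ᵐ w ∂ν, ‖∑ j, t w j ^ k * a w j‖ ≤ R ^ k * K := fun k => by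
    filter_upwards [ht] with w hw
    refine (norm_sum_le _ _).trans ?_
    rw [← haK w, Finset.mul_sum]
    refine Finset.sum_le_sum fun j _ => ?_
    rw [norm_mul, Real.norm_of_nonneg (ha w j), norm_pow, Real.norm_eq_abs]
    exact mul_le_mul_of_nonneg_right (pow_le_pow_left₀ (abs_nonneg _) (hw j) _) (ha w j)
  have hintk : ∀ k : ℕ, Integrable (fun w => ∑ j, t w j ^ k * a w j) ν := fun k =>
    Integrable.mono' (integrable_const _) (hmeas k) (hbk k)
  have hexp : ∀ (p : ℝ[X]) (w : ℝ), ∑ j, p.eval (t w j) * a w j =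
      ∑ k ∈ Finset.range (p.natDegree + 1), p.coeff k * ∑ j, t w j ^ k * a w j := fun p w => by
    simp only [eval_eq_sum_range, Finset.sum_mul, Finset.mul_sum]
    rw [Finset.sum_comm]
    exact Finset.sum_congr rfl fun k _ => Finset.sum_congr rfl fun j _ => by ring
  have hintp : ∀ p : ℝ[X], Integrable (fun w => ∑ j, p.eval (t w j) * a w j) ν := fun p => by
    simp only [hexp]
    exact integrable_finsetSum _ fun k _ => (hintk k).const_mul _
  have hpoly : ∀ p : ℝ[X], ∫ x, p.eval x ∂μ = ∫ w, ∑ j, p.eval (t w j) * a w j ∂ν := fun p => by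
    simp only [hexp]
    simp only [eval_eq_sum_range]
    rw [integral_finsetSum _ fun k _ => (hμ k).const_mul _,
      integral_finsetSum _ fun k _ => (hintk k).const_mul _]
    refine Finset.sum_congr rfl fun k _ => ?_
    rw [integral_const_mul, integral_const_mul, hm]
  have happ : ∀ k : ℕ, ∃ p : ℝ[X], ∀ x ∈ Set.Icc (-R) R, |p.eval x - f x| < 1 / ((k : ℝ) + 1) :=
    fun k => exists_polynomial_near_of_continuousOn _ _ f hf.continuousOn _
      Nat.one_div_pos_of_nat
  choose p hp using happ
  obtain ⟨C, hC⟩ := (isCompact_Icc (a := -R) (b := R)).exists_bound_of_continuousOn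
    hf.continuousOn
  have hlim : ∀ x ∈ Set.Icc (-R) R, Filter.Tendsto (fun k => (p k).eval x) Filter.atTop
      (𝓝 (f x)) := fun x hx => by
    rw [tendsto_iff_norm_sub_tendsto_zero]
    exact squeeze_zero (fun k => norm_nonneg _) (fun k => (hp k x hx).le)
      tendsto_one_div_add_atTop_nhds_zero_nat
  have hbd : ∀ k, ∀ x ∈ Set.Icc (-R) R, |(p k).eval x| ≤ C + 1 := fun k x hx => by
    have h1 := hp k x hx
    have h2 := hC x hx
    rw [Real.norm_eq_abs] at h2
    have h3 : (1 : ℝ) / ((k : ℝ) + 1) ≤ 1 := by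
      rw [div_le_one (by positivity)]
      linarith [(Nat.cast_nonneg k : (0 : ℝ) ≤ k)]
    calc |(p k).eval x| = |((p k).eval x - f x) + f x| := by rw [sub_add_cancel]
      _ ≤ |(p k).eval x - f x| + |f x| := abs_add_le _ _
      _ ≤ C + 1 := by linarith
  have hL : Filter.Tendsto (fun k => ∫ x, (p k).eval x ∂μ) Filter.atTop (𝓝 (∫ x, f x ∂μ)) := by
    refine tendsto_integral_of_dominated_convergence (fun _ => C + 1)
      (fun k => (p k).continuous.aestronglyMeasurable) (integrable_const _) (fun k => ?_) ?_
    · filter_upwards [hsupp] with x hx using hbd k x (abs_le.1 hx)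
    · filter_upwards [hsupp] with x hx using hlim x (abs_le.1 hx)
  have hRt : Filter.Tendsto (fun k => ∫ w, ∑ j, (p k).eval (t w j) * a w j ∂ν) Filter.atTop
      (𝓝 (∫ w, ∑ j, f (t w j) * a w j ∂ν)) := by
    refine tendsto_integral_of_dominated_convergence (fun _ => (C + 1) * K)
      (fun k => (hintp (p k)).aestronglyMeasurable) (integrable_const _) (fun k => ?_) ?_
    · filter_upwards [ht] with w hw
      refine (norm_sum_le _ _).trans ?_
      rw [← haK w, Finset.mul_sum]
      refine Finset.sum_le_sum fun j _ => ?_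
      rw [norm_mul, Real.norm_of_nonneg (ha w j), Real.norm_eq_abs]
      exact mul_le_mul_of_nonneg_right (hbd k _ (abs_le.1 (hw j))) (ha w j)
    · filter_upwards [ht] with w hw
      exact tendsto_finsetSum _ fun j _ => (hlim _ (abs_le.1 (hw j))).mul_const _
  refine tendsto_nhds_unique hL (hRt.congr fun k => (hpoly _).symm)

/-- The bound is crude, but for `w A + B` it is uniform in `|w| ≤ 2`. -/
theorem abs_eigenvalues_le {n : Type*} [Fintype n] [DecidableEq n] {H : Matrix n n ℂ}
    (hH : H.IsHermitian) (j : n) : |hH.eigenvalues j| ≤ ∑ a, ∑ b, ‖H a b‖ := by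
  set e : n → ℂ := (hH.eigenvectorBasis j).ofLp with he
  have h1 : H *ᵥ e = (hH.eigenvalues j : ℂ) • e := hH.mulVec_eigenvectorBasis j
  have he0 : e ≠ 0 := fun h0 => by
    refine hH.eigenvectorBasis.orthonormal.ne_zero j ?_
    ext i
    exact congrFun h0 i
  have hpos : 0 < ∑ b, ‖e b‖ := by
    obtain ⟨i, hi⟩ := Function.ne_iff.1 he0
    exact Finset.sum_pos' (fun _ _ => norm_nonneg _) ⟨i, Finset.mem_univ _, norm_pos_iff.2 hi⟩
  refine le_of_mul_le_mul_right ?_ hpos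
  calc |hH.eigenvalues j| * ∑ b, ‖e b‖ = ∑ a, ‖(H *ᵥ e) a‖ := by
        rw [h1, Finset.mul_sum]
        simp
    _ ≤ ∑ a, ∑ b, ‖H a b‖ * ∑ c, ‖e c‖ := by
        refine Finset.sum_le_sum fun a _ => ?_
        refine (norm_sum_le _ _).trans (Finset.sum_le_sum fun b _ => ?_)
        rw [norm_mul]
        exact mul_le_mul_of_nonneg_left
          (Finset.single_le_sum (f := fun c => ‖e c‖) (fun c _ => norm_nonneg _)
            (Finset.mem_univ b)) (norm_nonneg _)
    _ = (∑ a, ∑ b, ‖H a b‖) * ∑ b, ‖e b‖ := by simp only [Finset.sum_mul]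

theorem isHermitian_pencil_real {r : ℕ} {A B : Matrix (Fin r) (Fin r) ℂ} (hA : A.IsHermitian)
    (hB : B.IsHermitian) (w : ℝ) : ((w : ℂ) • A + B).IsHermitian := by
  have := isHermitian_pencil hA hB (w := (w : ℂ)) (Complex.conj_ofReal w) 0
  simpa using this

/-- Integrals of continuous functions against the quadratic forms of the spectral measure. -/
theorem IsSpectralMeasure.integral_eq {r : ℕ} {A B : Matrix (Fin r) (Fin r) ℂ}
    (hA : A.IsHermitian) (hAdet : A.det ≠ 0) (hB : B.IsHermitian) {α : ℕ → ℝ} {p : ℕ → ℝ → ℝ}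
    {ν : Measure ℝ} (hν : IsScalarSystem α p ν)
    {W : VectorMeasure ℝ (Matrix (Fin r) (Fin r) ℂ)}
    (hW : IsSpectralMeasure (fun m => (α m : ℂ) • A) (fun _ => B) W) {μ : Measure ℝ}
    [IsFiniteMeasure μ] {u : Fin r → ℂ}
    (hμ : ∀ E : Set ℝ, MeasurableSet E → ((μ.real E : ℝ) : ℂ) = star u ⬝ᵥ W E *ᵥ u)
    {f : ℝ → ℝ} (hf : Continuous f) :
    ∫ x, f x ∂μ = ∫ w, specSum (isHermitian_pencil_real hA hB w) u f ∂ν := by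
  have := hν.isFinite
  have hspec : ∀ (k : ℕ) (w : ℝ), specSum (isHermitian_pencil_real hA hB w) u (fun t => t ^ k) =
      (star u ⬝ᵥ (((w : ℂ) • A + B) ^ k) *ᵥ u).re := fun k w => by
    rw [dotProduct_pow_mulVec_eq_specSum (isHermitian_pencil_real hA hB w), Complex.ofReal_re]
  have hH : Continuous fun w : ℝ => (w : ℂ) • A + B :=
    (Complex.continuous_ofReal.smul continuous_const).add continuous_const
  have hcont : ∀ k : ℕ, Continuous fun w : ℝ => star u ⬝ᵥ (((w : ℂ) • A + B) ^ k) *ᵥ u :=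
    fun k => (continuous_const (y := star u)).dotProduct
      ((hH.pow k).matrix_mulVec continuous_const)
  have hentry : ∀ (k : ℕ) (i j : Fin r), Integrable (fun w : ℝ => (((w : ℂ) • A + B) ^ k) i j) ν :=
    fun k i j => hν.integrable ((hH.pow k).matrix_elem i j)
  refine integral_eq_of_moments (R := ∑ a, ∑ b, (2 * ‖A a b‖ + ‖B a b‖))
    (K := (star u ⬝ᵥ u).re) (by positivity) ?_ (fun w j => by positivity) (fun w => ?_)
    (fun k => ?_) (fun k => ?_) (fun k => ?_) hf
  · filter_upwards [hν.abs_le] with w hw j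
    refine (abs_eigenvalues_le _ j).trans
      (Finset.sum_le_sum fun a _ => Finset.sum_le_sum fun b _ => ?_)
    refine (norm_add_le _ _).trans (add_le_add ?_ le_rfl)
    rw [Matrix.smul_apply, norm_smul, Complex.norm_real, Real.norm_eq_abs]
    exact mul_le_mul_of_nonneg_right hw (norm_nonneg _)
  · have := hspec 0 w
    simpa [specSum] using this
  · have h := integrable_of_integrable_entry hμ fun i j => hW.moments i j k
    have h2 := h.re
    refine h2.congr (Filter.Eventually.of_forall fun x => ?_)
    simp [← Complex.ofReal_pow]
  · have h := (Complex.continuous_re.comp (hcont k)).aestronglyMeasurable (μ := ν)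
    refine h.congr (Filter.Eventually.of_forall fun w => (hspec k w).symm)
  · have h1 : ((∫ x, x ^ k ∂μ : ℝ) : ℂ) = ∫ w : ℝ, star u ⬝ᵥ (((w : ℂ) • A + B) ^ k) *ᵥ u ∂ν := by
      rw [integral_quadMeasure hμ (fun i j => hW.isFiniteMeasure i j) (by fun_prop)
        (fun i j => by simpa using hW.moments i j k)]
      simp only [star_dotProduct_mulVec_eq_sum]
      rw [integral_finsetSum _ fun i _ => integrable_finsetSum _ fun j _ =>
        (hentry k i j).const_mul _]
      refine Finset.sum_congr rfl fun i _ => ?_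
      rw [integral_finsetSum _ fun j _ => (hentry k i j).const_mul _]
      refine Finset.sum_congr rfl fun j _ => ?_
      rw [integral_const_mul, ← hW.moment_eq hA hAdet hν]
      simp
    have h2 : ∀ w : ℝ, star u ⬝ᵥ (((w : ℂ) • A + B) ^ k) *ᵥ u =
        ((specSum (isHermitian_pencil_real hA hB w) u fun t => t ^ k : ℝ) : ℂ) := fun w =>
      dotProduct_pow_mulVec_eq_specSum _ u k
    simp only [h2] at h1
    rw [integral_complex_ofReal] at h1
    exact_mod_cast h1

end Determinacy
-- Eigenvalue branches along a real interval
section RealStructure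

variable {r : ℕ} {A B : Matrix (Fin r) (Fin r) ℂ} {ι : Type} {κ : Fin r → ι}
  {φ : ι → ℂ → ℂ} {V : ℂ → Matrix (Fin r) (Fin r) ℂ} {U : Set ℂ}

/-- An analytic local diagonalization around a real point, on a real interval on which no
eigenvalue passes through `±2`, changes from real to nonreal, or takes a value of another one. -/
structure RealLocalDiag (A B : Matrix (Fin r) (Fin r) ℂ) (κ : Fin r → ι)
    (φ : ι → ℂ → ℂ) (V : ℂ → Matrix (Fin r) (Fin r) ℂ) (U : Set ℂ) (t₀ δ : ℝ) : Prop
    extends LocalDiag A B κ φ V U where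
  pos : 0 < δ
  mem : ∀ x ∈ Set.Icc (t₀ - δ) (t₀ + δ), (x : ℂ) ∈ U
  ne_two : ∀ t ∈ U, ∀ i, φ i t ≠ 2
  ne_neg_two : ∀ t ∈ U, ∀ i, φ i t ≠ -2
  star_eq : ∀ i, star (φ i t₀) = φ i t₀ → ∀ x ∈ Set.Icc (t₀ - δ) (t₀ + δ),
    star (φ i (x : ℝ)) = φ i (x : ℝ)
  star_ne : ∀ i, star (φ i t₀) ≠ φ i t₀ → ∀ x ∈ Set.Icc (t₀ - δ) (t₀ + δ),
    star (φ i (x : ℝ)) ≠ φ i (x : ℝ)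
  separated : ∀ i j, i ≠ j → ∀ x ∈ Set.Icc (t₀ - δ) (t₀ + δ), ∀ y ∈ Set.Icc (t₀ - δ) (t₀ + δ),
    φ i (x : ℝ) ≠ φ j (y : ℝ)

/-- Apart from persistence of reality, every condition is open at `t₀`. The conjugate of an
eigenvalue of the pencil matrix at a real point is again one; for a branch real at `t₀`, continuity
forces it to be the same branch. -/
theorem LocalDiag.exists_realLocalDiag [Fintype ι] (h : LocalDiag A B κ φ V U)
    (hA : A.IsHermitian) (hAdet : A.det ≠ 0) (hB : B.IsHermitian) {t₀ : ℝ} (ht₀ : (t₀ : ℂ) ∈ U)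
    (h2 : ((2 : ℂ) • A + B - (t₀ : ℂ) • 1).det ≠ 0)
    (h2' : ((-2 : ℂ) • A + B - (t₀ : ℂ) • 1).det ≠ 0) :
    ∃ (U' : Set ℂ) (δ : ℝ), U' ⊆ U ∧ RealLocalDiag A B κ φ V U' t₀ δ := by
  have hcont : ∀ i, ContinuousAt (φ i) t₀ := fun i => (h.analytic i _ ht₀).continuousAt
  have hne : ∀ w : ℂ, (w • A + B - (t₀ : ℂ) • 1).det ≠ 0 →
      ∀ᶠ t in 𝓝 (t₀ : ℂ), ∀ i, φ i t ≠ w := fun w hw => by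
    rw [Filter.eventually_all]
    intro i
    refine (hcont i).eventually_ne ?_
    obtain ⟨k, rfl⟩ := h.surjective i
    exact fun e => hw ((h.det_eq_zero_iff hAdet ht₀).2 ⟨k, e⟩)
  obtain ⟨U₁, hU₁, hU₁o, hU₁t⟩ := eventually_nhds_iff.1 ((hne 2 h2).and (hne (-2) h2'))
  have hrc : ∀ i, ContinuousAt (fun x : ℝ => φ i x) t₀ := fun i =>
    ContinuousAt.comp (f := fun x : ℝ => (x : ℂ)) (hcont i) Complex.continuous_ofReal.continuousAt
  have hmem : ∀ᶠ x : ℝ in 𝓝 t₀, (x : ℂ) ∈ U ∩ U₁ :=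
    Complex.continuous_ofReal.continuousAt.eventually_mem
      ((h.isOpen.inter hU₁o).mem_nhds ⟨ht₀, hU₁t⟩)
  have hstarne : ∀ᶠ x : ℝ in 𝓝 t₀, ∀ i j, star (φ i t₀) ≠ φ j t₀ →
      star (φ i x) ≠ φ j x := by
    simp only [Filter.eventually_all]
    intro i j hij
    have h1 : ContinuousAt (fun x : ℝ => star (φ i x) - φ j x) t₀ :=
      (hrc i).star.sub (hrc j)
    exact (h1.eventually_ne (sub_ne_zero.2 hij)).mono fun x hx => sub_ne_zero.1 hx
  have hsep : ∀ᶠ p : ℝ × ℝ in 𝓝 t₀ ×ˢ 𝓝 t₀, ∀ i j, i ≠ j → φ i p.1 ≠ φ j p.2 := by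
    simp only [Filter.eventually_all]
    intro i j hij
    have h1 : Filter.Tendsto (fun p : ℝ × ℝ => φ i p.1 - φ j p.2) (𝓝 t₀ ×ˢ 𝓝 t₀)
        (𝓝 (φ i t₀ - φ j t₀)) :=
      ((hrc i).tendsto.comp Filter.tendsto_fst).sub ((hrc j).tendsto.comp Filter.tendsto_snd)
    refine (h1.eventually_ne (sub_ne_zero.2 fun e => hij (h.injective _ ht₀ e))).mono
      fun x hx => sub_ne_zero.1 hx
  obtain ⟨N, hN, hNsep⟩ := (Filter.eventually_prod_self_iff
    (r := fun x y : ℝ => ∀ i j, i ≠ j → φ i x ≠ φ j y)).1 hsep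
  have hall := (hmem.and hstarne).and hN
  obtain ⟨ε, hε, hball⟩ := Metric.eventually_nhds_iff.1 hall
  have hIcc : ∀ x ∈ Set.Icc (t₀ - ε / 2) (t₀ + ε / 2), dist x t₀ < ε := fun x hx => by
    rw [Real.dist_eq]
    have : |x - t₀| ≤ ε / 2 := abs_le.2 ⟨by linarith [hx.1], by linarith [hx.2]⟩
    linarith
  refine ⟨U ∩ U₁, ε / 2, Set.inter_subset_left,
    { h.mono (h.isOpen.inter hU₁o) Set.inter_subset_left with
      pos := by positivity
      mem := fun x hx => (hball (hIcc x hx)).1.1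
      ne_two := fun t ht i => (hU₁ t ht.2).1 i
      ne_neg_two := fun t ht i => (hU₁ t ht.2).2 i
      star_eq := ?_
      star_ne := fun i hi x hx => (hball (hIcc x hx)).1.2 i i hi
      separated := fun i j hij x hx y hy => hNsep x (hball (hIcc x hx)).2 y
        (hball (hIcc y hy)).2 i j hij }⟩
  intro i hi x hx
  have hxU := (hball (hIcc x hx)).1.1
  obtain ⟨k, rfl⟩ := h.surjective i
  have h0 : (φ (κ k) x • A + B - (x : ℂ) • 1).det = 0 :=
    (h.det_eq_zero_iff hAdet hxU.1).2 ⟨k, rfl⟩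
  have h1 : (star (φ (κ k) x) • A + B - (x : ℂ) • 1).det = 0 := by
    rw [det_pencil_star hA hB, h0, star_zero]
  obtain ⟨j, hj⟩ := (h.det_eq_zero_iff hAdet hxU.1).1 h1
  by_cases hjk : κ j = κ k
  · rw [← hj, hjk]
  · exfalso
    refine (hball (hIcc x hx)).1.2 (κ k) (κ j) ?_ hj.symm
    rw [hi]
    exact fun e => hjk (h.injective _ ht₀ e).symm

variable {t₀ δ : ℝ}

theorem LocalDiag.hasDerivAt_re (h : LocalDiag A B κ φ V U) {x : ℝ} (hx : (x : ℂ) ∈ U) (i : ι) :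
    HasDerivAt (fun y : ℝ => (φ i y).re) (deriv (φ i) x).re x :=
  ((h.analytic i) x hx).differentiableAt.hasDerivAt.real_of_complex

theorem RealLocalDiag.eq_re (h : RealLocalDiag A B κ φ V U t₀ δ) {i : ι}
    (hi : star (φ i t₀) = φ i t₀) {x : ℝ} (hx : x ∈ Set.Icc (t₀ - δ) (t₀ + δ)) :
    φ i x = ((φ i x).re : ℂ) := (Complex.conj_eq_iff_re.1 (h.star_eq i hi x hx)).symm

/-- Rolle's theorem: the derivative of a real branch never vanishes. -/
theorem RealLocalDiag.injOn (h : RealLocalDiag A B κ φ V U t₀ δ) (hA : A.IsHermitian)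
    (hAdet : A.det ≠ 0) (hB : B.IsHermitian) {i : ι} (hi : star (φ i t₀) = φ i t₀) :
    Set.InjOn (fun y : ℝ => (φ i y).re) (Set.Icc (t₀ - δ) (t₀ + δ)) := by
  have key : ∀ x ∈ Set.Icc (t₀ - δ) (t₀ + δ), ∀ y ∈ Set.Icc (t₀ - δ) (t₀ + δ), x < y →
      (φ i x).re ≠ (φ i y).re := by
    intro x hx y hy hxy he
    have hsub : ∀ z ∈ Set.Icc x y, z ∈ Set.Icc (t₀ - δ) (t₀ + δ) := fun z hz =>
      ⟨hx.1.trans hz.1, hz.2.trans hy.2⟩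
    obtain ⟨c, hc, hc0⟩ := exists_hasDerivAt_eq_zero hxy
      (fun z hz => (h.hasDerivAt_re (h.mem z (hsub z hz)) i).continuousAt.continuousWithinAt) he
      (fun z hz => h.hasDerivAt_re (h.mem z (hsub z (Set.Ioo_subset_Icc_self hz))) i)
    have hcI := hsub c (Set.Ioo_subset_Icc_self hc)
    exact (h.deriv_real hA hAdet hB (h.mem c hcI) i (h.star_eq i hi c hcI)).2 hc0
  intro x hx y hy hxy
  rcases lt_trichotomy x y with h1 | h1 | h1
  · exact absurd hxy (key x hx y hy h1)
  · exact h1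
  · exact absurd hxy.symm (key y hy x hx h1)

/-- The quadratic form of the derivative-normalized spectral projection. -/
noncomputable def projForm (A : Matrix (Fin r) (Fin r) ℂ) (κ : Fin r → ι) (φ : ι → ℂ → ℂ)
    (V : ℂ → Matrix (Fin r) (Fin r) ℂ) (u : Fin r → ℂ) (i : ι) (x : ℝ) : ℝ :=
  (star u ⬝ᵥ (classProj κ (V x) i * A⁻¹) *ᵥ u).re / (deriv (φ i) x).re

/-- Only the `x`-eigenspace of `φ i x • A + B` is seen by `f`. Another eigenvalue `t` in the
interval would give `φ j t = φ i x` for some `j`, excluded by separation if `j ≠ i` and by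
injectivity if `j = i`. -/
theorem RealLocalDiag.specSum_eq (h : RealLocalDiag A B κ φ V U t₀ δ) (hA : A.IsHermitian)
    (hAdet : A.det ≠ 0) (hB : B.IsHermitian) {i : ι} (hi : star (φ i t₀) = φ i t₀) {x : ℝ}
    (hx : x ∈ Set.Icc (t₀ - δ) (t₀ + δ)) (u : Fin r → ℂ) {f : ℝ → ℝ}
    (hf : ∀ y, y ≠ x → f y ≠ 0 → y ∈ Set.Icc (t₀ - δ) (t₀ + δ)) :
    specSum (isHermitian_pencil_real hA hB (φ i x).re) u f = f x * projForm A κ φ V u i x := by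
  set hH := isHermitian_pencil_real hA hB (φ i x).re
  have hre := h.eq_re hi hx
  have hst := h.star_eq i hi x hx
  have hxU := h.mem x hx
  obtain ⟨hd1, hd2⟩ := h.deriv_real hA hAdet hB hxU i hst
  have hker : ∀ v : Fin r → ℂ, (((φ i x).re : ℂ) • A + B) *ᵥ v = (x : ℂ) • v ↔
      (φ i x • A + B - (x : ℂ) • 1) *ᵥ v = 0 := fun v => by
    rw [← hre, Matrix.sub_mulVec (φ i x • A + B), Matrix.smul_mulVec, Matrix.one_mulVec,
      sub_eq_zero]
  have h1 := mul_specSum_eq hH (h.isHermitian_classProj_mul_inv hA hAdet hB hxU i hst) x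
    (deriv (φ i) x)
    (fun v => by
      rw [hker, ← Matrix.mulVec_mulVec]
      exact h.pencil_mulVec_classProj hxU i _)
    (fun v hv => h.classProj_mul_inv_mulVec hA hAdet hB hxU i hst ((hker v).1 hv)) u f
    (fun j hj => by
      by_contra hne
      have hI := hf _ hj hne
      set t := hH.eigenvalues j with ht
      have hev : (((φ i x).re : ℂ) • A + B) *ᵥ (hH.eigenvectorBasis j).ofLp =
        (t : ℂ) • (hH.eigenvectorBasis j).ofLp := hH.mulVec_eigenvectorBasis j
      have hv0 : (hH.eigenvectorBasis j).ofLp ≠ 0 := fun h0 => by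
        refine hH.eigenvectorBasis.orthonormal.ne_zero j ?_
        ext i
        exact congrFun h0 i
      have hv : (((φ i x).re : ℂ) • A + B - (t : ℂ) • 1) *ᵥ (hH.eigenvectorBasis j).ofLp = 0 := by
        rw [Matrix.sub_mulVec, hev, Matrix.smul_mulVec, Matrix.one_mulVec, sub_self]
      obtain ⟨k, hk⟩ := h.exists_eq hAdet (h.mem t hI) hv hv0
      rw [← hre] at hk
      have hki : κ k = i := by
        by_contra hki
        exact h.separated (κ k) i hki t hI x hx hk
      rw [hki] at hk
      exact hj (h.injOn hA hAdet hB hi hI hx (congrArg Complex.re hk)))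
  rw [hd1] at h1
  have h2 := congrArg Complex.re h1
  rw [Complex.re_ofReal_mul, Complex.ofReal_re, Complex.re_ofReal_mul] at h2
  rw [projForm, mul_div_assoc', ← h2, mul_div_cancel_left₀ _ hd2]

theorem RealLocalDiag.projForm_nonneg (h : RealLocalDiag A B κ φ V U t₀ δ) (hA : A.IsHermitian)
    (hAdet : A.det ≠ 0) (hB : B.IsHermitian) {i : ι} (hi : star (φ i t₀) = φ i t₀) {x : ℝ}
    (hx : x ∈ Set.Icc (t₀ - δ) (t₀ + δ)) (u : Fin r → ℂ) : 0 ≤ projForm A κ φ V u i x := by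
  classical
  -- For the indicator of `{x}` the spectral sum is a sum of squares and equals `projForm`.
  have h1 := h.specSum_eq hA hAdet hB hi hx u (f := fun y => if y = x then 1 else 0)
    (fun y hy hne => absurd (if_neg hy) hne)
  rw [if_pos rfl, one_mul] at h1
  rw [← h1]
  refine Finset.sum_nonneg fun j _ => mul_nonneg ?_ (by positivity)
  beta_reduce
  split_ifs <;> norm_num

/-- An eigenvalue of `w A + B` in the interval would put the real number `w` on some branch,
necessarily one real at `t₀`, since nonreal branches stay nonreal. -/
theorem RealLocalDiag.specSum_eq_zero (h : RealLocalDiag A B κ φ V U t₀ δ) (hA : A.IsHermitian)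
    (hAdet : A.det ≠ 0) (hB : B.IsHermitian) {w : ℝ}
    (hw : ∀ i, star (φ i t₀) = φ i t₀ → w ∉ (fun y : ℝ => (φ i y).re) '' Set.Ioo (t₀ - δ) (t₀ + δ))
    (u : Fin r → ℂ) {f : ℝ → ℝ} (hf : ∀ y, f y ≠ 0 → y ∈ Set.Ioo (t₀ - δ) (t₀ + δ)) :
    specSum (isHermitian_pencil_real hA hB w) u f = 0 := by
  set hH := isHermitian_pencil_real hA hB w
  refine Finset.sum_eq_zero fun j _ => ?_
  suffices f (hH.eigenvalues j) = 0 by rw [this, zero_mul]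
  by_contra hne
  set t := hH.eigenvalues j with ht
  have hI := hf _ hne
  have hIc := Set.Ioo_subset_Icc_self hI
  have hev : ((w : ℂ) • A + B) *ᵥ (hH.eigenvectorBasis j).ofLp =
    (t : ℂ) • (hH.eigenvectorBasis j).ofLp := hH.mulVec_eigenvectorBasis j
  have hv0 : (hH.eigenvectorBasis j).ofLp ≠ 0 := fun h0 => by
    refine hH.eigenvectorBasis.orthonormal.ne_zero j ?_
    ext i
    exact congrFun h0 i
  have hv : ((w : ℂ) • A + B - (t : ℂ) • 1) *ᵥ (hH.eigenvectorBasis j).ofLp = 0 := by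
    rw [Matrix.sub_mulVec, hev, Matrix.smul_mulVec, Matrix.one_mulVec, sub_self]
  obtain ⟨k, hk⟩ := h.exists_eq hAdet (h.mem t hIc) hv hv0
  by_cases hs : star (φ (κ k) t₀) = φ (κ k) t₀
  · exact hw _ hs ⟨t, hI, by simp only [hk, Complex.ofReal_re]⟩
  · refine h.star_ne _ hs t hIc ?_
    rw [hk]
    exact Complex.conj_ofReal w

theorem LocalDiag.continuousOn_classProj (h : LocalDiag A B κ φ V U) (i : ι) :
    ContinuousOn (fun t => classProj κ (V t) i) U := by
  have hdet : ContinuousOn (fun t => (V t).det) U :=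
    (continuous_id.matrix_det).comp_continuousOn h.continuousOn
  have hadj : ContinuousOn (fun t => (V t).adjugate) U :=
    (continuous_id.matrix_adjugate).comp_continuousOn h.continuousOn
  have hinv : ContinuousOn (fun t => (V t)⁻¹) U := by
    simp only [Matrix.inv_def, Ring.inverse_eq_inv']
    exact (hdet.inv₀ h.det_ne_zero).smul hadj
  exact (h.continuousOn.mul continuousOn_const).mul hinv

theorem RealLocalDiag.continuousOn_deriv (h : RealLocalDiag A B κ φ V U t₀ δ) (i : ι) :
    ContinuousOn (fun x : ℝ => (deriv (φ i) x).re) (Set.Icc (t₀ - δ) (t₀ + δ)) := fun x hx =>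
  (Complex.continuous_re.continuousAt.comp
    (ContinuousAt.comp (f := fun x : ℝ => (x : ℂ)) (h.analytic i x (h.mem x hx)).deriv.continuousAt
      Complex.continuous_ofReal.continuousAt)).continuousWithinAt

theorem RealLocalDiag.continuousOn_re (h : RealLocalDiag A B κ φ V U t₀ δ) (i : ι) :
    ContinuousOn (fun x : ℝ => (φ i x).re) (Set.Icc (t₀ - δ) (t₀ + δ)) := fun x hx =>
  (h.hasDerivAt_re (h.mem x hx) i).continuousAt.continuousWithinAt

theorem RealLocalDiag.continuousOn_density (h : RealLocalDiag A B κ φ V U t₀ δ) {ρ : ℝ → ℝ}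
    (hρ : ContinuousOn ρ {2, -2}ᶜ) {i : ι} (hi : star (φ i t₀) = φ i t₀) :
    ContinuousOn (fun x : ℝ => ρ (φ i x).re) (Set.Icc (t₀ - δ) (t₀ + δ)) := by
  refine hρ.comp (h.continuousOn_re i) fun x hx => ?_
  have h1 := h.ne_two x (h.mem x hx) i
  have h2 := h.ne_neg_two x (h.mem x hx) i
  rw [h.eq_re hi hx] at h1 h2
  rintro (h3 | h3)
  · exact h1 (by rw [h3]; norm_num)
  · exact h2 (by rw [h3]; norm_num)

theorem RealLocalDiag.continuousOn_projMatrix (h : RealLocalDiag A B κ φ V U t₀ δ) (i : ι) :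
    ContinuousOn (fun x : ℝ => classProj κ (V x) i * A⁻¹) (Set.Icc (t₀ - δ) (t₀ + δ)) :=
  ((h.continuousOn_classProj i).comp Complex.continuous_ofReal.continuousOn h.mem).mul
    continuousOn_const

end RealStructure
-- Identifying densities from integrals
section MeasureLemmas

theorem _root_.MeasureTheory.SignedMeasure.rnDeriv_ae_eq_restrict (s : SignedMeasure ℝ)
    {I : Set ℝ} (hI : MeasurableSet I) {g : ℝ → ℝ} (hg : IntegrableOn g I)
    (h : ∀ E, MeasurableSet E → E ⊆ I → s E = ∫ x in E, g x) :
    s.rnDeriv volume =ᵐ[volume.restrict I] g := by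
  -- `S` has full Lebesgue measure and the singular part vanishes on its subsets.
  obtain ⟨S, hS, hS1, hS2⟩ := s.mutuallySingular_singularPart volume
  have hSc : volume Sᶜ = 0 := by
    by_contra hne
    have h2 := hS2 Sᶜ le_rfl
    rw [Measure.toENNRealVectorMeasure_apply_measurable hS.compl] at h2
    exact hne h2
  have hD := s.integrable_rnDeriv volume
  have hnull : ∀ (E : Set ℝ) (f : ℝ → ℝ), ∫ x in E ∩ S, f x = ∫ x in E, f x := fun E f => by
    refine setIntegral_congr_set ?_
    have : S =ᵐ[volume] Set.univ := by
      rw [ae_eq_univ]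
      exact hSc
    simpa using (ae_eq_refl E).inter this
  refine Integrable.ae_eq_of_forall_setIntegral_eq _ _ hD.restrict hg fun E hE _ => ?_
  rw [Measure.restrict_restrict hE, ← hnull, ← hnull (E ∩ I)]
  have hm : MeasurableSet (E ∩ I ∩ S) := (hE.inter hI).inter hS
  rw [← h _ hm (Set.inter_subset_left.trans Set.inter_subset_right)]
  have h3 := congrArg (fun v : SignedMeasure ℝ => v (E ∩ I ∩ S))
    (s.singularPart_add_withDensity_rnDeriv_eq (μ := volume))
  simp only [_root_.add_apply] at h3
  rw [hS1 _ Set.inter_subset_right, zero_add, withDensityᵥ_apply hD hm] at h3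
  exact h3

theorem _root_.MeasureTheory.ComplexMeasure.rnDeriv_ae_eq_restrict (c : ComplexMeasure ℝ)
    {I : Set ℝ} (hI : MeasurableSet I) {g : ℝ → ℂ} (hg : IntegrableOn g I)
    (h : ∀ E, MeasurableSet E → E ⊆ I → c E = ∫ x in E, g x) :
    c.rnDeriv volume =ᵐ[volume.restrict I] g := by
  have h1 := SignedMeasure.rnDeriv_ae_eq_restrict (ComplexMeasure.re c) hI
    (g := fun x => (g x).re) hg.re fun E hE hEI => by
      have := congrArg Complex.re (h E hE hEI)
      have h2 := integral_re (𝕜 := ℂ) (hg.mono_set hEI)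
      simp only [RCLike.re_to_complex] at h2
      rw [h2, ← this]
      rfl
  have h2 := SignedMeasure.rnDeriv_ae_eq_restrict (ComplexMeasure.im c) hI
    (g := fun x => (g x).im) hg.im fun E hE hEI => by
      have := congrArg Complex.im (h E hE hEI)
      have h2 := integral_im (𝕜 := ℂ) (hg.mono_set hEI)
      simp only [RCLike.im_to_complex] at h2
      rw [h2, ← this]
      rfl
  filter_upwards [h1, h2] with x hx1 hx2
  exact Complex.ext hx1 hx2

/-- A finite measure which on an open interval integrates test functions like a density `g` has
this density on that interval. -/
theorem measureReal_eq_setIntegral {μ : Measure ℝ} [IsFiniteMeasure μ] {t₀ δ : ℝ} {g : ℝ → ℝ}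
    (hg : ContinuousOn g (Set.Icc (t₀ - δ) (t₀ + δ)))
    (hg0 : ∀ x ∈ Set.Icc (t₀ - δ) (t₀ + δ), 0 ≤ g x)
    (h : ∀ f : ℝ → ℝ, Continuous f → (∀ y, f y ≠ 0 → y ∈ Set.Ioo (t₀ - δ) (t₀ + δ)) →
      ∫ x, f x ∂μ = ∫ x in Set.Ioo (t₀ - δ) (t₀ + δ), f x * g x)
    {E : Set ℝ} (hE : MeasurableSet E) (hEI : E ⊆ Set.Ioo (t₀ - δ) (t₀ + δ)) :
    μ.real E = ∫ x in E, g x := by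
  set I := Set.Ioo (t₀ - δ) (t₀ + δ) with hI
  have hIm : MeasurableSet I := measurableSet_Ioo
  have hgI : IntegrableOn g I :=
    (hg.integrableOn_compact isCompact_Icc).mono_set Set.Ioo_subset_Icc_self
  -- The tent function `χ` is positive exactly on `I`. Multiplying by it turns every bounded
  -- continuous function into an admissible test function, and the resulting equality of
  -- `χ`-weighted measures can be divided by `χ`.
  set χ : ℝ → ℝ := fun x => max 0 (δ - |x - t₀|) with hχ
  have hχc : Continuous χ := by fun_prop
  have hχ0 : ∀ x, 0 ≤ χ x := fun x => le_max_left _ _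
  have hχI : ∀ x, χ x ≠ 0 ↔ x ∈ I := fun x => by
    rw [← (hχ0 x).lt_iff_ne', hI, Set.mem_Ioo]
    rw [hχ, lt_max_iff]
    simp only [lt_irrefl, false_or, sub_pos, abs_lt]
    constructor
    · rintro ⟨h1, h2⟩; constructor <;> linarith
    · rintro ⟨h1, h2⟩; constructor <;> linarith
  set m₁ := μ.restrict I
  set m₂ := (volume.restrict I).withDensity (fun x => ENNReal.ofReal (g x)) with hm₂
  have : IsFiniteMeasure m₂ := isFiniteMeasure_withDensity_ofReal hgI.2
  have hgm : AEMeasurable (fun x => ENNReal.ofReal (g x)) (volume.restrict I) :=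
    hgI.aestronglyMeasurable.aemeasurable.ennreal_ofReal
  have hχm : Measurable fun x => ENNReal.ofReal (χ x) := hχc.measurable.ennreal_ofReal
  have hχint : ∀ (m : Measure ℝ) [IsFiniteMeasure m], Integrable χ m := fun m _ =>
    Integrable.of_bound hχc.aestronglyMeasurable |δ| (Filter.Eventually.of_forall fun x => by
      rw [Real.norm_of_nonneg (hχ0 x)]
      exact max_le (abs_nonneg _) ((sub_le_self _ (abs_nonneg _)).trans (le_abs_self _)))
  have hfin : ∀ (m : Measure ℝ) [IsFiniteMeasure m],
      IsFiniteMeasure (m.withDensity fun x => ENNReal.ofReal (χ x)) := fun m _ =>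
    isFiniteMeasure_withDensity_ofReal (hχint m).2
  have hf1 := hfin m₁
  have hf2 := hfin m₂
  have key : m₁.withDensity (fun x => ENNReal.ofReal (χ x)) =
      m₂.withDensity (fun x => ENNReal.ofReal (χ x)) := by
    refine ext_of_forall_integral_eq_of_IsFiniteMeasure fun f => ?_
    rw [integral_withDensity_eq_integral_toReal_smul hχm (by simp),
      integral_withDensity_eq_integral_toReal_smul hχm (by simp), hm₂,
      integral_withDensity_eq_integral_toReal_smul₀ hgm (by simp)]
    simp only [ENNReal.toReal_ofReal (hχ0 _), smul_eq_mul]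
    have hsupp : ∀ y, χ y * f y ≠ 0 → y ∈ I := fun y hy => (hχI y).1 (left_ne_zero_of_mul hy)
    rw [setIntegral_eq_integral_of_forall_compl_eq_zero (fun x hx => not_imp_comm.1 (hsupp x) hx),
      h (fun x => χ x * f x) (hχc.mul f.continuous) hsupp]
    refine setIntegral_congr_fun hIm fun x hx => ?_
    rw [ENNReal.toReal_ofReal (hg0 x (Set.Ioo_subset_Icc_self hx))]
    ring
  have hinv : ∀ m : Measure ℝ, (∀ᵐ x ∂m, x ∈ I) →
      (m.withDensity fun x => ENNReal.ofReal (χ x)).withDensity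
        (fun x => ENNReal.ofReal (χ x))⁻¹ = m := fun m hm =>
    withDensity_inv_same hχm (hm.mono fun x hx => by
      rw [Ne, ENNReal.ofReal_eq_zero, not_le]
      exact lt_of_le_of_ne (hχ0 x) ((hχI x).2 hx).symm) (by simp)
  have hm : m₁ = m₂ := by
    rw [← hinv m₁ (ae_restrict_mem hIm), ← hinv m₂ ?_, key]
    exact (withDensity_absolutelyContinuous _ _).ae_le (ae_restrict_mem hIm)
  have hEr : (volume.restrict I).restrict E = volume.restrict E := by
    rw [Measure.restrict_restrict hE, Set.inter_eq_left.2 hEI]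
  have h1 : μ E = ∫⁻ x in E, ENNReal.ofReal (g x) := by
    rw [← Set.inter_eq_left.2 hEI, ← Measure.restrict_apply hE,
      show μ.restrict I = m₂ from hm, hm₂, withDensity_apply _ hE, hEr, Set.inter_eq_left.2 hEI]
  rw [Measure.real, h1, integral_eq_lintegral_of_nonneg_ae]
  · exact (ae_restrict_mem hE).mono fun x hx => hg0 x (Set.Ioo_subset_Icc_self (hEI hx))
  · exact (hgI.mono_set hEI).aestronglyMeasurable

theorem eq_zero_of_star_dotProduct_mulVec_eq_zero {r : ℕ} {N : Matrix (Fin r) (Fin r) ℂ}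
    (h : ∀ u : Fin r → ℂ, star u ⬝ᵥ N *ᵥ u = 0) : N = 0 := by
  have h1 : Matrix.toEuclideanLin N = 0 := by
    rw [← inner_map_self_eq_zero]
    intro x
    rw [← inner_conj_symm]
    have := h x.ofLp
    simp only [EuclideanSpace.inner_eq_star_dotProduct, Matrix.ofLp_toLpLin, Matrix.toLin'_apply]
    rw [dotProduct_comm, this, map_zero]
  exact (LinearEquiv.map_eq_zero_iff _).1 h1

end MeasureLemmas

/-! ### The density near a regular point -/

section LocalDensity

variable {r : ℕ} {A B : Matrix (Fin r) (Fin r) ℂ} {ι : Type} {κ : Fin r → ι}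
  {φ : ι → ℂ → ℂ} {V : ℂ → Matrix (Fin r) (Fin r) ℂ} {U : Set ℂ} {t₀ δ : ℝ}

/-- The density at `x` of the matrix measure `∫ E_{wA+B} ρ(w) dw`: the eigenvalues which are real
contribute `ρ` times the spectral projection divided by the modulus of the derivative. -/
noncomputable def localDensity (A : Matrix (Fin r) (Fin r) ℂ) (κ : Fin r → ι) (φ : ι → ℂ → ℂ)
    (V : ℂ → Matrix (Fin r) (Fin r) ℂ) (ρ : ℝ → ℝ) (S : Finset ι) (x : ℝ) :
    Matrix (Fin r) (Fin r) ℂ :=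
  ∑ i ∈ S, ((ρ (φ i x).re * Real.sign (deriv (φ i) x).re : ℝ) : ℂ) • (classProj κ (V x) i * A⁻¹)

theorem sign_eq_abs_div {d : ℝ} (hd : d ≠ 0) : Real.sign d = |d| / d := by
  rw [eq_div_iff hd]
  rcases lt_or_gt_of_ne hd with h | h
  · rw [Real.sign_of_neg h, abs_of_neg h]; ring
  · rw [Real.sign_of_pos h, abs_of_pos h]; ring

/-- The Jacobian `|φ'|` and the factor `1 / φ'` in `projForm` combine to the sign of `φ'`. In this
form the density is visibly nonnegative when `ρ` is. -/
theorem RealLocalDiag.re_dotProduct_localDensity (h : RealLocalDiag A B κ φ V U t₀ δ)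
    (hA : A.IsHermitian) (hAdet : A.det ≠ 0) (hB : B.IsHermitian) (ρ : ℝ → ℝ) {S : Finset ι}
    (hS : ∀ i ∈ S, star (φ i t₀) = φ i t₀) {x : ℝ} (hx : x ∈ Set.Icc (t₀ - δ) (t₀ + δ))
    (u : Fin r → ℂ) :
    (star u ⬝ᵥ localDensity A κ φ V ρ S x *ᵥ u).re =
      ∑ i ∈ S, |(deriv (φ i) x).re| * (ρ (φ i x).re * projForm A κ φ V u i x) := by
  rw [localDensity, Matrix.sum_mulVec, dotProduct_sum, Complex.re_sum]
  refine Finset.sum_congr rfl fun i hi => ?_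
  have hd := (h.deriv_real hA hAdet hB (h.mem x hx) i (h.star_eq i (hS i hi) x hx)).2
  rw [Matrix.smul_mulVec, dotProduct_smul, smul_eq_mul, Complex.re_ofReal_mul, projForm,
    sign_eq_abs_div hd]
  ring

theorem RealLocalDiag.isHermitian_localDensity (h : RealLocalDiag A B κ φ V U t₀ δ)
    (hA : A.IsHermitian) (hAdet : A.det ≠ 0) (hB : B.IsHermitian) (ρ : ℝ → ℝ) {S : Finset ι}
    (hS : ∀ i ∈ S, star (φ i t₀) = φ i t₀) {x : ℝ} (hx : x ∈ Set.Icc (t₀ - δ) (t₀ + δ)) :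
    (localDensity A κ φ V ρ S x).IsHermitian := by
  rw [Matrix.IsHermitian, localDensity, Matrix.conjTranspose_sum]
  refine Finset.sum_congr rfl fun i hi => ?_
  rw [Matrix.conjTranspose_smul, h.isHermitian_classProj_mul_inv hA hAdet hB (h.mem x hx) i
    (h.star_eq i (hS i hi) x hx), RCLike.star_def, Complex.conj_ofReal]

theorem RealLocalDiag.continuousOn_projForm (h : RealLocalDiag A B κ φ V U t₀ δ)
    (hA : A.IsHermitian) (hAdet : A.det ≠ 0) (hB : B.IsHermitian) {i : ι}
    (hi : star (φ i t₀) = φ i t₀) (u : Fin r → ℂ) :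
    ContinuousOn (projForm A κ φ V u i) (Set.Icc (t₀ - δ) (t₀ + δ)) := by
  refine ContinuousOn.div (Complex.continuous_re.comp_continuousOn ?_) (h.continuousOn_deriv i)
    fun x hx => (h.deriv_real hA hAdet hB (h.mem x hx) i (h.star_eq i hi x hx)).2
  have : Continuous fun N : Matrix (Fin r) (Fin r) ℂ => star u ⬝ᵥ N *ᵥ u :=
    (continuous_const (y := star u)).dotProduct (continuous_id.matrix_mulVec continuous_const)
  exact this.comp_continuousOn (h.continuousOn_projMatrix i)

theorem RealLocalDiag.continuousOn_localDensity (h : RealLocalDiag A B κ φ V U t₀ δ)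
    (hA : A.IsHermitian) (hAdet : A.det ≠ 0) (hB : B.IsHermitian) {ρ : ℝ → ℝ}
    (hρ : ContinuousOn ρ {2, -2}ᶜ) {S : Finset ι} (hS : ∀ i ∈ S, star (φ i t₀) = φ i t₀) :
    ContinuousOn (localDensity A κ φ V ρ S) (Set.Icc (t₀ - δ) (t₀ + δ)) := by
  refine continuousOn_finsetSum _ fun i hi => ContinuousOn.smul
    (Complex.continuous_ofReal.comp_continuousOn
      ((h.continuousOn_density hρ (hS i hi)).mul ?_)) (h.continuousOn_projMatrix i)
  have hd : ∀ x ∈ Set.Icc (t₀ - δ) (t₀ + δ), (deriv (φ i) x).re ≠ 0 := fun x hx =>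
    (h.deriv_real hA hAdet hB (h.mem x hx) i (h.star_eq i (hS i hi) x hx)).2
  refine ContinuousOn.congr ((h.continuousOn_deriv i).abs.div (h.continuousOn_deriv i) hd)
    fun x hx => sign_eq_abs_div (hd x hx)

/-- Substitution `w = φ i x` on each real branch: the images of the interval are pairwise disjoint,
and the spectral sum vanishes off their union. -/
theorem RealLocalDiag.integral_eq [Fintype ι] (h : RealLocalDiag A B κ φ V U t₀ δ)
    (hA : A.IsHermitian) (hAdet : A.det ≠ 0) (hB : B.IsHermitian) {ρ : ℝ → ℝ}
    (hρm : Measurable ρ) (hρ0 : ∀ w, 0 ≤ ρ w) (hρ : ContinuousOn ρ {2, -2}ᶜ) {S : Finset ι}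
    (hS : ∀ i, i ∈ S ↔ star (φ i t₀) = φ i t₀) (u : Fin r → ℂ) {f : ℝ → ℝ} (hf : Continuous f)
    (hfI : ∀ y, f y ≠ 0 → y ∈ Set.Ioo (t₀ - δ) (t₀ + δ)) :
    ∫ w, specSum (isHermitian_pencil_real hA hB w) u f
        ∂(volume.withDensity fun w => ENNReal.ofReal (ρ w)) =
      ∫ x in Set.Ioo (t₀ - δ) (t₀ + δ),
        f x * (star u ⬝ᵥ localDensity A κ φ V ρ S x *ᵥ u).re := by
  set I := Set.Ioo (t₀ - δ) (t₀ + δ) with hI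
  have hsub : I ⊆ Set.Icc (t₀ - δ) (t₀ + δ) := Set.Ioo_subset_Icc_self
  set s : ι → Set ℝ := fun i => (fun y : ℝ => (φ i y).re) '' I with hs
  have hderiv : ∀ i, ∀ x ∈ I, HasDerivWithinAt (fun y : ℝ => (φ i y).re)
      (deriv (φ i) x).re I x := fun i x hx =>
    (h.hasDerivAt_re (h.mem x (hsub hx)) i).hasDerivWithinAt
  have hinj : ∀ i ∈ S, Set.InjOn (fun y : ℝ => (φ i y).re) I := fun i hi =>
    (h.injOn hA hAdet hB ((hS i).1 hi)).mono hsub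
  have hsm : ∀ i ∈ S, MeasurableSet (s i) := fun i _ =>
    (isPreconnected_Ioo.image _ ((h.continuousOn_re i).mono hsub)).ordConnected.measurableSet
  have hdisj : Set.Pairwise (↑S) (Function.onFun Disjoint s) := by
    intro i hi j hj hij
    rw [Function.onFun, Set.disjoint_left]
    rintro w ⟨x, hx, rfl⟩ ⟨y, hy, hxy⟩
    refine h.separated i j hij x (hsub hx) y (hsub hy) ?_
    rw [h.eq_re ((hS i).1 hi) (hsub hx), h.eq_re ((hS j).1 hj) (hsub hy)]
    exact congrArg _ hxy.symm
  set F : ℝ → ℝ := fun w => ρ w * specSum (isHermitian_pencil_real hA hB w) u f with hF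
  have hspec : ∀ i ∈ S, ∀ x ∈ I, |(deriv (φ i) x).re| • F (φ i x).re =
      f x * (|(deriv (φ i) x).re| * (ρ (φ i x).re * projForm A κ φ V u i x)) :=
    fun i hi x hx => by
      simp only [hF]
      rw [h.specSum_eq hA hAdet hB ((hS i).1 hi) (hsub hx) u
        (fun y _ hy => hsub (hfI y hy)), smul_eq_mul]
      ring
  have hterm : ∀ i ∈ S, IntegrableOn
      (fun x => f x * (|(deriv (φ i) x).re| * (ρ (φ i x).re * projForm A κ φ V u i x))) I :=
    fun i hi => (ContinuousOn.integrableOn_compact (μ := volume) isCompact_Icc (hf.continuousOn.mul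
      ((h.continuousOn_deriv i).abs.mul ((h.continuousOn_density hρ ((hS i).1 hi)).mul
        (h.continuousOn_projForm hA hAdet hB ((hS i).1 hi) u))))).mono_set hsub
  have hint : ∀ i ∈ S, IntegrableOn F (s i) := fun i hi => by
    rw [integrableOn_image_iff_integrableOn_abs_deriv_smul measurableSet_Ioo (hderiv i)
      (hinj i hi)]
    exact (hterm i hi).congr_fun (fun x hx => (hspec i hi x hx).symm) measurableSet_Ioo
  rw [integral_withDensity_eq_integral_toReal_smul hρm.ennreal_ofReal (by simp)]
  simp only [ENNReal.toReal_ofReal (hρ0 _), smul_eq_mul]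
  change ∫ w, F w = _
  rw [← setIntegral_eq_integral_of_forall_compl_eq_zero (s := ⋃ i ∈ S, s i),
    integral_biUnion_finset S hsm hdisj hint]
  · rw [Finset.sum_congr rfl fun i hi => (integral_image_eq_integral_abs_deriv_smul
      measurableSet_Ioo (hderiv i) (hinj i hi) F).trans
      (setIntegral_congr_fun measurableSet_Ioo (hspec i hi)), ← integral_finsetSum _ hterm]
    refine setIntegral_congr_fun measurableSet_Ioo fun x hx => ?_
    rw [h.re_dotProduct_localDensity hA hAdet hB ρ (fun i hi => (hS i).1 hi) (hsub hx),
      Finset.mul_sum]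
  · intro w hw
    simp only [hF]
    rw [h.specSum_eq_zero hA hAdet hB (fun i hi hwi => hw ?_) u hfI, mul_zero]
    exact Set.mem_biUnion ((hS i).2 hi) hwi

/-- A complex matrix is determined by its quadratic form, so it suffices to compare, for each `u`, a
scalar measure with a scalar density; these agree on test functions. -/
theorem RealLocalDiag.apply_eq_setIntegral [Fintype ι] (h : RealLocalDiag A B κ φ V U t₀ δ)
    (hA : A.IsHermitian) (hAdet : A.det ≠ 0) (hB : B.IsHermitian) {ρ : ℝ → ℝ}
    (hρm : Measurable ρ) (hρ0 : ∀ w, 0 ≤ ρ w) (hρ : ContinuousOn ρ {2, -2}ᶜ) {S : Finset ι}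
    (hS : ∀ i, i ∈ S ↔ star (φ i t₀) = φ i t₀) {α : ℕ → ℝ} {p : ℕ → ℝ → ℝ}
    (hν : IsScalarSystem α p (volume.withDensity fun w => ENNReal.ofReal (ρ w)))
    {W : VectorMeasure ℝ (Matrix (Fin r) (Fin r) ℂ)}
    (hW : IsSpectralMeasure (fun m => (α m : ℂ) • A) (fun _ => B) W) {E : Set ℝ}
    (hE : MeasurableSet E) (hEI : E ⊆ Set.Ioo (t₀ - δ) (t₀ + δ)) (i j : Fin r) :
    W E i j = ∫ x in E, localDensity A κ φ V ρ S x i j := by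
  have hS' : ∀ i ∈ S, star (φ i t₀) = φ i t₀ := fun i hi => (hS i).1 hi
  have hsub : E ⊆ Set.Icc (t₀ - δ) (t₀ + δ) := hEI.trans Set.Ioo_subset_Icc_self
  have hc := h.continuousOn_localDensity hA hAdet hB hρ hS'
  have hint : ∀ i j, IntegrableOn (fun x => localDensity A κ φ V ρ S x i j) E := fun i j =>
    (((continuous_id.matrix_elem i j).comp_continuousOn hc).integrableOn_compact
      isCompact_Icc).mono_set hsub
  suffices W E - Matrix.of (fun i j => ∫ x in E, localDensity A κ φ V ρ S x i j) = 0 by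
    exact congrFun (congrFun (sub_eq_zero.1 this) i) j
  refine eq_zero_of_star_dotProduct_mulVec_eq_zero fun u => ?_
  rw [Matrix.sub_mulVec, dotProduct_sub, sub_eq_zero]
  obtain ⟨μ, hμf, hμ⟩ := exists_quadMeasure hW.posSemidef u
  have hform : Continuous fun N : Matrix (Fin r) (Fin r) ℂ => (star u ⬝ᵥ N *ᵥ u).re :=
    Complex.continuous_re.comp
      ((continuous_const (y := star u)).dotProduct (continuous_id.matrix_mulVec continuous_const))
  have h1 := measureReal_eq_setIntegral (μ := μ) (hform.comp_continuousOn hc)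
    (fun x hx => by
      change 0 ≤ (star u ⬝ᵥ localDensity A κ φ V ρ S x *ᵥ u).re
      rw [h.re_dotProduct_localDensity hA hAdet hB ρ hS' hx]
      exact Finset.sum_nonneg fun i hi => mul_nonneg (abs_nonneg _)
        (mul_nonneg (hρ0 _) (h.projForm_nonneg hA hAdet hB (hS' i hi) hx u)))
    (fun f hf hfI => (hW.integral_eq hA hAdet hB hν hμ hf).trans
      (h.integral_eq hA hAdet hB hρm hρ0 hρ hS u hf hfI)) hE hEI
  rw [← hμ E hE, h1, ← integral_complex_ofReal, star_dotProduct_mulVec_eq_sum]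
  simp only [Matrix.of_apply]
  simp_rw [← integral_const_mul]
  have hint' : ∀ i j, IntegrableOn (fun x => star (u i) * u j * localDensity A κ φ V ρ S x i j)
    E := fun i j => (hint i j).const_mul _
  rw [Finset.sum_congr rfl fun i _ => (integral_finsetSum _ fun j _ => hint' i j).symm,
    ← integral_finsetSum _ fun i _ => integrable_finsetSum _ fun j _ => hint' i j]
  refine setIntegral_congr_fun hE fun x hx => ?_
  have hH := h.isHermitian_localDensity hA hAdet hB ρ hS' (hsub hx)
  -- The density is Hermitian, so nothing is lost by having worked with real parts.
  have him := hH.im_star_dotProduct_mulVec_self u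
  simp only [Function.comp_apply]
  rw [← star_dotProduct_mulVec_eq_sum]
  exact Complex.ext (by simp) (by simpa using him.symm)

/-- The absolutely continuous part of a spectral measure near a regular point. -/
theorem RealLocalDiag.acDensity_ae_eq [Fintype ι] (h : RealLocalDiag A B κ φ V U t₀ δ)
    (hA : A.IsHermitian) (hAdet : A.det ≠ 0) (hB : B.IsHermitian) {ρ : ℝ → ℝ}
    (hρm : Measurable ρ) (hρ0 : ∀ w, 0 ≤ ρ w) (hρ : ContinuousOn ρ {2, -2}ᶜ) {S : Finset ι}
    (hS : ∀ i, i ∈ S ↔ star (φ i t₀) = φ i t₀) {α : ℕ → ℝ} {p : ℕ → ℝ → ℝ}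
    (hν : IsScalarSystem α p (volume.withDensity fun w => ENNReal.ofReal (ρ w)))
    {W : VectorMeasure ℝ (Matrix (Fin r) (Fin r) ℂ)}
    (hW : IsSpectralMeasure (fun m => (α m : ℂ) • A) (fun _ => B) W) :
    ∀ᵐ x ∂(volume.restrict (Set.Ioo (t₀ - δ) (t₀ + δ))),
      acDensity W x = localDensity A κ φ V ρ S x := by
  have hS' : ∀ i ∈ S, star (φ i t₀) = φ i t₀ := fun i hi => (hS i).1 hi
  have hc := h.continuousOn_localDensity hA hAdet hB hρ hS'
  have h1 : ∀ i j, ∀ᵐ x ∂(volume.restrict (Set.Ioo (t₀ - δ) (t₀ + δ))),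
      acDensity W x i j = localDensity A κ φ V ρ S x i j := fun i j =>
    (entry W i j).rnDeriv_ae_eq_restrict measurableSet_Ioo
      ((((continuous_id.matrix_elem i j).comp_continuousOn hc).integrableOn_compact
        isCompact_Icc).mono_set Set.Ioo_subset_Icc_self)
      fun E hE hEI => h.apply_eq_setIntegral hA hAdet hB hρm hρ0 hρ hS hν hW hE hEI i j
  filter_upwards [ae_all_iff.2 fun i => ae_all_iff.2 (h1 i)] with x hx
  exact Matrix.ext hx

theorem localDensity_eq (A : Matrix (Fin r) (Fin r) ℂ) (κ : Fin r → ι) (φ : ι → ℂ → ℂ)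
    (V : ℂ → Matrix (Fin r) (Fin r) ℂ) (ρ : ℝ → ℝ) {S : Finset ι} [DecidablePred (· ∈ S)] (x : ℝ) :
    localDensity A κ φ V ρ S x = V x * diagonal (fun k => if κ k ∈ S then
      ((ρ (φ (κ k) x).re * Real.sign (deriv (φ (κ k)) x).re : ℝ) : ℂ) else 0) * (V x)⁻¹ * A⁻¹ := by
  classical
  have hterm : ∀ i ∈ S, ((ρ (φ i x).re * Real.sign (deriv (φ i) x).re : ℝ) : ℂ) •
      (classProj κ (V x) i * A⁻¹) =
      V x * (((ρ (φ i x).re * Real.sign (deriv (φ i) x).re : ℝ) : ℂ) •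
        diagonal (fun k => if κ k = i then 1 else 0)) * (V x)⁻¹ * A⁻¹ := fun i _ => by
    rw [classProj, Matrix.mul_smul, Matrix.smul_mul, Matrix.smul_mul]
  rw [localDensity, Finset.sum_congr rfl hterm, ← Matrix.sum_mul, ← Matrix.sum_mul, ← Matrix.mul_sum]
  congr 3
  ext k l
  rw [Matrix.sum_apply]
  by_cases hkl : k = l
  · subst hkl
    simp
  · simp [hkl]

end LocalDensity

/-! ### The arcsine and semicircle laws and their Chebyshev polynomials -/

section ScalarMeasures

/-- The arcsine density on `[-2, 2]`; it vanishes outside since `√` does. -/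
noncomputable def arcsineDensity (w : ℝ) : ℝ := 1 / Real.pi * (1 / √(4 - w ^ 2))

/-- The semicircle density on `[-2, 2]`. -/
noncomputable def semicircleDensity (w : ℝ) : ℝ := 1 / (2 * Real.pi) * √(4 - w ^ 2)

theorem sqrt_four_sub_sq_eq_zero {w : ℝ} (h : w ∉ Set.Ioo (-2 : ℝ) 2) : √(4 - w ^ 2) = 0 := by
  refine Real.sqrt_eq_zero_of_nonpos ?_
  by_contra hlt
  refine h ⟨?_, ?_⟩ <;> nlinarith

theorem sqrt_four_sub_two_mul_sq (x : ℝ) : √(4 - (2 * x) ^ 2) = 2 * √(1 - x ^ 2) := by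
  rw [show 4 - (2 * x) ^ 2 = 2 ^ 2 * (1 - x ^ 2) by ring, Real.sqrt_mul (by positivity),
    Real.sqrt_sq (by norm_num)]

theorem arcsineDensity_nonneg (w : ℝ) : 0 ≤ arcsineDensity w := by
  unfold arcsineDensity; positivity

theorem semicircleDensity_nonneg (w : ℝ) : 0 ≤ semicircleDensity w := by
  unfold semicircleDensity; positivity

theorem measurable_arcsineDensity : Measurable arcsineDensity := by
  unfold arcsineDensity; fun_prop

theorem continuous_semicircleDensity : Continuous semicircleDensity := by
  unfold semicircleDensity; fun_prop

theorem continuousOn_arcsineDensity : ContinuousOn arcsineDensity {2, -2}ᶜ := by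
  intro w hw
  have h2 : w ≠ 2 := fun e => hw (Or.inl e)
  have h2' : w ≠ -2 := fun e => hw (Or.inr e)
  refine ContinuousAt.continuousWithinAt ?_
  by_cases hI : w ∈ Set.Ioo (-2 : ℝ) 2
  · have : √(4 - w ^ 2) ≠ 0 := (Real.sqrt_pos.2 (by nlinarith [hI.1, hI.2])).ne'
    unfold arcsineDensity
    fun_prop (disch := assumption)
  · have hI' : w ∈ (Set.Icc (-2 : ℝ) 2)ᶜ := fun h =>
      hI ⟨lt_of_le_of_ne h.1 h2'.symm, lt_of_le_of_ne h.2 h2⟩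
    refine (continuousAt_const (y := (0 : ℝ))).congr ?_
    filter_upwards [isClosed_Icc.isOpen_compl.mem_nhds hI'] with y hy
    rw [arcsineDensity, sqrt_four_sub_sq_eq_zero fun h => hy (Set.Ioo_subset_Icc_self h)]
    simp

theorem arcsineDensity_eq_zero {w : ℝ} (h : w ∉ Set.Ioo (-2 : ℝ) 2) : arcsineDensity w = 0 := by
  rw [arcsineDensity, sqrt_four_sub_sq_eq_zero h]; simp

theorem semicircleDensity_eq_zero {w : ℝ} (h : w ∉ Set.Ioo (-2 : ℝ) 2) :
    semicircleDensity w = 0 := by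
  rw [semicircleDensity, sqrt_four_sub_sq_eq_zero h]; simp

/-- The scaling `w = 2 x` leads to the interval `[-1, 1]` of the classical Chebyshev polynomials. -/
theorem integral_eq_integral_two_mul {ρ : ℝ → ℝ} (h : ∀ w, w ∉ Set.Ioo (-2 : ℝ) 2 → ρ w = 0)
    (f : ℝ → ℝ) : ∫ w, ρ w * f w = 2 * ∫ x in (-1 : ℝ)..1, ρ (2 * x) * f (2 * x) := by
  rw [intervalIntegral.mul_integral_comp_mul_left (f := fun w => ρ w * f w),
    intervalIntegral.integral_of_le (by norm_num)]
  refine (setIntegral_eq_integral_of_forall_compl_eq_zero fun w hw => ?_).symm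
  rw [h w fun hw' => hw ?_, zero_mul]
  norm_num
  exact ⟨hw'.1, hw'.2.le⟩

theorem integral_withDensity_arcsine (f : ℝ → ℝ) :
    ∫ w, f w ∂(volume.withDensity fun w => ENNReal.ofReal (arcsineDensity w)) =
      1 / Real.pi * ∫ x, f (2 * x) ∂Chebyshev.measureT := by
  rw [integral_withDensity_eq_integral_toReal_smul measurable_arcsineDensity.ennreal_ofReal
    (by simp)]
  simp only [ENNReal.toReal_ofReal (arcsineDensity_nonneg _), smul_eq_mul]
  rw [integral_eq_integral_two_mul fun w => arcsineDensity_eq_zero, Chebyshev.integral_measureT,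
    ← intervalIntegral.integral_const_mul, ← intervalIntegral.integral_const_mul]
  refine intervalIntegral.integral_congr fun x _ => ?_
  simp only [arcsineDensity, sqrt_four_sub_two_mul_sq, Real.sqrt_inv]
  rw [one_div (2 * _), mul_inv]
  ring

theorem integral_withDensity_semicircle (f : ℝ → ℝ) :
    ∫ w, f w ∂(volume.withDensity fun w => ENNReal.ofReal (semicircleDensity w)) =
      2 / Real.pi * ∫ x, (1 - x ^ 2) * f (2 * x) ∂Chebyshev.measureT := by
  rw [integral_withDensity_eq_integral_toReal_smul
    continuous_semicircleDensity.measurable.ennreal_ofReal (by simp)]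
  simp only [ENNReal.toReal_ofReal (semicircleDensity_nonneg _), smul_eq_mul]
  rw [integral_eq_integral_two_mul fun w => semicircleDensity_eq_zero, Chebyshev.integral_measureT,
    ← intervalIntegral.integral_const_mul, ← intervalIntegral.integral_const_mul]
  refine intervalIntegral.integral_congr fun x hx => ?_
  rw [Set.uIcc_of_le (by norm_num)] at hx
  have h1 : (0 : ℝ) ≤ 1 - x ^ 2 := by nlinarith [hx.1, hx.2]
  have h2 : (1 - x ^ 2) * (√(1 - x ^ 2))⁻¹ = √(1 - x ^ 2) := by
    rw [← div_eq_mul_inv, Real.div_sqrt]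
  simp only [semicircleDensity, sqrt_four_sub_two_mul_sq, Real.sqrt_inv]
  rw [mul_right_comm (1 - x ^ 2), h2]
  field_simp

theorem ae_abs_le_two_withDensity {ρ : ℝ → ℝ} (hρ : Measurable ρ)
    (h : ∀ w, w ∉ Set.Ioo (-2 : ℝ) 2 → ρ w = 0) :
    ∀ᵐ w ∂(volume.withDensity fun w => ENNReal.ofReal (ρ w)), |w| ≤ 2 := by
  rw [ae_withDensity_iff hρ.ennreal_ofReal]
  refine Filter.Eventually.of_forall fun w hw => ?_
  by_contra hlt
  refine hw ?_
  rw [h w fun hI => hlt (abs_le.2 ⟨hI.1.le, hI.2.le⟩), ENNReal.ofReal_zero]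

theorem integral_T_measureT (m : ℕ) :
    ∫ x, (Chebyshev.T ℝ m).eval x ∂Chebyshev.measureT = if m = 0 then Real.pi else 0 := by
  split_ifs with h
  · rw [h]; exact Chebyshev.integral_eval_T_real_measureT_zero
  · exact Chebyshev.integral_eval_T_real_measureT_of_ne_zero (by exact_mod_cast h)

theorem integrable_arcsineDensity : Integrable arcsineDensity := by
  have h1 := Chebyshev.intervalIntegrable_sqrt_one_sub_sq_inv.comp_mul_left (c := (2 : ℝ)⁻¹)
  norm_num at h1
  rw [intervalIntegrable_iff, Set.uIoc_of_le (by norm_num)] at h1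
  rw [← integrableOn_iff_integrable_of_support_subset (s := Set.Ioc (-2 : ℝ) 2)]
  · refine (h1.const_mul (1 / (2 * Real.pi))).congr (Filter.Eventually.of_forall fun x => ?_)
    have h2 := sqrt_four_sub_two_mul_sq (1 / 2 * x)
    rw [← mul_assoc] at h2
    norm_num at h2
    simp only [arcsineDensity]
    rw [h2]
    field_simp
  · intro w hw
    by_contra hI
    exact hw (arcsineDensity_eq_zero fun h => hI ⟨h.1, h.2.le⟩)

/-- The orthonormal polynomials are `1` and `√2 T_m(w / 2)`; the exceptional coefficient `α 1 = √2`
reflects that `p_0` lacks the factor `√2`. -/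
theorem isScalarSystem_arcsine : IsScalarSystem (fun m => if m = 1 then √2 else 1)
    (fun m w => if m = 0 then 1 else √2 * (Chebyshev.T ℝ m).eval (w / 2))
    (volume.withDensity fun w => ENNReal.ofReal (arcsineDensity w)) where
  isFinite := isFiniteMeasure_withDensity_ofReal integrable_arcsineDensity.2
  abs_le := ae_abs_le_two_withDensity measurable_arcsineDensity fun w => arcsineDensity_eq_zero
  ne_zero m := by split_ifs <;> simp
  zero w := by simp
  mul_zero w := by
    have : √2 * √2 = 2 := Real.mul_self_sqrt (by norm_num)
    simp
    linear_combination (-w / 2) * this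
  mul_succ m w := by
    have h1 : (Chebyshev.T ℝ ((m + 2 : ℕ) : ℤ)).eval (w / 2) =
        w * (Chebyshev.T ℝ ((m + 1 : ℕ) : ℤ)).eval (w / 2) -
          (Chebyshev.T ℝ (m : ℤ)).eval (w / 2) := by
      push_cast
      rw [Chebyshev.T_add_two]
      simp only [eval_sub, eval_mul, eval_ofNat, eval_X]
      ring
    -- For `m = 0` the factor `√2` comes from `α 1`, for `m > 0` from `p m`; the product has the
    -- same form.
    have h2 : (if m + 1 = 1 then √2 else 1) *
        (if m = 0 then 1 else √2 * (Chebyshev.T ℝ (m : ℤ)).eval (w / 2)) =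
        √2 * (Chebyshev.T ℝ (m : ℤ)).eval (w / 2) := by
      rcases Nat.eq_zero_or_pos m with rfl | hm
      · simp
      · simp [hm.ne']
    rw [h2, if_neg (by omega), if_neg (by omega), if_neg (by omega), h1]
    ring
  continuous m := by
    rcases Nat.eq_zero_or_pos m with rfl | hm
    · simp only [if_true]; exact continuous_const
    · simp only [hm.ne', if_false]; fun_prop
  integral m := by
    rw [integral_withDensity_arcsine]
    rcases Nat.eq_zero_or_pos m with rfl | hm
    · have := integral_T_measureT 0
      simp at this ⊢
      rw [this]
      field_simp
    · have := integral_T_measureT m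
      simp only [hm.ne', if_false] at this ⊢
      rw [integral_const_mul]
      simp only [ne_eq, OfNat.ofNat_ne_zero, not_false_eq_true, mul_div_cancel_left₀]
      rw [this]
      simp

theorem isScalarSystem_semicircle : IsScalarSystem (fun _ => 1)
    (fun m w => (Chebyshev.U ℝ m).eval (w / 2))
    (volume.withDensity fun w => ENNReal.ofReal (semicircleDensity w)) where
  isFinite := by
    refine isFiniteMeasure_withDensity_ofReal (Integrable.hasFiniteIntegral ?_)
    rw [← integrableOn_iff_integrable_of_support_subset (s := Set.Icc (-2 : ℝ) 2)]
    · exact continuous_semicircleDensity.continuousOn.integrableOn_compact isCompact_Icc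
    · intro w hw
      by_contra hI
      exact hw (semicircleDensity_eq_zero fun h => hI ⟨h.1.le, h.2.le⟩)
  abs_le := ae_abs_le_two_withDensity continuous_semicircleDensity.measurable
    fun w => semicircleDensity_eq_zero
  ne_zero m := one_ne_zero
  zero w := by simp
  mul_zero w := by simp; ring
  mul_succ m w := by
    push_cast
    rw [Chebyshev.U_add_two]
    simp only [eval_sub, eval_mul, eval_ofNat, eval_X]
    ring
  continuous m := by fun_prop
  integral m := by
    rw [integral_withDensity_semicircle]
    -- The semicircle weight turns `U_m` into `(T_m - T_{m+2}) / 2`, and among the `T_n` with `n ≥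
    -- 0` only `T_0` has a nonzero integral.
    have h1 : ∀ x : ℝ, (1 - x ^ 2) * (Chebyshev.U ℝ m).eval (2 * x / 2) =
        (1 / 2) * ((Chebyshev.T ℝ m).eval x - (Chebyshev.T ℝ ((m + 2 : ℕ) : ℤ)).eval x) :=
      fun x => by
        have h2 := congrArg (Polynomial.eval x) (Chebyshev.one_sub_X_sq_mul_U_eq_pol_in_T ℝ m)
        push_cast
        simp at h2 ⊢
        rw [h2]
        ring
    simp_rw [h1]
    rw [integral_const_mul, integral_sub (Chebyshev.integrable_measureT (by fun_prop))
      (Chebyshev.integrable_measureT (by fun_prop)), integral_T_measureT, integral_T_measureT]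
    rw [if_neg (by omega : m + 2 ≠ 0)]
    split_ifs
    · field_simp
      norm_num
    · simp

end ScalarMeasures

/-! ### Roots of `f(·, x)`, their pairing, and `Γ₀` -/

section RootLists

theorem prod_univ_two_mul_eq {M : Type*} [CommMonoid M] {r : ℕ} (f : Fin (2 * r) → M) :
    ∏ k, f k = ∏ k : Fin r, f (k.castLE (by omega)) * f (k.castLE (by omega)).rev := by
  rw [← Fin.prod_congr' f (two_mul r).symm, Fin.prod_univ_add, Finset.prod_mul_distrib]
  congr 1
  rw [← Equiv.prod_comp Fin.revPerm]
  refine Finset.prod_congr rfl fun k _ => congrArg f (Fin.ext ?_)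
  simp only [Fin.revPerm_apply, Fin.val_cast, Fin.val_natAdd, Fin.val_rev, Fin.val_castLE]
  omega

/-- The list `a_1, …, a_r, a_r⁻¹, …, a_1⁻¹`. -/
noncomputable def pairedList {r : ℕ} (a : Fin r → ℂ) (k : Fin (2 * r)) : ℂ :=
  if h : (k : ℕ) < r then a ⟨k, h⟩ else (a ⟨2 * r - 1 - k, by omega⟩)⁻¹

theorem pairedList_castLE {r : ℕ} (a : Fin r → ℂ) (k : Fin r) :
    pairedList a (k.castLE (by omega)) = a k := by
  simp [pairedList]

theorem pairedList_rev {r : ℕ} (a : Fin r → ℂ) (k : Fin (2 * r)) :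
    pairedList a k.rev = (pairedList a k)⁻¹ := by
  unfold pairedList
  simp only [Fin.val_rev]
  by_cases h : (k : ℕ) < r
  · rw [dif_pos h, dif_neg (by omega)]
    congr 3
    omega
  · rw [dif_neg h, dif_pos (by omega), inv_inv]
    congr 2
    omega

/-- Since `(B - t) V = -A V diag(ω)`, multiplying the quadratic matrix polynomial by `V` on the
right gives `A V diag(X² - ω_k X + 1)`; compare determinants. -/
theorem clearedPoly_eq_prod {r : ℕ} {A B : Matrix (Fin r) (Fin r) ℂ} (hA : A.IsHermitian)
    {t : ℂ} {ω : Fin r → ℂ} {V : Matrix (Fin r) (Fin r) ℂ} (hV : V.det ≠ 0)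
    (hnull : ∀ k, (ω k • A + B - t • 1) *ᵥ (fun i => V i k) = 0) :
    clearedPoly A B t = C A.det * ∏ k, (X ^ 2 - C (ω k) * X + 1) := by
  have hBV : (B - t • 1) * V = -(A * V * diagonal ω) := by
    ext i k
    have := congrFun (hnull k) i
    rw [add_sub_assoc, Matrix.add_mulVec, Matrix.smul_mulVec, Pi.add_apply, Pi.smul_apply,
      Pi.zero_apply] at this
    rw [Matrix.neg_apply, Matrix.mul_diagonal]
    change ((B - t • 1) *ᵥ fun i => V i k) i = -((A *ᵥ fun i => V i k) i * ω k)
    rw [smul_eq_mul] at this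
    linear_combination this
  have hC : (C V.det : ℂ[X]) ≠ 0 := by simpa using hV
  refine mul_right_cancel₀ hC ?_
  have hdetC : ∀ N : Matrix (Fin r) (Fin r) ℂ, C N.det = (N.map C).det := fun N =>
    RingHom.map_det (C : ℂ →+* ℂ[X]) N
  have hmul : ∀ N N' : Matrix (Fin r) (Fin r) ℂ,
      (N * N').map (C : ℂ → ℂ[X]) = N.map C * N'.map C :=
    fun N N' => Matrix.map_mul
  have hX2 : ((X : ℂ[X]) ^ 2 • Aᴴ.map C + (X : ℂ[X]) • (B - t • 1).map C + A.map C) * V.map C =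
      (A * V).map C * diagonal fun k => X ^ 2 - C (ω k) * X + 1 := by
    rw [add_mul, add_mul, Matrix.smul_mul, Matrix.smul_mul, ← hmul, ← hmul, ← hmul, hBV, hA.eq]
    ext1 i k
    simp only [Matrix.add_apply, Matrix.smul_apply, Matrix.map_apply, Matrix.neg_apply,
      Matrix.mul_diagonal, C_neg, C_mul, smul_eq_mul]
    ring
  rw [clearedPoly, hdetC V, ← Matrix.det_mul, hX2, Matrix.det_mul, Matrix.det_diagonal, ← hdetC,
    Matrix.det_mul, C_mul, hdetC V]
  ring

/-- Each factor `X² - (z + z⁻¹) X + 1` is `(X - z) (X - z⁻¹)`, which accounts for one pair of the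
list. -/
theorem isRootList_of_pairing {r : ℕ} {A B : Matrix (Fin r) (Fin r) ℂ} (hA : A.IsHermitian)
    (hAdet : A.det ≠ 0) {t : ℂ} {V : Matrix (Fin r) (Fin r) ℂ} (hV : V.det ≠ 0)
    {z : Fin (2 * r) → ℂ} (hz0 : ∀ k, z k ≠ 0) (hz : ∀ k, z k.rev = (z k)⁻¹)
    (hnull : ∀ k : Fin r, ((z (k.castLE (by omega)) + (z (k.castLE (by omega)))⁻¹) • A + B
      - t • 1) *ᵥ (fun i => V i k) = 0) : IsRootList A B t z := by
  have h1 : clearedPoly A B t = C A.det * ∏ k, (X - C (z k)) := by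
    rw [clearedPoly_eq_prod hA hV hnull, prod_univ_two_mul_eq]
    congr 1
    refine Finset.prod_congr rfl fun k _ => ?_
    rw [hz, C_add]
    have : C (z (k.castLE (by omega))) * C (z (k.castLE (by omega)))⁻¹ = 1 := by
      rw [← C_mul, mul_inv_cancel₀ (hz0 _), C_1]
    linear_combination -this
  rw [IsRootList, h1, roots_C_mul _ hAdet, Finset.prod_eq_multiset_prod]
  exact (congrArg roots (by rw [Multiset.map_map]; rfl)).trans (roots_multiset_prod_X_sub_C _)

theorem IsRootList.ne_zero {r : ℕ} {A B : Matrix (Fin r) (Fin r) ℂ} (hAdet : A.det ≠ 0) {t : ℂ}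
    {z : Fin (2 * r) → ℂ} (h : IsRootList A B t z) (k : Fin (2 * r)) : z k ≠ 0 := by
  have h1 : z k ∈ (clearedPoly A B t).roots := by
    rw [h]
    exact Multiset.mem_map_of_mem _ (Finset.mem_univ_val k)
  have h2 := (mem_roots'.1 h1).2
  intro h0
  rw [h0, IsRoot.def, clearedPoly, ← Polynomial.coe_evalRingHom, RingHom.map_det] at h2
  refine hAdet (Eq.trans (congrArg det ?_) h2)
  ext i j
  simp

theorem IsRootList.det_eq_zero {r : ℕ} {A B : Matrix (Fin r) (Fin r) ℂ} (hA : A.IsHermitian)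
    (hAdet : A.det ≠ 0) {t : ℂ} {z : Fin (2 * r) → ℂ} (h : IsRootList A B t z)
    (k : Fin (2 * r)) : ((z k + (z k)⁻¹) • A + B - t • 1).det = 0 := by
  have h1 : z k ∈ (clearedPoly A B t).roots := by
    rw [h]
    exact Multiset.mem_map_of_mem _ (Finset.mem_univ_val k)
  have h2 := (mem_roots'.1 h1).2
  have hk := h.ne_zero hAdet k
  rw [IsRoot.def, eval_clearedPoly _ _ _ _ hk] at h2
  have h3 := (mul_eq_zero.1 h2).resolve_left (pow_ne_zero _ hk)
  rw [algFun, hA.eq] at h3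
  rw [← h3]
  congr 1
  rw [add_smul]
  abel

theorem card_norm_lt_one_eq {m : ℕ} {z : Fin m → ℂ} (hz0 : ∀ k, z k ≠ 0)
    (hz : ∀ k, z k.rev = (z k)⁻¹) :
    (Finset.univ.val.map z).countP (fun a => ‖a‖ < 1) =
      (Finset.univ.val.map z).countP (fun a => 1 < ‖a‖) := by
  rw [Multiset.countP_map, Multiset.countP_map]
  change (Finset.univ.filter fun k => ‖z k‖ < 1).card = (Finset.univ.filter fun k => 1 < ‖z k‖).card
  refine Finset.card_bijective Fin.rev Fin.rev_bijective fun k => ?_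
  simp only [Finset.mem_filter, Finset.mem_univ, true_and, hz, norm_inv]
  exact (one_lt_inv₀ (norm_pos_iff.2 (hz0 k))).symm

/-- Inversion exchanges the roots inside and outside the unit circle. With `n` of each, a list
sorted by modulus has `n` roots inside, `2r - 2n` on the circle and `n` outside, so the two middle
moduli agree exactly when `n < r`. -/
theorem mem_Gamma0_iff {r : ℕ} {A B : Matrix (Fin r) (Fin r) ℂ} {t : ℂ} {z : Fin (2 * r) → ℂ}
    (hz0 : ∀ k, z k ≠ 0) (hz : ∀ k, z k.rev = (z k)⁻¹) (hroots : IsRootList A B t z) :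
    t ∈ Gamma0 A B ↔ ∃ k, ‖z k‖ = 1 := by
  have hcount := card_norm_lt_one_eq hz0 hz
  have hcount' : ∀ z' : Fin (2 * r) → ℂ, IsRootList A B t z' →
      (Finset.univ.filter fun k => ‖z' k‖ < 1).card =
        (Finset.univ.filter fun k => 1 < ‖z' k‖).card := fun z' hz' => by
    rw [← hroots, hz', Multiset.countP_map, Multiset.countP_map] at hcount
    exact hcount
  have hdisj : ∀ z' : Fin (2 * r) → ℂ, Disjoint (Finset.univ.filter fun k => ‖z' k‖ < 1)
      (Finset.univ.filter fun k => 1 < ‖z' k‖) := fun z' =>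
    Finset.disjoint_filter.2 fun k _ h1 h2 => lt_asymm h1 h2
  have htot : ∀ z' : Fin (2 * r) → ℂ, IsRootList A B t z' →
      2 * (Finset.univ.filter fun k => ‖z' k‖ < 1).card ≤ 2 * r ∧
      ((∃ k, ‖z' k‖ = 1) → 2 * (Finset.univ.filter fun k => ‖z' k‖ < 1).card < 2 * r) :=
    fun z' hz' => by
      have h1 := Finset.card_union_of_disjoint (hdisj z')
      rw [← hcount' z' hz', ← two_mul] at h1
      rw [← h1]
      refine ⟨(Finset.card_le_univ _).trans (by simp), fun ⟨k, hk⟩ => ?_⟩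
      refine (Finset.card_lt_univ_of_notMem (x := k) ?_).trans_eq (by simp)
      simp [hk]
  constructor
  · rintro ⟨z', hz', hmono, i, j, hi, hj, hij⟩
    suffices ‖z' i‖ = 1 by
      have h1 : z' i ∈ (clearedPoly A B t).roots := by
        rw [hz']
        exact Multiset.mem_map_of_mem _ (Finset.mem_univ_val i)
      rw [hroots] at h1
      obtain ⟨k, -, hk⟩ := Multiset.mem_map.1 h1
      exact ⟨k, by rw [hk, this]⟩
    have h1 := (htot z' hz').1
    refine le_antisymm (not_lt.1 fun hlt => ?_) (not_lt.1 fun hlt => ?_)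
    · have h2 : Finset.Ici i ⊆ Finset.univ.filter fun k => 1 < ‖z' k‖ := fun k hk => by
        simp only [Finset.mem_filter, Finset.mem_univ, true_and]
        exact hlt.trans_le (hmono (Finset.mem_Ici.1 hk))
      have h3 := Finset.card_le_card h2
      rw [Fin.card_Ici, ← hcount' z' hz'] at h3
      omega
    · have h2 : Finset.Iic j ⊆ Finset.univ.filter fun k => ‖z' k‖ < 1 := fun k hk => by
        simp only [Finset.mem_filter, Finset.mem_univ, true_and]
        exact (hmono (Finset.mem_Iic.1 hk)).trans_lt (hij.symm.trans_lt hlt)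
      have h3 := Finset.card_le_card h2
      rw [Fin.card_Iic] at h3
      omega
  · rintro ⟨k, hk⟩
    set σ := Tuple.sort fun k => ‖z k‖ with hσ
    have hmono : Monotone fun k => ‖z (σ k)‖ := Tuple.monotone_sort fun k => ‖z k‖
    have hz' : IsRootList A B t (fun k => z (σ k)) := by
      rw [IsRootList, hroots]
      have : Finset.univ.val.map σ = Finset.univ.val := Multiset.map_univ_val_equiv σ
      conv_lhs => rw [← this, Multiset.map_map]
      rfl
    have h1 := (htot _ hz').2 ⟨σ.symm k, by simpa using hk⟩
    have hr := k.2
    have hone : ∀ i : Fin (2 * r), (i : ℕ) + 1 = r ∨ (i : ℕ) = r → ‖z (σ i)‖ = 1 := by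
      intro i hi
      refine le_antisymm (not_lt.1 fun hlt => ?_) (not_lt.1 fun hlt => ?_)
      · have h2 : Finset.Ici i ⊆ Finset.univ.filter fun k => 1 < ‖z (σ k)‖ := fun k hk => by
          simp only [Finset.mem_filter, Finset.mem_univ, true_and]
          exact hlt.trans_le (hmono (Finset.mem_Ici.1 hk))
        have h3 := Finset.card_le_card h2
        rw [Fin.card_Ici, ← hcount' _ hz'] at h3
        omega
      · have h2 : Finset.Iic i ⊆ Finset.univ.filter fun k => ‖z (σ k)‖ < 1 := fun k hk => by
          simp only [Finset.mem_filter, Finset.mem_univ, true_and]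
          exact (hmono (Finset.mem_Iic.1 hk)).trans_lt hlt
        have h3 := Finset.card_le_card h2
        rw [Fin.card_Iic] at h3
        omega
    refine ⟨fun k => z (σ k), hz', hmono, ⟨r - 1, by omega⟩, ⟨r, by omega⟩, ?_, rfl, ?_⟩
    · simp only
      omega
    · rw [hone _ (Or.inl (by simp only; omega)), hone _ (Or.inr rfl)]

/-- The roots of `a + a⁻¹ = t` for real `t ≠ ±2` lie on the unit circle exactly when `t` is in
`(-2, 2)`. -/
theorem norm_eq_one_iff_add_inv {a : ℂ} (ha : a ≠ 0) (h2 : a + a⁻¹ ≠ 2) (h2' : a + a⁻¹ ≠ -2) :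
    ‖a‖ = 1 ↔ ∃ t ∈ Set.Ioo (-2 : ℝ) 2, a + a⁻¹ = (t : ℂ) := by
  constructor
  · intro h
    have hinv : a⁻¹ = (starRingEnd ℂ) a := by
      rw [Complex.inv_def, Complex.normSq_eq_norm_sq, h]
      simp
    have hsum : a + a⁻¹ = ((2 * a.re : ℝ) : ℂ) := by
      rw [hinv, Complex.add_conj]
    have hle := (Complex.abs_re_le_norm a).trans_eq h
    rw [abs_le] at hle
    refine ⟨2 * a.re, ⟨lt_of_le_of_ne (by linarith [hle.1]) fun e => h2' ?_,
      lt_of_le_of_ne (by linarith [hle.2]) fun e => h2 ?_⟩, hsum⟩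
    · rw [hsum, ← e]; norm_num
    · rw [hsum, e]; norm_num
  · rintro ⟨t, ht, h⟩
    have hq : a * a + 1 = t * a := by
      rw [← h]
      field_simp
    have hre := congrArg Complex.re hq
    have him := congrArg Complex.im hq
    simp at hre him
    have him' : a.im * (2 * a.re - t) = 0 := by linear_combination him
    rcases mul_eq_zero.1 him' with h0 | h0
    -- A real `a` would solve `a² - t a + 1 = 0`, whose discriminant `t² - 4` is negative.
    · exfalso
      rw [h0] at hre
      nlinarith [sq_nonneg (2 * a.re - t), mul_pos (sub_pos.2 ht.2) (neg_lt_iff_pos_add.1 ht.1)]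
    · have : a.re * a.re + a.im * a.im = 1 := by
        have : t = 2 * a.re := by linarith
        rw [this] at hre
        linarith
      rw [Complex.norm_def, Complex.normSq_apply, this, Real.sqrt_one]

/-- An analytic solution of `z + z⁻¹ = ω` where `ω ≠ ±2`. -/
theorem exists_analytic_add_inv {ω : ℂ → ℂ} {t₀ : ℂ} (hω : AnalyticAt ℂ ω t₀) (h2 : ω t₀ ≠ 2)
    (h2' : ω t₀ ≠ -2) : ∃ a : ℂ → ℂ, AnalyticAt ℂ a t₀ ∧
      ∀ᶠ t in 𝓝 t₀, a t ≠ 0 ∧ a t + (a t)⁻¹ = ω t := by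
  set c := ω t₀ ^ 2 - 4 with hc
  have hc0 : c ≠ 0 := by
    rw [hc, show ω t₀ ^ 2 - 4 = (ω t₀ - 2) * (ω t₀ + 2) by ring]
    exact mul_ne_zero (sub_ne_zero.2 h2) (by rwa [Ne, add_eq_zero_iff_eq_neg])
  -- Dividing by the value `c` at `t₀` brings the discriminant near `1`, where the principal
  -- logarithm is analytic; the constant `σ` restores the factor.
  obtain ⟨σ, hσ⟩ := IsAlgClosed.exists_pow_nat_eq c (n := 2) (by norm_num)
  have hq : AnalyticAt ℂ (fun t => (ω t ^ 2 - 4) / c) t₀ :=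
    ((hω.pow 2).sub analyticAt_const).div_const
  have hq0 : (ω t₀ ^ 2 - 4) / c ∈ Complex.slitPlane := by
    rw [← hc, div_self hc0]
    exact Complex.one_mem_slitPlane
  have hlog : AnalyticAt ℂ (fun t => Complex.log ((ω t ^ 2 - 4) / c)) t₀ := hq.clog hq0
  set s : ℂ → ℂ := fun t => σ * Complex.exp (Complex.log ((ω t ^ 2 - 4) / c) / 2) with hs
  have hsa : AnalyticAt ℂ s t₀ := analyticAt_const.mul hlog.div_const.cexp
  refine ⟨fun t => (ω t + s t) / 2, (hω.add hsa).div_const, ?_⟩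
  have hev := hq.continuousAt.eventually_ne (Complex.slitPlane_ne_zero hq0)
  filter_upwards [hev] with t ht
  have hss : s t ^ 2 = ω t ^ 2 - 4 := by
    rw [hs]
    simp only
    rw [mul_pow, hσ, ← Complex.exp_nat_mul]
    push_cast
    rw [mul_div_cancel₀ _ two_ne_zero, Complex.exp_log ht, mul_div_cancel₀ _ hc0]
  have hprod : (ω t + s t) / 2 * ((ω t - s t) / 2) = 1 := by linear_combination (-1 / 4) * hss
  refine ⟨left_ne_zero_of_mul_eq_one hprod, ?_⟩
  rw [inv_eq_of_mul_eq_one_right hprod]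
  ring

theorem exists_isNullVectorMatrix {r : ℕ} {A B : Matrix (Fin r) (Fin r) ℂ} {t : ℂ}
    {ω : Fin r → ℂ} {V : Matrix (Fin r) (Fin r) ℂ} (hV : V.det ≠ 0)
    (hnull : ∀ k, (ω k • A + B - t • 1) *ᵥ (fun i => V i k) = 0) :
    ∃ V' : Matrix (Fin r) (Fin r) ℂ, IsNullVectorMatrix A B t ω V' := by
  set n : Fin r → ℝ := fun k => ∑ i, ‖V i k‖ ^ 2 with hn
  have hn0 : ∀ k, 0 < n k := fun k => by
    refine lt_of_le_of_ne (Finset.sum_nonneg fun i _ => by positivity) fun h0 => ?_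
    have h1 := (Finset.sum_eq_zero_iff_of_nonneg fun i _ => by positivity).1 h0.symm
    refine hV (Matrix.det_eq_zero_of_column_eq_zero k fun i => ?_)
    simpa using h1 i (Finset.mem_univ i)
  have hs0 : ∀ k, √(n k) ≠ 0 := fun k => (Real.sqrt_pos.2 (hn0 k)).ne'
  refine ⟨V * diagonal fun k => (((√(n k))⁻¹ : ℝ) : ℂ), ?_, fun k => ?_, fun k => ?_⟩
  · rw [Matrix.det_mul, Matrix.det_diagonal]
    refine (mul_ne_zero hV (Finset.prod_ne_zero_iff.2 fun k _ => ?_)).isUnit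
    exact_mod_cast inv_ne_zero (hs0 k)
  · simp only [Matrix.mul_diagonal, norm_mul, mul_pow, ← Finset.sum_mul]
    change n k * _ = 1
    rw [Complex.norm_real, norm_inv, inv_pow, Real.norm_eq_abs, sq_abs,
      Real.sq_sqrt (hn0 k).le, mul_inv_cancel₀ (hn0 k).ne']
  · have : (fun i => (V * diagonal fun k => (((√(n k))⁻¹ : ℝ) : ℂ)) i k) =
        (((√(n k))⁻¹ : ℝ) : ℂ) • fun i => V i k := by
      ext i
      rw [Matrix.mul_diagonal, Pi.smul_apply, smul_eq_mul, mul_comm]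
    rw [this, Matrix.mulVec_smul, hnull, smul_zero]

end RootLists

/-! ### Existence of local data -/

section Existence

variable {r : ℕ} {A B : Matrix (Fin r) (Fin r) ℂ} {ι : Type} {κ : Fin r → ι}
  {φ : ι → ℂ → ℂ} {V : ℂ → Matrix (Fin r) (Fin r) ℂ} {U : Set ℂ} {t₀ δ : ℝ}

/-- Solving `z + z⁻¹ = φ` on each branch gives half of the roots, and their inverses the other half.
At a point of `Γ₀` some branch has a value in `(-2, 2)`; it stays real and in `(-2, 2)` nearby,
which keeps a whole interval in `Γ₀`. -/
theorem RealLocalDiag.exists_localData [Finite ι] (h : RealLocalDiag A B κ φ V U t₀ δ)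
    (hA : A.IsHermitian) (hAdet : A.det ≠ 0) (ht₀ : (t₀ : ℂ) ∈ Gamma0 A B) :
    ∃ (a b : ℝ) (Ω : Set ℂ) (z : Fin (2 * r) → ℂ → ℂ) (V' : Matrix (Fin r) (Fin r) ℂ),
      IsAnalyticLabelling A B a b Ω z ∧ t₀ ∈ Set.Ioo a b ∧
        IsNullVectorMatrix A B t₀ (fun k => wFun z k t₀) V' := by
  have hI₀ : t₀ ∈ Set.Ioo (t₀ - δ) (t₀ + δ) := ⟨by linarith [h.pos], by linarith [h.pos]⟩
  have hU₀ := h.mem t₀ (Set.Ioo_subset_Icc_self hI₀)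
  choose α hα hαω using fun i => exists_analytic_add_inv (h.analytic i t₀ hU₀)
    (h.ne_two t₀ hU₀ i) (h.ne_neg_two t₀ hU₀ i)
  have hev : ∀ᶠ t in 𝓝 (t₀ : ℂ), t ∈ U ∧ (∀ i, AnalyticAt ℂ (α i) t) ∧
      ∀ i, α i t ≠ 0 ∧ α i t + (α i t)⁻¹ = φ i t :=
    (h.isOpen.eventually_mem hU₀).and
      ((Filter.eventually_all.2 fun i => (hα i).eventually_analyticAt).and
        (Filter.eventually_all.2 hαω))
  obtain ⟨Ω, hΩ, hΩo, hΩt⟩ := eventually_nhds_iff.1 hev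
  set z : Fin (2 * r) → ℂ → ℂ := fun k t => pairedList (fun j => α (κ j) t) k with hz
  have hzrev : ∀ t k, z k.rev t = (z k t)⁻¹ := fun t k => pairedList_rev _ k
  have hzcast : ∀ (k : Fin r) t, z (k.castLE (by omega)) t = α (κ k) t := fun k t =>
    pairedList_castLE _ k
  have hz0 : ∀ t ∈ Ω, ∀ k, z k t ≠ 0 := fun t ht k => by
    simp only [hz, pairedList]
    split_ifs
    · exact ((hΩ t ht).2.2 _).1
    · exact inv_ne_zero ((hΩ t ht).2.2 _).1
  have hw : ∀ t ∈ Ω, ∀ k, wFun z k t = φ (κ k) t := fun t ht k => by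
    rw [wFun, hzcast, ((hΩ t ht).2.2 _).2]
  have hnull : ∀ t ∈ Ω, ∀ k, (wFun z k t • A + B - t • 1) *ᵥ (fun i => V t i k) = 0 :=
    fun t ht k => by
      rw [hw t ht]
      exact h.null t (hΩ t ht).1 k
  have hroots : ∀ t ∈ Ω, IsRootList A B t fun k => z k t := fun t ht =>
    isRootList_of_pairing hA hAdet (h.det_ne_zero t (hΩ t ht).1) (hz0 t ht) (hzrev t)
      (hnull t ht)
  have hΓ : ∀ t ∈ Ω, t ∈ Gamma0 A B ↔ ∃ k, ∃ s ∈ Set.Ioo (-2 : ℝ) 2, φ (κ k) t = (s : ℂ) := by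
    intro t ht
    rw [mem_Gamma0_iff (hz0 t ht) (hzrev t) (hroots t ht)]
    have hk : ∀ k : Fin r, ‖z (k.castLE (by omega)) t‖ = 1 ↔
        ∃ s ∈ Set.Ioo (-2 : ℝ) 2, φ (κ k) t = (s : ℂ) := fun k => by
      have h1 := hw t ht k
      rw [← h1]
      refine norm_eq_one_iff_add_inv (hz0 t ht _) ?_ ?_
      · exact fun e => h.ne_two t (hΩ t ht).1 (κ k) (h1 ▸ e)
      · exact fun e => h.ne_neg_two t (hΩ t ht).1 (κ k) (h1 ▸ e)
    constructor
    · rintro ⟨k, hk1⟩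
      by_cases hkr : (k : ℕ) < r
      · exact ⟨⟨k, hkr⟩, (hk _).1 hk1⟩
      · refine ⟨⟨k.rev, by rw [Fin.val_rev]; omega⟩, (hk _).1 ?_⟩
        change ‖z k.rev t‖ = 1
        rw [hzrev, norm_inv, hk1, inv_one]
    · rintro ⟨k, hk1⟩
      exact ⟨_, (hk k).2 hk1⟩
  obtain ⟨k, s, hs, hks⟩ := (hΓ t₀ hΩt).1 ht₀
  have hreal : star (φ (κ k) t₀) = φ (κ k) t₀ := by
    rw [hks]
    exact Complex.conj_ofReal s
  have hsre : (φ (κ k) t₀).re ∈ Set.Ioo (-2 : ℝ) 2 := by rwa [hks, Complex.ofReal_re]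
  have hnear : ∀ᶠ x : ℝ in 𝓝 t₀, (x : ℂ) ∈ Ω ∧ x ∈ Set.Ioo (t₀ - δ) (t₀ + δ) ∧
      (φ (κ k) x).re ∈ Set.Ioo (-2 : ℝ) 2 :=
    (Complex.continuous_ofReal.continuousAt.eventually_mem (hΩo.mem_nhds hΩt)).and
      ((isOpen_Ioo.eventually_mem hI₀).and
        ((h.hasDerivAt_re hU₀ (κ k)).continuousAt.eventually_mem (isOpen_Ioo.mem_nhds hsre)))
  obtain ⟨ε, hε, hball⟩ := Metric.eventually_nhds_iff.1 hnear
  have hIoo : ∀ x ∈ Set.Ioo (t₀ - ε) (t₀ + ε), dist x t₀ < ε := fun x hx => by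
    rw [Real.dist_eq, abs_lt]
    exact ⟨by linarith [hx.1], by linarith [hx.2]⟩
  obtain ⟨V', hV'⟩ := exists_isNullVectorMatrix (h.det_ne_zero t₀ hU₀) (hnull t₀ hΩt)
  refine ⟨t₀ - ε, t₀ + ε, Ω, z, V',
    ⟨fun x hx => ?_, hΩo, fun x hx => (hball (hIoo x hx)).1, fun k t ht => ?_, hroots,
      fun t _ k => hzrev t k⟩, ⟨by linarith, by linarith⟩, hV'⟩
  · obtain ⟨h1, h2, h3⟩ := hball (hIoo x hx)
    exact (hΓ x h1).2 ⟨k, _, h3, h.eq_re hreal (Set.Ioo_subset_Icc_self h2)⟩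
  · by_cases hkr : (k : ℕ) < r
    · simp only [hz, pairedList, dif_pos hkr]
      exact (hΩ t ht).2.1 _
    · simp only [hz, pairedList, dif_neg hkr]
      exact ((hΩ t ht).2.1 _).inv ((hΩ t ht).2.2 _).1

end Existence

/-! ### Independence of the labelling and of the eigenvectors -/

section Labellings

variable {r : ℕ} {A B : Matrix (Fin r) (Fin r) ℂ} {ι : Type} {κ : Fin r → ι}
  {φ : ι → ℂ → ℂ} {V : ℂ → Matrix (Fin r) (Fin r) ℂ} {U : Set ℂ} {t₀ δ : ℝ}

/-- The functions `w_k` of an arbitrary labelling agree locally with branches of eigenvalues. -/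
theorem LocalDiag.exists_wFun_eventuallyEq [Finite ι] (h : LocalDiag A B κ φ V U)
    (hA : A.IsHermitian) (hAdet : A.det ≠ 0) {a b : ℝ} {Ω : Set ℂ} {z : Fin (2 * r) → ℂ → ℂ}
    (hL : IsAnalyticLabelling A B a b Ω z) {x : ℂ} (hxU : x ∈ U) (hxΩ : x ∈ Ω) (k : Fin r) :
    ∃ i, wFun z k =ᶠ[𝓝 x] φ i := by
  have hbranch : ∀ y ∈ U ∩ Ω, ∃ i, φ i y = wFun z k y := fun y hy => by
    obtain ⟨j, hj⟩ := (h.det_eq_zero_iff hAdet hy.1).1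
      ((hL.roots y hy.2).det_eq_zero hA hAdet (k.castLE (by omega)))
    exact ⟨κ j, hj⟩
  have hcont : ContinuousAt (wFun z k) x := by
    have h1 := (hL.analytic (k.castLE (by omega)) x hxΩ).continuousAt
    exact h1.add (h1.inv₀ ((hL.roots x hxΩ).ne_zero hAdet _))
  obtain ⟨i, hi⟩ := hbranch x ⟨hxU, hxΩ⟩
  refine ⟨i, ?_⟩
  -- At each nearby point `wFun z k` takes the value of some branch; by continuity it cannot jump to
  -- one with a different value at `x`.
  have hne : ∀ᶠ y in 𝓝 x, ∀ j, j ≠ i → φ j y ≠ wFun z k y := by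
    refine Filter.eventually_all.2 fun j => ?_
    by_cases hji : j = i
    · exact Filter.Eventually.of_forall fun y hy => absurd hji hy
    · have h1 := ((h.analytic j x hxU).continuousAt.sub hcont).eventually_ne
        (sub_ne_zero.2 fun e => hji (h.injective x hxU (e.trans hi.symm)))
      exact h1.mono fun y hy _ => sub_ne_zero.1 hy
  filter_upwards [hne, (h.isOpen.inter hL.isOpen).mem_nhds ⟨hxU, hxΩ⟩] with y hy hyU
  obtain ⟨j, hj⟩ := hbranch y hyU
  by_cases hji : j = i
  · rw [← hj, hji]
  · exact absurd hj (hy j hji)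

/-- A function of the pencil does not depend on the choice of eigenvectors. -/
theorem LocalDiag.mul_diagonal_mul_inv_eq (h : LocalDiag A B κ φ V U) (hAdet : A.det ≠ 0) {x : ℂ}
    (hx : x ∈ U) {κ' : Fin r → ι} {V' : Matrix (Fin r) (Fin r) ℂ} (hV' : IsUnit V'.det)
    (hnull : ∀ k, (φ (κ' k) x • A + B - x • 1) *ᵥ (fun i => V' i k) = 0) (g : ι → ℂ) :
    V x * (diagonal fun k => g (κ k)) * (V x)⁻¹ = V' * (diagonal fun k => g (κ' k)) * V'⁻¹ := by
  -- The change of basis `(V x)⁻¹ * V'` only relates columns of the same class, so it intertwines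
  -- the two diagonal matrices.
  have h1 : (diagonal fun k => g (κ k)) * ((V x)⁻¹ * V') =
      (V x)⁻¹ * V' * diagonal fun k => g (κ' k) := by
    ext j k
    rw [Matrix.diagonal_mul, Matrix.mul_diagonal]
    by_cases hjk : κ j = κ' k
    · rw [hjk, mul_comm]
    · have : ((V x)⁻¹ * V') j k = 0 :=
        h.coeff_eq_zero hAdet hx (hnull k) fun e => hjk (h.injective x hx e)
      rw [this, mul_zero, zero_mul]
  have h2 := congrArg (fun N => V x * N * V'⁻¹) h1
  calc V x * (diagonal fun k => g (κ k)) * (V x)⁻¹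
      = V x * ((diagonal fun k => g (κ k)) * ((V x)⁻¹ * V')) * V'⁻¹ := by
        rw [← mul_assoc, ← mul_assoc, mul_assoc _ V', Matrix.mul_nonsing_inv _ hV', mul_one]
    _ = V x * ((V x)⁻¹ * V' * diagonal fun k => g (κ' k)) * V'⁻¹ := h2
    _ = V' * (diagonal fun k => g (κ' k)) * V'⁻¹ := by
        rw [← mul_assoc, ← mul_assoc, h.mul_inv hx, one_mul]

-- The labelling's `w_k` have the germs of branches, hence the same values and derivatives. On real
-- branches the indicator is already enforced by the vanishing of `ρ`; on nonreal branches it fails,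
-- matching their absence from `S`.
open Classical in
theorem RealLocalDiag.localDensity_eq_of_labelling [Finite ι] (h : RealLocalDiag A B κ φ V U t₀ δ)
    (hA : A.IsHermitian) (hAdet : A.det ≠ 0) {ρ : ℝ → ℝ}
    (hρ : ∀ w, w ∉ Set.Ioo (-2 : ℝ) 2 → ρ w = 0) {S : Finset ι}
    (hS : ∀ i, i ∈ S ↔ star (φ i t₀) = φ i t₀) {a b : ℝ} {Ω : Set ℂ} {z : Fin (2 * r) → ℂ → ℂ}
    (hL : IsAnalyticLabelling A B a b Ω z) {x : ℝ} (hx : x ∈ Set.Icc (t₀ - δ) (t₀ + δ))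
    (hxΩ : (x : ℂ) ∈ Ω) {V' : Matrix (Fin r) (Fin r) ℂ}
    (hV' : IsNullVectorMatrix A B x (fun k => wFun z k x) V') :
    localDensity A κ φ V ρ S x = V' * (diagonal fun k =>
      if ∃ t ∈ Set.Ioo (-2 : ℝ) 2, wFun z k x = (t : ℂ) then
        ((ρ (wFun z k x).re * Real.sign (deriv (wFun z k) x).re : ℝ) : ℂ) else 0) * V'⁻¹ * A⁻¹ := by
  have hxU := h.mem x hx
  choose κ' hκ' using h.exists_wFun_eventuallyEq hA hAdet hL hxU hxΩ
  have hval : ∀ k, wFun z k x = φ (κ' k) x := fun k => (hκ' k).eq_of_nhds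
  rw [localDensity_eq, h.mul_diagonal_mul_inv_eq hAdet hxU hV'.isUnit_det
    (fun k => by rw [← hval]; exact hV'.null k) fun i => if i ∈ S then
      ((ρ (φ i x).re * Real.sign (deriv (φ i) x).re : ℝ) : ℂ) else 0]
  congr 4
  funext k
  rw [hval, (hκ' k).deriv_eq]
  by_cases hk : κ' k ∈ S
  · have hre := h.eq_re ((hS _).1 hk) hx
    rw [if_pos hk]
    by_cases hI : (φ (κ' k) x).re ∈ Set.Ioo (-2 : ℝ) 2
    · rw [if_pos ⟨_, hI, hre⟩]
    · rw [hρ _ hI, zero_mul, Complex.ofReal_zero, ite_self]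
  · rw [if_neg hk, if_neg]
    rintro ⟨t, -, ht⟩
    refine h.star_ne _ (fun e => hk ((hS _).2 e)) x hx ?_
    rw [ht]
    exact Complex.conj_ofReal t

theorem finite_setOf_eval_ofReal_eq_zero {p : ℂ[X]} (hp : p ≠ 0) :
    {x : ℝ | p.eval (x : ℂ) = 0}.Finite := by
  have h1 := (p.rootSet_finite ℂ).preimage (f := Complex.ofReal) Complex.ofReal_injective.injOn
  refine h1.subset fun x hx => ?_
  rw [Set.mem_preimage, mem_rootSet]
  exact ⟨hp, by simpa using hx⟩

theorem det_sub_smul_one_eq (M : Matrix (Fin r) (Fin r) ℂ) (t : ℂ) :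
    (M - t • 1).det = (-1) ^ r * M.charpoly.eval t := by
  rw [Matrix.eval_charpoly, ← neg_sub, Matrix.det_neg, Fintype.card_fin, ← Algebra.algebraMap_eq_smul_one]
  rfl

/-- All but finitely many real points are centres of a local diagonalization. -/
theorem ae_exists_realLocalDiag (hA : A.IsHermitian) (hAdet : A.det ≠ 0) (hB : B.IsHermitian) :
    ∀ᵐ x : ℝ, ∃ (ι : Type) (_ : Fintype ι) (κ : Fin r → ι) (φ : ι → ℂ → ℂ)
      (V : ℂ → Matrix (Fin r) (Fin r) ℂ) (U : Set ℂ) (δ : ℝ), RealLocalDiag A B κ φ V U x δ := by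
  obtain ⟨d, hd, hloc⟩ := exists_localDiag hA hAdet hB
  -- The excluded points are the zeros of `d` and the eigenvalues of `±2 A + B`, where some branch
  -- could take the value `±2`.
  have hp : d * ((2 : ℂ) • A + B).charpoly * ((-2 : ℂ) • A + B).charpoly ≠ 0 :=
    mul_ne_zero (mul_ne_zero hd (Matrix.charpoly_monic _).ne_zero) (Matrix.charpoly_monic _).ne_zero
  refine measure_mono_null (fun x hx => ?_)
    ((finite_setOf_eval_ofReal_eq_zero hp).measure_zero volume)
  by_contra hne
  refine hx ?_
  simp only [Set.mem_ofPred_eq, eval_mul, mul_eq_zero, not_or] at hne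
  obtain ⟨⟨h1, h2⟩, h3⟩ := hne
  have h0 : (-1 : ℂ) ^ r ≠ 0 := pow_ne_zero _ (by norm_num)
  obtain ⟨ι, hι, κ, φ, V, U, hxU, h⟩ := hloc x h1
  obtain ⟨U', δ, -, h'⟩ := h.exists_realLocalDiag hA hAdet hB hxU
    (by rw [det_sub_smul_one_eq]; exact mul_ne_zero h0 h2)
    (by rw [det_sub_smul_one_eq]; exact mul_ne_zero h0 h3)
  exact ⟨ι, hι, κ, φ, V, U', δ, h'⟩

theorem chebFirst_eq (A : Matrix (Fin r) (Fin r) ℂ) :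
    chebFirst A = fun m => (((if m = 1 then √2 else 1 : ℝ)) : ℂ) • A := by
  funext m
  rw [chebFirst]
  split_ifs <;> simp

theorem chebSecond_eq (A : Matrix (Fin r) (Fin r) ℂ) :
    chebSecond A = fun _ => ((1 : ℝ) : ℂ) • A := by
  funext m
  rw [chebSecond, Complex.ofReal_one, one_smul]

/-- The exceptional null set depends only on the fixed local diagonalization. This is why the
quantifier over the uncountably many labellings can stand inside the almost-everywhere statement. -/
theorem RealLocalDiag.ae_densities [Fintype ι] (h : RealLocalDiag A B κ φ V U t₀ δ)
    (hA : A.IsHermitian) (hAdet : A.det ≠ 0) (hB : B.IsHermitian)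
    {X W : VectorMeasure ℝ (Matrix (Fin r) (Fin r) ℂ)}
    (hX : IsSpectralMeasure (chebFirst A) (fun _ => B) X)
    (hW : IsSpectralMeasure (chebSecond A) (fun _ => B) W) :
    ∀ᵐ x ∂(volume.restrict (Set.Ioo (t₀ - δ) (t₀ + δ))),
      ∀ (a b : ℝ) (Ω : Set ℂ) (z : Fin (2 * r) → ℂ → ℂ) (V' : Matrix (Fin r) (Fin r) ℂ),
        IsAnalyticLabelling A B a b Ω z → x ∈ Set.Ioo a b →
        IsNullVectorMatrix A B x (fun k => wFun z k x) V' →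
        acDensity X x = V' * lambdaX (fun k => wFun z k x)
            (fun k => deriv (wFun z k) x) * V'⁻¹ * A⁻¹ ∧
        acDensity W x = V' * lambdaW (fun k => wFun z k x)
            (fun k => deriv (wFun z k) x) * V'⁻¹ * A⁻¹ := by
  classical
  rw [chebFirst_eq] at hX
  rw [chebSecond_eq] at hW
  set S : Finset ι := Finset.univ.filter fun i => star (φ i t₀) = φ i t₀ with hS
  have hmem : ∀ i, i ∈ S ↔ star (φ i t₀) = φ i t₀ := fun i => by simp [hS]
  filter_upwards [ae_restrict_mem measurableSet_Ioo,
    h.acDensity_ae_eq hA hAdet hB measurable_arcsineDensity arcsineDensity_nonneg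
      continuousOn_arcsineDensity hmem isScalarSystem_arcsine hX,
    h.acDensity_ae_eq hA hAdet hB continuous_semicircleDensity.measurable semicircleDensity_nonneg
      continuous_semicircleDensity.continuousOn hmem isScalarSystem_semicircle hW]
    with x hx hxX hxW a b Ω z V' hL hab hV'
  have hxI := Set.Ioo_subset_Icc_self hx
  have hxΩ := hL.subset_nhd x hab
  rw [hxX, hxW, h.localDensity_eq_of_labelling hA hAdet (fun w => arcsineDensity_eq_zero) hmem hL
    hxI hxΩ hV', h.localDensity_eq_of_labelling hA hAdet (fun w => semicircleDensity_eq_zero) hmem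
    hL hxI hxΩ hV']
  constructor
  · congr 4
    funext k
    refine if_congr Iff.rfl (congrArg _ ?_) rfl
    rw [arcsineDensity]
    ring
  · congr 4
    funext k
    refine if_congr Iff.rfl (congrArg _ ?_) rfl
    rw [semicircleDensity]
    ring

end Labellings

end MatrixChebyshev

/-! ### The main theorem -/

theorem proposition4p2 {r : ℕ} (A B : Matrix (Fin r) (Fin r) ℂ)
    (hA : A.IsHermitian) (hAdet : A.det ≠ 0) (hB : B.IsHermitian)
    (X W : MeasureTheory.VectorMeasure ℝ (Matrix (Fin r) (Fin r) ℂ))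
    (hX : MatrixChebyshev.IsSpectralMeasure (MatrixChebyshev.chebFirst A) (fun _ => B) X)
    (hW : MatrixChebyshev.IsSpectralMeasure (MatrixChebyshev.chebSecond A) (fun _ => B) W) :
    ∀ᵐ x : ℝ, (x : ℂ) ∈ MatrixChebyshev.Gamma0 A B →
      (∃ (a b : ℝ) (Ω : Set ℂ) (z : Fin (2 * r) → ℂ → ℂ) (V : Matrix (Fin r) (Fin r) ℂ),
        MatrixChebyshev.IsAnalyticLabelling A B a b Ω z ∧ x ∈ Set.Ioo a b ∧
        MatrixChebyshev.IsNullVectorMatrix A B x (fun k => MatrixChebyshev.wFun z k x) V) ∧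
      ∀ (a b : ℝ) (Ω : Set ℂ) (z : Fin (2 * r) → ℂ → ℂ) (V : Matrix (Fin r) (Fin r) ℂ),
        MatrixChebyshev.IsAnalyticLabelling A B a b Ω z → x ∈ Set.Ioo a b →
        MatrixChebyshev.IsNullVectorMatrix A B x (fun k => MatrixChebyshev.wFun z k x) V →
        MatrixChebyshev.acDensity X x =
            V * MatrixChebyshev.lambdaX (fun k => MatrixChebyshev.wFun z k x)
              (fun k => deriv (MatrixChebyshev.wFun z k) x) * V⁻¹ * A⁻¹ ∧
        MatrixChebyshev.acDensity W x =
            V * MatrixChebyshev.lambdaW (fun k => MatrixChebyshev.wFun z k x)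
              (fun k => deriv (MatrixChebyshev.wFun z k) x) * V⁻¹ * A⁻¹ := by
  have hgood := MatrixChebyshev.ae_exists_realLocalDiag hA hAdet hB
  set Q : ℝ → Prop := fun x => ∀ (a b : ℝ) (Ω : Set ℂ) (z : Fin (2 * r) → ℂ → ℂ)
    (V : Matrix (Fin r) (Fin r) ℂ),
      MatrixChebyshev.IsAnalyticLabelling A B a b Ω z → x ∈ Set.Ioo a b →
      MatrixChebyshev.IsNullVectorMatrix A B x (fun k => MatrixChebyshev.wFun z k x) V →
      MatrixChebyshev.acDensity X x =
          V * MatrixChebyshev.lambdaX (fun k => MatrixChebyshev.wFun z k x)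
            (fun k => deriv (MatrixChebyshev.wFun z k) x) * V⁻¹ * A⁻¹ ∧
      MatrixChebyshev.acDensity W x =
          V * MatrixChebyshev.lambdaW (fun k => MatrixChebyshev.wFun z k x)
            (fun k => deriv (MatrixChebyshev.wFun z k) x) * V⁻¹ * A⁻¹ with hQ
  set G : Set ℝ := {x | ∃ (ι : Type) (_ : Fintype ι) (κ : Fin r → ι) (φ : ι → ℂ → ℂ)
    (V : ℂ → Matrix (Fin r) (Fin r) ℂ) (U : Set ℂ) (δ : ℝ),
      MatrixChebyshev.RealLocalDiag A B κ φ V U x δ} with hG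
  -- Each point of `G` has a neighbourhood on which failure of `Q` is a null event; on the second
  -- countable line a locally null set is null.
  have hnull : MeasureTheory.volume {x | x ∈ G ∧ ¬ Q x} = 0 := by
    refine MeasureTheory.measure_null_of_locally_null _ fun t₀ ht₀ => ?_
    obtain ⟨⟨ι, hι, κ, φ, V, U, δ, h⟩, -⟩ := ht₀
    have hI : Set.Ioo (t₀ - δ) (t₀ + δ) ∈ nhds t₀ :=
      Ioo_mem_nhds (by linarith [h.pos]) (by linarith [h.pos])
    refine ⟨Set.Ioo (t₀ - δ) (t₀ + δ) ∩ {x | x ∈ G ∧ ¬ Q x},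
      Filter.inter_mem (mem_nhdsWithin_of_mem_nhds hI) self_mem_nhdsWithin, ?_⟩
    have := (MeasureTheory.ae_restrict_iff' measurableSet_Ioo).1
      (h.ae_densities hA hAdet hB hX hW)
    refine MeasureTheory.measure_mono_null (fun x hx => ?_) this
    exact fun hx' => hx.2.2 (hx' hx.1)
  have hnull' : ∀ᵐ x : ℝ, ¬ (x ∈ G ∧ ¬ Q x) := by
    rw [MeasureTheory.ae_iff]
    simpa using hnull
  filter_upwards [hgood, hnull'] with x hx hxQ hxΓ
  refine ⟨?_, by_contra fun hne => hxQ ⟨hx, hne⟩⟩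
  obtain ⟨ι, hι, κ, φ, V, U, δ, h⟩ := hx
  exact h.exists_localData hA hAdet hxΓ
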